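/- Consider the half-duplex multiple-access relay channel with two sources, one relay and one destination. A block of $l=n+m$ channel uses is split into two slots of lengths $n$ and $m$, with outputs $$y_{D1}=h_{1D}x_{11}+h_{2D}x_{21}+z_{D1},\qquad y_R=h_{1R}x_{11}+h_{2R}x_{21}+z_R,\qquad y_{D2}=h_{1D}x_{12}+h_{2D}x_{22}+h_{RD}x_R+z_{D2}$$ (the first two in slot 1, the third in slot 2). The noises are i.i.d. $\mathcal{CN}(0,1)$; the coefficients $\mathbf h=(h_{1D},h_{2D},h_{1R},h_{2R},h_{RD})$ are independent, $h_{ij}\sim\mathcal{CN}(0,\sigma_{ij}^2)$ with $\sigma_{ij}^2>0$, and constant over the block; each transmitted sequence has average power at most $\mathrm{SNR}$ in each slot. Write $f\doteq \mathrm{SNR}^{d}$ if $\lim_{\mathrm{SNR}\to\infty}\log f(\mathrm{SNR})/\log \mathrm{SNR}=d$. *The GQF scheme.* Fix $\beta\in(0,1)$ and $R_U>0$. Let $X_{11},X_{21},X_{12},X_{22},X_R\sim\mathcal{CN}(0,\mathrm{SNR})$, $Z_{D1},Z_{D2},Z_R\sim\mathcal{CN}(0,1)$ and $Z_Q\sim\mathcal{CN}(0,\sigma_Q^2)$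 be independent, let $Y_{D1},Y_R,Y_{D2}$ be the channel outputs given $\mathbf h$, and let $\hat Y_R=Y_R+Z_Q$. The relay takes $\sigma_Q^2=(1+|h_{1R}|^2\mathrm{SNR}+|h_{2R}|^2\mathrm{SNR})/(e^{R_U/\beta}-1)$, which does not depend on $h_{RD}$. The scheme with rates $(R_1,R_2,R_U)$ is in outage at $\mathbf h$ if at least one of the following holds: $$\begin{aligned} R_1&>\beta I(X_{11};Y_{D1},\hat Y_R|X_{21})+(1-\beta)I(X_{12};Y_{D2}|X_{22},X_R),\\ R_1+R_U&>\beta[I(X_{11},\hat Y_R;X_{21},Y_{D1})+I(X_{11};\hat Y_R)]+(1-\beta)I(X_{12},X_R;Y_{D2}|X_{22}),\\ R_2&>\beta I(X_{21};Y_{D1},\hat Y_R|X_{11})+(1-\beta)I(X_{22};Y_{D2}|X_{12},X_R),\\ R_2+R_U&>\beta[I(X_{21},\hat Y_R;X_{11},Y_{D1})+I(X_{21};\hat Y_R)]+(1-\beta)I(X_{22},X_R;Y_{D2}|X_{12}),\\ R_1+R_2&>\beta I(X_{11},X_{21};Y_{D1},\hat Y_R)+(1-\beta)I(X_{12},X_{22};Y_{D2}|X_R),\\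 R_1+R_2+R_U&>\beta[I(X_{11},X_{21},\hat Y_R;Y_{D1})+I(X_{11},X_{21};\hat Y_R)]+(1-\beta)I(X_{12},X_{22},X_R;Y_{D2}). \end{aligned}$$ Let $P_{out}(\mathrm{SNR};r,\beta,r_U)$ be the probability over $\mathbf h$ of outage when $R_1=R_2=\frac r2\log\mathrm{SNR}$ and $R_U=r_U\log\mathrm{SNR}$. Put $$d(r)=\begin{cases}2-r,&0\le r\le\frac12,\\ 3(1-r),&\frac12\le r\le1.\end{cases}$$ **Proposition.** 1. The relay's choice of $\sigma_Q^2$ satisfies $\beta I(Y_R;\hat Y_R)=R_U$ for every $\mathbf h$ and every $\mathrm{SNR}>0$. 2. The GQF scheme with $\beta=r_U=\frac12$ achieves the diversity-multiplexing tradeoff $d$: $P_{out}(\mathrm{SNR};r,\frac12,\frac12)\doteq\mathrm{SNR}^{-d(r)}$ for all $0\le r\le1$. 3. No other parameters do better: for all $0<r\le1$, $\beta\in(0,1)$ and $r_U>0$, $\limsup_{\mathrm{SNR}\to\infty}\big(-\log P_{out}(\mathrm{SNR};r,\beta,r_U)/\log\mathrm{SNR}\big)\le d(r)$. 4. $d$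 is optimal for the channel. Let $0<r\le1$ and, for each $\mathrm{SNR}$, take any block code (of any slot lengths $n,m$ with $n+m\geq 1$) in which the sources do not know $\mathbf h$, the relay's slot-2 sequence is a measurable function of $\mathbf h$ and its slot-1 output, the destination decodes both messages from $\mathbf h$ and its outputs, and the power constraints hold for all large $\mathrm{SNR}$. If the rate of each source, divided by $\log\mathrm{SNR}$, tends to $r/2$, then the average error probability $P_e$ satisfies $\limsup_{\mathrm{SNR}\to\infty}\big(-\log P_e(\mathrm{SNR})/\log\mathrm{SNR}\big)\le d(r)$. -/

import Mathlib

open MeasureTheory ProbabilityTheory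
open scoped NNReal ENNReal Topology

noncomputable section

namespace HDMARC

/-! ### Mutual information -/

section Information

variable {Ω A B C : Type*} [MeasurableSpace Ω] [MeasurableSpace A] [MeasurableSpace B]
  [MeasurableSpace C]

/-- Mutual information `I(X; Y)` in nats: the Kullback-Leibler divergence of the joint law from the
product of the marginal laws. -/
def mutualInfo (μ : Measure Ω) (X : Ω → A) (Y : Ω → B) : ℝ≥0∞ :=
  InformationTheory.klDiv (μ.map fun ω => (X ω, Y ω)) ((μ.map X).prod (μ.map Y))

/-- Conditional mutual information `I(X; Y | Z)` in nats: the average over `z` of the mutual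
information of the conditional law of `(X, Y)` given `Z = z`. -/
def condMutualInfo [StandardBorelSpace A] [Nonempty A] [StandardBorelSpace B] [Nonempty B]
    (μ : Measure Ω) [IsFiniteMeasure μ] (X : Ω → A) (Y : Ω → B) (Z : Ω → C) : ℝ≥0∞ :=
  ∫⁻ z, InformationTheory.klDiv (condDistrib (fun ω => (X ω, Y ω)) Z μ z)
    ((condDistrib X Z μ z).prod (condDistrib Y Z μ z)) ∂(μ.map Z)

end Information

/-! ### Rayleigh fading -/

/-- The circularly symmetric complex Gaussian law `CN(0, v)`. -/
def complexGaussian (v : ℝ≥0) : Measure ℂ :=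
  ((gaussianReal 0 (v / 2)).prod (gaussianReal 0 (v / 2))).map Complex.measurableEquivRealProd.symm

instance (v : ℝ≥0) : IsProbabilityMeasure (complexGaussian v) :=
  Measure.isProbabilityMeasure_map Complex.measurableEquivRealProd.symm.measurable.aemeasurable

/-- The five links: source 1 and 2 to destination, source 1 and 2 to relay, relay to destination. -/
inductive Link
  | s1D | s2D | s1R | s2R | rD
  deriving DecidableEq

instance : Fintype Link :=
  ⟨{.s1D, .s2D, .s1R, .s2R, .rD}, fun x => by cases x <;> decide⟩

/-- The law of the channel coefficients: independent `CN(0, v i)`. -/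
def fadingLaw (v : Link → ℝ≥0) : Measure (Link → ℂ) :=
  Measure.pi fun i => complexGaussian (v i)

instance (v : Link → ℝ≥0) : IsProbabilityMeasure (fadingLaw v) := by
  unfold fadingLaw; infer_instance

/-! ### The generalized quantize-and-forward scheme -/

/-- The independent generic signals: the inputs of the sources in the two slots and of the relay,
the noises at the destination in the two slots and at the relay, and the quantization noise. -/
inductive Sig
  | x11 | x21 | x12 | x22 | xR | zD1 | zD2 | zR | zQ
  deriving DecidableEq

instance : Fintype Sig :=
  ⟨{.x11, .x21, .x12, .x22, .xR, .zD1, .zD2, .zR, .zQ}, fun x => by cases x <;> decide⟩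

/-- Variances of the generic signals: inputs have power `snr`, channel noises have variance 1 and
the quantization noise has variance `q`. -/
def sigVar (snr : ℝ) (q : ℝ≥0) : Sig → ℝ≥0
  | .x11 | .x21 | .x12 | .x22 | .xR => snr.toNNReal
  | .zD1 | .zD2 | .zR => 1
  | .zQ => q

/-- The joint law of the generic signals. -/
def sigLaw (snr : ℝ) (q : ℝ≥0) : Measure (Sig → ℂ) :=
  Measure.pi fun i => complexGaussian (sigVar snr q i)

instance (snr : ℝ) (q : ℝ≥0) : IsProbabilityMeasure (sigLaw snr q) := by
  unfold sigLaw; infer_instance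

def X11 (ω : Sig → ℂ) : ℂ := ω .x11
def X21 (ω : Sig → ℂ) : ℂ := ω .x21
def X12 (ω : Sig → ℂ) : ℂ := ω .x12
def X22 (ω : Sig → ℂ) : ℂ := ω .x22
def XR (ω : Sig → ℂ) : ℂ := ω .xR

/-- Output at the destination in the first slot. -/
def YD1 (h : Link → ℂ) (ω : Sig → ℂ) : ℂ := h .s1D * ω .x11 + h .s2D * ω .x21 + ω .zD1

/-- Output at the relay in the first slot. -/
def YR (h : Link → ℂ) (ω : Sig → ℂ) : ℂ := h .s1R * ω .x11 + h .s2R * ω .x21 + ω .zR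

/-- Output at the destination in the second slot. -/
def YD2 (h : Link → ℂ) (ω : Sig → ℂ) : ℂ :=
  h .s1D * ω .x12 + h .s2D * ω .x22 + h .rD * ω .xR + ω .zD2

/-- The quantized relay observation. -/
def YQ (h : Link → ℂ) (ω : Sig → ℂ) : ℂ := YR h ω + ω .zQ

/-- The variance of the quantization noise that the relay chooses for the fixed rate `RU`, that is
the solution `q` of `RU = β * log (1 + (1 + |h₁R|² snr + |h₂R|² snr) / q)`. It depends on
the source-relay coefficients `a = h₁R` and `b = h₂R` only. -/
def quantVar (snr β RU : ℝ) (a b : ℂ) : ℝ≥0 :=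
  ((1 + ‖a‖ ^ 2 * snr + ‖b‖ ^ 2 * snr) / (Real.exp (RU / β) - 1)).toNNReal

/-- The law of the generic signals when the quantizer is tuned to the rate `RU`. -/
def gqfLaw (snr β RU : ℝ) (h : Link → ℂ) : Measure (Sig → ℂ) :=
  sigLaw snr (quantVar snr β RU (h .s1R) (h .s2R))

instance (snr β RU : ℝ) (h : Link → ℂ) : IsProbabilityMeasure (gqfLaw snr β RU h) := by
  unfold gqfLaw; infer_instance

/-! The six instantaneous mutual informations that bound, in this order,
`R₁`, `R₁ + RU`, `R₂`, `R₂ + RU`, `R₁ + R₂`, `R₁ + R₂ + RU`. -/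

def info1 (snr β RU : ℝ) (h : Link → ℂ) : ℝ≥0∞ :=
  ENNReal.ofReal β *
      condMutualInfo (gqfLaw snr β RU h) X11 (fun ω => (YD1 h ω, YQ h ω)) X21
    + ENNReal.ofReal (1 - β) *
      condMutualInfo (gqfLaw snr β RU h) X12 (YD2 h) (fun ω => (X22 ω, XR ω))

def info1u (snr β RU : ℝ) (h : Link → ℂ) : ℝ≥0∞ :=
  ENNReal.ofReal β *
      (mutualInfo (gqfLaw snr β RU h) (fun ω => (X11 ω, YQ h ω)) (fun ω => (X21 ω, YD1 h ω))
        + mutualInfo (gqfLaw snr β RU h) X11 (YQ h))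
    + ENNReal.ofReal (1 - β) *
      condMutualInfo (gqfLaw snr β RU h) (fun ω => (X12 ω, XR ω)) (YD2 h) X22

def info2 (snr β RU : ℝ) (h : Link → ℂ) : ℝ≥0∞ :=
  ENNReal.ofReal β *
      condMutualInfo (gqfLaw snr β RU h) X21 (fun ω => (YD1 h ω, YQ h ω)) X11
    + ENNReal.ofReal (1 - β) *
      condMutualInfo (gqfLaw snr β RU h) X22 (YD2 h) (fun ω => (X12 ω, XR ω))

def info2u (snr β RU : ℝ) (h : Link → ℂ) : ℝ≥0∞ :=
  ENNReal.ofReal β *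
      (mutualInfo (gqfLaw snr β RU h) (fun ω => (X21 ω, YQ h ω)) (fun ω => (X11 ω, YD1 h ω))
        + mutualInfo (gqfLaw snr β RU h) X21 (YQ h))
    + ENNReal.ofReal (1 - β) *
      condMutualInfo (gqfLaw snr β RU h) (fun ω => (X22 ω, XR ω)) (YD2 h) X12

def info12 (snr β RU : ℝ) (h : Link → ℂ) : ℝ≥0∞ :=
  ENNReal.ofReal β *
      mutualInfo (gqfLaw snr β RU h) (fun ω => (X11 ω, X21 ω)) (fun ω => (YD1 h ω, YQ h ω))
    + ENNReal.ofReal (1 - β) *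
      condMutualInfo (gqfLaw snr β RU h) (fun ω => (X12 ω, X22 ω)) (YD2 h) XR

def info12u (snr β RU : ℝ) (h : Link → ℂ) : ℝ≥0∞ :=
  ENNReal.ofReal β *
      (mutualInfo (gqfLaw snr β RU h) (fun ω => (X11 ω, X21 ω, YQ h ω)) (YD1 h)
        + mutualInfo (gqfLaw snr β RU h) (fun ω => (X11 ω, X21 ω)) (YQ h))
    + ENNReal.ofReal (1 - β) *
      mutualInfo (gqfLaw snr β RU h) (fun ω => (X12 ω, X22 ω, XR ω)) (YD2 h)

/-- The outage event of the GQF scheme: one of the six rate conditions fails. -/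
def gqfOutage (snr β R₁ R₂ RU : ℝ) : Set (Link → ℂ) :=
  {h | info1 snr β RU h < ENNReal.ofReal R₁} ∪
  {h | info1u snr β RU h < ENNReal.ofReal (R₁ + RU)} ∪
  {h | info2 snr β RU h < ENNReal.ofReal R₂} ∪
  {h | info2u snr β RU h < ENNReal.ofReal (R₂ + RU)} ∪
  {h | info12 snr β RU h < ENNReal.ofReal (R₁ + R₂)} ∪
  {h | info12u snr β RU h < ENNReal.ofReal (R₁ + R₂ + RU)}

/-- The outage probability of the GQF scheme, as a function of `snr`, at the rates
`R₁ = R₂ = (r / 2) log snr` and `RU = rU log snr`. -/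
def gqfOutageProb (v : Link → ℝ≥0) (β rU r snr : ℝ) : ℝ :=
  (fadingLaw v).real
    (gqfOutage snr β (r / 2 * Real.log snr) (r / 2 * Real.log snr) (rU * Real.log snr))

/-! ### Exponents -/

/-- `f(snr) ≐ snr ^ d`. -/
def DotEq (f : ℝ → ℝ) (d : ℝ) : Prop :=
  (∀ᶠ snr in Filter.atTop, 0 < f snr) ∧
    Filter.Tendsto (fun snr => Real.log (f snr) / Real.log snr) Filter.atTop (𝓝 d)

/-- The probability `f` does not decay faster than `snr ^ (-d)` on the exponential scale, that is
`limsup (- log f(snr) / log snr) ≤ d`. -/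
def DiversityAtMost (f : ℝ → ℝ) (d : ℝ) : Prop :=
  ∀ ε > 0, ∀ᶠ snr in Filter.atTop, snr ^ (-(d + ε)) ≤ f snr

/-- The diversity-multiplexing tradeoff curve. -/
def dmt (r : ℝ) : ℝ := if r ≤ 1 / 2 then 2 - r else 3 * (1 - r)

/-! ### Arbitrary half-duplex codes -/

/-- A block code for the half-duplex multiple-access relay channel with slots of lengths `n` and
`m`. The relay hears the first slot and transmits in the second. The sources do not know the
channel coefficients; the relay and the destination may use all of them. -/
structure Code where
  n : ℕ
  m : ℕ
  length_pos : 0 < n + m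
  M₁ : ℕ
  M₂ : ℕ
  M₁_pos : 0 < M₁
  M₂_pos : 0 < M₂
  enc₁₁ : Fin M₁ → Fin n → ℂ
  enc₁₂ : Fin M₁ → Fin m → ℂ
  enc₂₁ : Fin M₂ → Fin n → ℂ
  enc₂₂ : Fin M₂ → Fin m → ℂ
  relay : (Link → ℂ) × (Fin n → ℂ) → Fin m → ℂ
  measurable_relay : Measurable relay
  dec : (Link → ℂ) × (Fin n → ℂ) × (Fin m → ℂ) → Fin M₁ × Fin M₂
  measurable_dec : Measurable dec

namespace Code

/-- The power constraints on all transmitted sequences. -/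
def PowerConstraint (c : Code) (snr : ℝ) : Prop :=
  (∀ w, ∑ i, ‖c.enc₁₁ w i‖ ^ 2 ≤ c.n * snr) ∧
  (∀ w, ∑ i, ‖c.enc₁₂ w i‖ ^ 2 ≤ c.m * snr) ∧
  (∀ w, ∑ i, ‖c.enc₂₁ w i‖ ^ 2 ≤ c.n * snr) ∧
  (∀ w, ∑ i, ‖c.enc₂₂ w i‖ ^ 2 ≤ c.m * snr) ∧
  (∀ p, ∑ i, ‖c.relay p i‖ ^ 2 ≤ c.m * snr)

/-- The rates of the two sources, in nats per channel use. -/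
def rate₁ (c : Code) : ℝ := Real.log c.M₁ / (c.n + c.m)

def rate₂ (c : Code) : ℝ := Real.log c.M₂ / (c.n + c.m)

/-- The noise sequences: destination in the first slot, relay, destination in the second slot. -/
abbrev Noise (c : Code) : Type := (Fin c.n → ℂ) × (Fin c.n → ℂ) × (Fin c.m → ℂ)

def noiseLaw (c : Code) : Measure c.Noise :=
  (Measure.pi fun _ => complexGaussian 1).prod
    ((Measure.pi fun _ => complexGaussian 1).prod (Measure.pi fun _ => complexGaussian 1))

/-- Received sequence at the destination in the first slot. -/
def yD1 (c : Code) (w : Fin c.M₁ × Fin c.M₂) (h : Link → ℂ) (z : c.Noise) : Fin c.n → ℂ :=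
  fun i => h .s1D * c.enc₁₁ w.1 i + h .s2D * c.enc₂₁ w.2 i + z.1 i

/-- Received sequence at the relay in the first slot. -/
def yR (c : Code) (w : Fin c.M₁ × Fin c.M₂) (h : Link → ℂ) (z : c.Noise) : Fin c.n → ℂ :=
  fun i => h .s1R * c.enc₁₁ w.1 i + h .s2R * c.enc₂₁ w.2 i + z.2.1 i

/-- Received sequence at the destination in the second slot. -/
def yD2 (c : Code) (w : Fin c.M₁ × Fin c.M₂) (h : Link → ℂ) (z : c.Noise) : Fin c.m → ℂ :=
  fun i => h .s1D * c.enc₁₂ w.1 i + h .s2D * c.enc₂₂ w.2 i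
    + h .rD * c.relay (h, c.yR w h z) i + z.2.2 i

/-- The probability of decoding error, for uniform messages, averaged over fading and noise. -/
def errorProb (c : Code) (v : Link → ℝ≥0) : ℝ :=
  (∑ w : Fin c.M₁ × Fin c.M₂, ((fadingLaw v).prod c.noiseLaw).real
    {p | c.dec (p.1, c.yD1 w p.1 p.2, c.yD2 w p.1 p.2) ≠ w}) / (c.M₁ * c.M₂)

end Code

end HDMARC

end

/-! Write S for the SNR, a₁, a₂ for the squared gains from the sources to the destination, b₁, b₂
for those to the relay, g for the one from relay to destination. A squared gain of order S^(-α), α ≥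
0, costs probability S^(-α), independently over the links, so each claim becomes a question about
monomials in five gains.

Achievability. For Gaussian signals the mutual informations are logarithms of variance ratios
(`mutualInfo_gaussianChannel`, `mutualInfo_crossed`). In the three conditions that contain the
quantization rate the relay terms telescope to the single ratio (1 + q + b₁S + b₂S) / (1 + q). For β
= r_U = 1/2 the noise q is bounded in terms of b₁, b₂ alone (`one_add_quantVar_le`), so each outage
condition bounds a power of S times a polynomial in the gains by 2(1 + b₁)(1 + b₂). The exponents
that result are 2 - r for the conditions on one source, 4(1 - r) for the sum rate and 3(1 - r) for
the sum rate with the relay; all are at least d(r). Hence S^d(r) ≤ 4 `weight` on the outage event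
(`rpow_dmt_le_weight`). The weight is a product of independent factors with finite moments of every
order p < 1, and Markov's inequality with p near 1 finishes (`eventually_fadingLaw_le`).

Optimality within the scheme. The relay ratio has logarithm at most R_U / β (`log_relay_ratio_le`),
so R_U cancels and parameters no longer matter: outage is forced if a₁ and g are below about S^(-(1
- r/2)), at cost 2 - r, or if a₁, a₂ and g are below about S^(-(1 - r)), at cost 3(1 - r). For r = 0
the outage needs slightly weak relay links as well.

Optimality among all codes. The argument is a change of measure, valid at every block length. Unit
noise shifted by a signal of power at most σ per symbol has a law dominated by (e²σ)^k times white
noise of variance σ ≥ 8. That law does not depend on the message, so the probabilities of correct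
decoding, summed over messages, are at most (const · σ)^l; if this is below half the number of
messages, the error probability is at least 1/2 on the chosen fading event
(`half_measureReal_le_errorProb`). One event makes a₁, a₂, g small. The other makes a₁ and b₁ small
and of equal order: a genie reveals the second message, and subtracting a multiple of the
destination's output from the relay's removes the signal of source 1. What remains is noise
correlated with the destination's, and `lintegral_shear_whiteNoise_le` absorbs this correlation. -/

noncomputable section

namespace HDMARC

/-! ### The complex Gaussian law -/

/-- The density of `CN(0, v)` with respect to the area measure. -/
def complexGaussianPDF (v : ℝ≥0) (z : ℂ) : ℝ := (Real.pi * v)⁻¹ * Real.exp (-‖z‖ ^ 2 / v)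

lemma complexGaussianPDF_pos {v : ℝ≥0} (hv : 0 < v) (z : ℂ) : 0 < complexGaussianPDF v z := by
  unfold complexGaussianPDF; positivity

lemma measurable_complexGaussianPDF (v : ℝ≥0) : Measurable (complexGaussianPDF v) := by
  unfold complexGaussianPDF; fun_prop

lemma gaussianPDF_mul_gaussianPDF {v : ℝ≥0} (p : ℝ × ℝ) :
    gaussianPDF 0 (v / 2) p.1 * gaussianPDF 0 (v / 2) p.2
      = ENNReal.ofReal (complexGaussianPDF v (Complex.measurableEquivRealProd.symm p)) := by
  rw [gaussianPDF, gaussianPDF, ← ENNReal.ofReal_mul (gaussianPDFReal_nonneg _ _ _)]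
  congr 1
  simp only [gaussianPDFReal, complexGaussianPDF]
  have h1 : ‖Complex.measurableEquivRealProd.symm p‖ ^ 2 = p.1 ^ 2 + p.2 ^ 2 := by
    rw [Complex.sq_norm, Complex.normSq_apply]
    simp [Complex.measurableEquivRealProd_symm_apply]; ring
  have h2 : (√(2 * Real.pi * ((v / 2 : ℝ≥0) : ℝ)))⁻¹ * (√(2 * Real.pi * ((v / 2 : ℝ≥0) : ℝ)))⁻¹
      = (Real.pi * v)⁻¹ := by
    rw [← mul_inv, Real.mul_self_sqrt (by positivity)]
    congr 1
    push_cast; ring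
  rw [h1, mul_mul_mul_comm, h2, ← Real.exp_add]
  congr 2
  push_cast
  rcases eq_or_ne (v : ℝ) 0 with h | h
  · simp [h]
  · field_simp; ring

lemma complexGaussian_eq_withDensity {v : ℝ≥0} (hv : 0 < v) :
    complexGaussian v
      = (volume : Measure ℂ).withDensity fun z => ENNReal.ofReal (complexGaussianPDF v z) := by
  have hv2 : v / 2 ≠ 0 := by positivity
  have hm := (measurable_complexGaussianPDF v).ennreal_ofReal
  ext s hs
  rw [complexGaussian, Measure.map_apply Complex.measurableEquivRealProd.symm.measurable hs,
    gaussianReal_of_var_ne_zero _ hv2,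
    prod_withDensity (measurable_gaussianPDF _ _) (measurable_gaussianPDF _ _),
    withDensity_apply _ (Complex.measurableEquivRealProd.symm.measurable hs),
    withDensity_apply _ hs]
  simp_rw [gaussianPDF_mul_gaussianPDF]
  exact Complex.volume_preserving_equiv_real_prod.symm.setLIntegral_comp_preimage hs hm

lemma lintegral_complexGaussian {v : ℝ≥0} (hv : 0 < v) {f : ℂ → ℝ≥0∞} (hf : Measurable f) :
    ∫⁻ z, f z ∂complexGaussian v = ∫⁻ z, ENNReal.ofReal (complexGaussianPDF v z) * f z := by
  rw [complexGaussian_eq_withDensity hv,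
    lintegral_withDensity_eq_lintegral_mul _ (measurable_complexGaussianPDF v).ennreal_ofReal hf]
  rfl

lemma charFun_complexGaussian (v : ℝ≥0) (t : ℂ) :
    charFun (complexGaussian v) t = Complex.exp (-(v * ‖t‖ ^ 2 / 4)) := by
  rw [charFun_apply, complexGaussian,
    integral_map Complex.measurableEquivRealProd.symm.measurable.aemeasurable
      (by fun_prop)]
  have h : ∀ p : ℝ × ℝ, Complex.exp ((inner ℝ (Complex.measurableEquivRealProd.symm p) t : ℝ)
      * Complex.I) = Complex.exp (t.re * p.1 * Complex.I) * Complex.exp (t.im * p.2 * Complex.I) := by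
    intro p
    rw [← Complex.exp_add]
    congr 1
    simp [Complex.inner, Complex.measurableEquivRealProd_symm_apply]
    ring
  simp_rw [h]
  rw [integral_prod_mul (fun x : ℝ => Complex.exp (t.re * x * Complex.I))
    (fun x : ℝ => Complex.exp (t.im * x * Complex.I)), ← charFun_apply_real, ← charFun_apply_real,
    charFun_gaussianReal, charFun_gaussianReal, ← Complex.exp_add]
  congr 1
  have : ((‖t‖ ^ 2 : ℝ) : ℂ) = t.re ^ 2 + t.im ^ 2 := by
    rw [Complex.sq_norm, Complex.normSq_apply]; push_cast; ring
  push_cast at this ⊢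
  rw [this]; ring

/-- A linear form in independent complex Gaussian variables is complex Gaussian. -/
lemma map_linearForm_pi_complexGaussian {ι : Type*} [Fintype ι] (v : ι → ℝ≥0) (c : ι → ℂ) :
    (Measure.pi fun i => complexGaussian (v i)).map (fun ω => ∑ i, c i * ω i)
      = complexGaussian (∑ i, ‖c i‖₊ ^ 2 * v i) := by
  have hm : Measurable fun ω : ι → ℂ => ∑ i, c i * ω i := by fun_prop
  have : IsProbabilityMeasure ((Measure.pi fun i => complexGaussian (v i)).map
    (fun ω => ∑ i, c i * ω i)) := Measure.isProbabilityMeasure_map hm.aemeasurable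
  refine Measure.ext_of_charFun ?_
  funext t
  rw [charFun_complexGaussian, charFun_apply, integral_map hm.aemeasurable (by fun_prop)]
  have h : ∀ ω : ι → ℂ, Complex.exp ((inner ℝ (∑ i, c i * ω i) t : ℝ) * Complex.I)
      = ∏ i, Complex.exp ((inner ℝ (ω i) (starRingEnd ℂ (c i) * t) : ℝ) * Complex.I) := by
    intro ω
    rw [← Complex.exp_sum, sum_inner]
    congr 1
    push_cast
    rw [Finset.sum_mul]
    refine Finset.sum_congr rfl fun i _ => ?_
    congr 2
    simp [Complex.inner]
    ring
  simp_rw [h]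
  rw [integral_fintype_prod_eq_prod
    (f := fun i z => Complex.exp ((inner ℝ z (starRingEnd ℂ (c i) * t) : ℝ) * Complex.I))]
  simp_rw [← charFun_apply, charFun_complexGaussian]
  rw [← Complex.exp_sum]
  congr 1
  push_cast
  rw [Finset.sum_neg_distrib, Finset.sum_mul, Finset.sum_div]
  congr 1
  refine Finset.sum_congr rfl fun i _ => ?_
  simp; ring

/-! ### Second moments, small-gain probabilities and negative moments. -/

lemma integrable_sq_gaussianReal (v : ℝ≥0) : Integrable (fun x : ℝ => x ^ 2) (gaussianReal 0 v) := by
  simpa using (memLp_id_gaussianReal' (μ := 0) (v := v) 2 (by simp)).integrable_sq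

lemma integral_sq_gaussianReal (v : ℝ≥0) : ∫ x, x ^ 2 ∂gaussianReal 0 v = v := by
  have h := variance_fun_id_gaussianReal (μ := 0) (v := v)
  rw [variance_eq_integral (by fun_prop), integral_id_gaussianReal] at h
  simpa using h

lemma sq_norm_measurableEquivRealProd_symm (p : ℝ × ℝ) :
    ‖Complex.measurableEquivRealProd.symm p‖ ^ 2 = p.1 ^ 2 + p.2 ^ 2 := by
  rw [Complex.sq_norm, Complex.normSq_apply]
  simp [Complex.measurableEquivRealProd_symm_apply]; ring

lemma integrable_sq_norm_complexGaussian (v : ℝ≥0) :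
    Integrable (fun z : ℂ => ‖z‖ ^ 2) (complexGaussian v) := by
  rw [complexGaussian, Complex.measurableEquivRealProd.symm.measurableEmbedding.integrable_map_iff]
  simp_rw [Function.comp_def, sq_norm_measurableEquivRealProd_symm]
  exact ((integrable_sq_gaussianReal _).comp_fst _).add ((integrable_sq_gaussianReal _).comp_snd _)

lemma integral_sq_norm_complexGaussian (v : ℝ≥0) : ∫ z, ‖z‖ ^ 2 ∂complexGaussian v = v := by
  rw [complexGaussian, Complex.measurableEquivRealProd.symm.measurableEmbedding.integral_map]
  simp_rw [sq_norm_measurableEquivRealProd_symm]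
  rw [integral_add ((integrable_sq_gaussianReal _).comp_fst _)
    ((integrable_sq_gaussianReal _).comp_snd _), integral_fun_fst (fun x : ℝ => x ^ 2),
    integral_fun_snd (fun x : ℝ => x ^ 2), integral_sq_gaussianReal]
  simp

/-- A measurable set in the unit disc has Gaussian measure at least a constant times its area. -/
lemma complexGaussian_ge_volume {v : ℝ≥0} (hv : 0 < v) {s : Set ℂ} (hs : MeasurableSet s)
    (h1 : ∀ z ∈ s, ‖z‖ ≤ 1) :
    ENNReal.ofReal ((Real.pi * v)⁻¹ * Real.exp (-1 / v)) * volume s ≤ complexGaussian v s := by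
  rw [complexGaussian_eq_withDensity hv, withDensity_apply _ hs, ← setLIntegral_const]
  refine setLIntegral_mono (measurable_complexGaussianPDF v).ennreal_ofReal fun z hz => ?_
  refine ENNReal.ofReal_le_ofReal ?_
  unfold complexGaussianPDF
  have : ‖z‖ ^ 2 ≤ 1 := pow_le_one₀ (norm_nonneg _) (h1 z hz)
  gcongr

/-- The probability that the squared gain lies in `[ρ / 2, ρ]` is at least of order `ρ`. -/
lemma exists_le_complexGaussian_annulus {v : ℝ≥0} (hv : 0 < v) :
    ∃ c : ℝ, 0 < c ∧ ∀ ρ : ℝ, 0 < ρ → ρ ≤ 1 →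
      c * ρ ≤ (complexGaussian v).real {z | ρ / 2 ≤ ‖z‖ ^ 2 ∧ ‖z‖ ^ 2 ≤ ρ} := by
  refine ⟨(Real.pi * v)⁻¹ * Real.exp (-1 / v) * (Real.pi / 2), by positivity, fun ρ h0 h1 => ?_⟩
  have hset : {z : ℂ | ρ / 2 ≤ ‖z‖ ^ 2 ∧ ‖z‖ ^ 2 ≤ ρ}
      = Metric.closedBall 0 (√ρ) \ Metric.ball 0 (√(ρ / 2)) := by
    ext z
    simp only [Set.mem_ofPred_eq, Set.mem_sdiff, Metric.mem_closedBall, dist_zero_right,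
      Metric.mem_ball, not_lt]
    rw [Real.le_sqrt (norm_nonneg _) h0.le, Real.sqrt_le_left (norm_nonneg _)]
    tauto
  have hms : MeasurableSet {z : ℂ | ρ / 2 ≤ ‖z‖ ^ 2 ∧ ‖z‖ ^ 2 ≤ ρ} := by
    rw [hset]; exact Metric.isClosed_closedBall.measurableSet.diff Metric.isOpen_ball.measurableSet
  have hvol : volume {z : ℂ | ρ / 2 ≤ ‖z‖ ^ 2 ∧ ‖z‖ ^ 2 ≤ ρ} = ENNReal.ofReal (Real.pi / 2 * ρ) := by
    rw [hset, measure_sdiff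
      ((Metric.ball_subset_ball (Real.sqrt_le_sqrt (by linarith))).trans Metric.ball_subset_closedBall)
      Metric.isOpen_ball.measurableSet.nullMeasurableSet (by finiteness),
      Complex.volume_closedBall, Complex.volume_ball, ← ENNReal.ofReal_pow (by positivity),
      ← ENNReal.ofReal_pow (by positivity), Real.sq_sqrt h0.le, Real.sq_sqrt (by positivity)]
    have hpi : ((NNReal.pi : ℝ≥0) : ℝ≥0∞) = ENNReal.ofReal Real.pi := by
      rw [ENNReal.ofReal, ← NNReal.coe_real_pi, Real.toNNReal_coe]
    rw [hpi, ← ENNReal.ofReal_mul h0.le, ← ENNReal.ofReal_mul (by positivity),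
      ← ENNReal.ofReal_sub _ (by positivity)]
    congr 1; ring
  have := complexGaussian_ge_volume hv hms fun z hz => by
    have : ‖z‖ ^ 2 ≤ 1 := hz.2.trans h1
    exact (sq_le_one_iff₀ (norm_nonneg _)).1 this
  rw [hvol, ← ENNReal.ofReal_mul (by positivity)] at this
  rw [measureReal_def, mul_assoc]
  exact (ENNReal.ofReal_le_iff_le_toReal (by finiteness)).1 this

/-- In the plane the singularity at the origin is integrable because q > -2. Thus the reciprocal of
a squared gain has moments of every order below 1, which fixes the diversity exponents from above.
-/
lemma integrable_rpow_norm_complexGaussian {v : ℝ≥0} (hv : 0 < v) {q : ℝ} (hq : -2 < q) :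
    Integrable (fun z : ℂ => ‖z‖ ^ q) (complexGaussian v) := by
  have hb : (0 : ℝ) < (v : ℝ)⁻¹ := by positivity
  have h1 := Complex.integral_rpow_mul_exp_neg_mul_rpow (p := 2) (q := q) (b := (v : ℝ)⁻¹)
    (by norm_num) hq hb
  have h2 : Integrable fun z : ℂ => ‖z‖ ^ q * Real.exp (-(v : ℝ)⁻¹ * ‖z‖ ^ (2 : ℝ)) := by
    -- The integral of a non-integrable function is 0 by convention, so a non-zero closed form
    -- proves integrability.
    refine Integrable.of_integral_ne_zero ?_
    rw [h1]
    have : 0 < Real.Gamma ((q + 2) / 2) := Real.Gamma_pos_of_pos (by linarith)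
    positivity
  rw [complexGaussian_eq_withDensity hv, integrable_withDensity_iff
    (measurable_complexGaussianPDF v).ennreal_ofReal (by simp)]
  refine (h2.const_mul (Real.pi * v)⁻¹).congr (Filter.Eventually.of_forall fun z => ?_)
  simp only
  rw [ENNReal.toReal_ofReal (complexGaussianPDF_pos hv z).le, complexGaussianPDF, Real.rpow_two]
  rw [show -‖z‖ ^ 2 / (v : ℝ) = -(v : ℝ)⁻¹ * ‖z‖ ^ 2 by ring]
  ring

/-- Up to the factor 2^k the base is at most |z|^(-2) + |z|^(2k-2), and t ↦ t^p is subadditive for 0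
≤ p ≤ 1. The first summand is the one that needs p < 1. -/
lemma integrable_weight_complexGaussian {v : ℝ≥0} (hv : 0 < v) {p : ℝ} (hp0 : 0 ≤ p) (hp : p < 1)
    (k : ℕ) :
    Integrable (fun z : ℂ => ((1 + ‖z‖ ^ 2) ^ k / ‖z‖ ^ 2) ^ p) (complexGaussian v) := by
  have h1 := (integrable_rpow_norm_complexGaussian hv (q := -2 * p) (by linarith)).const_mul
    (((2 : ℝ) ^ k) ^ p)
  have h2 := (integrable_rpow_norm_complexGaussian hv (q := (2 * k - 2) * p) (by
    have : 0 ≤ (k : ℝ) * p := by positivity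
    linarith)).const_mul (((2 : ℝ) ^ k) ^ p)
  refine (h1.add h2).mono' (Measurable.aestronglyMeasurable (by fun_prop)) (Filter.Eventually.of_forall fun z => ?_)
  have hx : 0 ≤ ‖z‖ := norm_nonneg z
  rw [Real.norm_of_nonneg (by positivity)]
  simp only [Pi.add_apply]
  -- At z = 0 the quotient is 0 by convention; p = 0 is separated there because 0^0 = 1.
  rcases hx.eq_or_lt with h | h
  · rw [← h]
    rcases hp0.eq_or_lt with rfl | hp0
    · norm_num
    · simp only [ne_eq, OfNat.ofNat_ne_zero, not_false_eq_true, zero_pow, div_zero]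
      rw [Real.zero_rpow hp0.ne']
      positivity
  · have e : ∀ x : ℝ, ‖z‖ ^ (x * p) = (‖z‖ ^ x) ^ p := fun x => Real.rpow_mul hx x p
    rw [e, e, ← mul_add]
    have hsum : (1 + ‖z‖ ^ 2) ^ k / ‖z‖ ^ 2
        ≤ 2 ^ k * (‖z‖ ^ (-2 : ℝ) + ‖z‖ ^ (2 * (k : ℝ) - 2)) := by
      have h3 : ‖z‖ ^ (-2 : ℝ) = (‖z‖ ^ 2)⁻¹ := by
        rw [Real.rpow_neg hx, Real.rpow_two]
      have h4 : ‖z‖ ^ (2 * (k : ℝ) - 2) = (‖z‖ ^ 2) ^ k / ‖z‖ ^ 2 := by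
        rw [Real.rpow_sub h, Real.rpow_two, Real.rpow_mul hx, Real.rpow_two, Real.rpow_natCast]
      rw [h3, h4, inv_eq_one_div, ← add_div, ← mul_div_assoc]
      gcongr
      rcases le_total (‖z‖ ^ 2) 1 with hle | hle
      · calc (1 + ‖z‖ ^ 2) ^ k ≤ (1 + 1) ^ k := by gcongr
          _ = 2 ^ k * 1 := by norm_num
          _ ≤ _ := by gcongr; exact le_add_of_nonneg_right (by positivity)
      · calc (1 + ‖z‖ ^ 2) ^ k ≤ (‖z‖ ^ 2 + ‖z‖ ^ 2) ^ k := by gcongr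
          _ = 2 ^ k * (‖z‖ ^ 2) ^ k := by rw [← two_mul, mul_pow]
          _ ≤ _ := by gcongr; exact le_add_of_nonneg_left (by positivity)
    calc _ ≤ (2 ^ k * (‖z‖ ^ (-2 : ℝ) + ‖z‖ ^ (2 * (k : ℝ) - 2))) ^ p := by gcongr
      _ = (2 ^ k) ^ p * (‖z‖ ^ (-2 : ℝ) + ‖z‖ ^ (2 * (k : ℝ) - 2)) ^ p :=
        Real.mul_rpow (by positivity) (by positivity)
      _ ≤ _ := by
        gcongr
        exact Real.rpow_add_le_add_rpow (by positivity) (by positivity) hp0 hp.le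

/-! ### Mutual information of Gaussian channels -/

section Information

variable {Ω A B C D : Type*} [MeasurableSpace Ω] [MeasurableSpace A] [MeasurableSpace B]
  [MeasurableSpace C] [MeasurableSpace D]

/-- An explicit density identifies the log-likelihood ratio almost everywhere, and the mass
correction in `klDiv` vanishes for probability measures. All mutual informations below are computed
this way. -/
lemma klDiv_eq_integral_log {μ ν : Measure A} [IsProbabilityMeasure μ] [IsProbabilityMeasure ν]
    {ρ : A → ℝ} (hρ : Measurable ρ) (hpos : ∀ x, 0 < ρ x)
    (h : μ = ν.withDensity fun x => ENNReal.ofReal (ρ x))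
    (hint : Integrable (fun x => Real.log (ρ x)) μ) :
    InformationTheory.klDiv μ ν = ENNReal.ofReal (∫ x, Real.log (ρ x) ∂μ) := by
  have hac : μ ≪ ν := by rw [h]; exact withDensity_absolutelyContinuous _ _
  have hllr : llr μ ν =ᵐ[μ] fun x => Real.log (ρ x) := by
    have h1 : μ.rnDeriv ν =ᵐ[ν] fun x => ENNReal.ofReal (ρ x) := by
      conv_lhs => rw [h]
      exact Measure.rnDeriv_withDensity ν hρ.ennreal_ofReal
    filter_upwards [hac.ae_le h1] with x hx
    rw [llr, hx, ENNReal.toReal_ofReal (hpos x).le]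
  rw [InformationTheory.klDiv_of_ac_of_integrable hac (hint.congr hllr.symm), integral_congr_ae hllr]
  simp

lemma mutualInfo_eq_integral_log {μ : Measure Ω} [IsProbabilityMeasure μ] {X : Ω → A} {Y : Ω → B}
    (hX : Measurable X) (hY : Measurable Y) {ρ : A × B → ℝ} (hρ : Measurable ρ)
    (hpos : ∀ x, 0 < ρ x)
    (h : μ.map (fun ω => (X ω, Y ω))
      = ((μ.map X).prod (μ.map Y)).withDensity fun x => ENNReal.ofReal (ρ x))
    (hint : Integrable (fun ω => Real.log (ρ (X ω, Y ω))) μ) :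
    mutualInfo μ X Y = ENNReal.ofReal (∫ ω, Real.log (ρ (X ω, Y ω)) ∂μ) := by
  have hXY : Measurable fun ω => (X ω, Y ω) := hX.prodMk hY
  have := Measure.isProbabilityMeasure_map (μ := μ) hX.aemeasurable
  have := Measure.isProbabilityMeasure_map (μ := μ) hY.aemeasurable
  have := Measure.isProbabilityMeasure_map (μ := μ) hXY.aemeasurable
  have hl : Measurable fun x => Real.log (ρ x) := hρ.log
  rw [mutualInfo, klDiv_eq_integral_log hρ hpos h
    ((integrable_map_measure hl.aestronglyMeasurable hXY.aemeasurable).2 hint),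
    integral_map hXY.aemeasurable hl.aestronglyMeasurable]

/-- Processing the second variable does not increase the mutual information. -/
lemma mutualInfo_comp_right_le {μ : Measure Ω} [IsProbabilityMeasure μ] {X : Ω → A} {Y : Ω → B}
    (hX : Measurable X) (hY : Measurable Y) {f : B → C} (hf : Measurable f) :
    mutualInfo μ X (fun ω => f (Y ω)) ≤ mutualInfo μ X Y := by
  have := Measure.isProbabilityMeasure_map (μ := μ) hX.aemeasurable
  have := Measure.isProbabilityMeasure_map (μ := μ) hY.aemeasurable
  have := Measure.isProbabilityMeasure_map (μ := μ) (hX.prodMk hY).aemeasurable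
  have h := InformationTheory.klDiv_map_le (μ := μ.map fun ω => (X ω, Y ω))
    (ν := (μ.map X).prod (μ.map Y)) (measurable_id.prodMap hf)
  rw [Measure.map_map (measurable_id.prodMap hf) (hX.prodMk hY),
    ← Measure.map_prod_map _ _ measurable_id hf, Measure.map_id, Measure.map_map hf hY] at h
  exact h

/-! #### Conditioning on an independent variable -/

/-- Independence allows Z to be frozen at z without changing the law of V. This reduces conditional
mutual informations to unconditional ones on the same space. -/
lemma condDistrib_comp_of_indepFun [StandardBorelSpace A] [Nonempty A] {μ : Measure Ω}
    [IsProbabilityMeasure μ] {Z : Ω → C} {V : Ω → D} (hZ : Measurable Z) (hV : Measurable V)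
    (hind : IndepFun Z V μ) {F : C × D → A} (hF : Measurable F) :
    ∀ᵐ z ∂μ.map Z, condDistrib (fun ω => F (Z ω, V ω)) Z μ z = μ.map fun ω => F (z, V ω) := by
  have := Measure.isProbabilityMeasure_map (μ := μ) hV.aemeasurable
  have hFZV : Measurable fun ω => F (Z ω, V ω) := hF.comp (hZ.prodMk hV)
  -- As the image of `id ×ₖ const`, the candidate conditional law is measurable in z by
  -- construction; uniqueness of the disintegration then applies.
  let κ : Kernel C A := (Kernel.id ×ₖ Kernel.const C (μ.map V)).map F
  have hκ : ∀ z, κ z = μ.map fun ω => F (z, V ω) := by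
    intro z
    rw [Kernel.map_apply _ hF, Kernel.prod_apply, Kernel.id_apply, Kernel.const_apply,
      Measure.dirac_prod, Measure.map_map hF (by fun_prop), Measure.map_map (by fun_prop) hV]
    rfl
  have : IsMarkovKernel κ := Kernel.IsMarkovKernel.map _ hF
  have h := condDistrib_ae_eq_of_measure_eq_compProd_of_measurable (μ := μ) (κ := κ) hZ hFZV (by
    refine Measure.ext_of_lintegral _ fun f hf => ?_
    rw [lintegral_map hf (hZ.prodMk hFZV), Measure.lintegral_compProd hf]
    simp_rw [hκ]
    have hl : ∀ z, ∫⁻ y, f (z, y) ∂(μ.map fun ω => F (z, V ω)) = ∫⁻ v, f (z, F (z, v)) ∂μ.map V := by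
      intro z
      rw [lintegral_map (by fun_prop) (by fun_prop), lintegral_map (by fun_prop) hV]
    simp_rw [hl]
    rw [← lintegral_prod (fun p : C × D => f (p.1, F p)) (by fun_prop),
      ← (indepFun_iff_map_prod_eq_prod_map_map hZ.aemeasurable hV.aemeasurable).1 hind,
      lintegral_map (by fun_prop) (hZ.prodMk hV)])
  filter_upwards [h] with z hz
  rw [hz, hκ]

lemma condMutualInfo_eq_lintegral [StandardBorelSpace A] [Nonempty A] [StandardBorelSpace B]
    [Nonempty B] {μ : Measure Ω} [IsProbabilityMeasure μ] {Z : Ω → C} {V : Ω → D}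
    (hZ : Measurable Z) (hV : Measurable V) (hind : IndepFun Z V μ)
    {F : C × D → A} (hF : Measurable F) {G : C × D → B} (hG : Measurable G) :
    condMutualInfo μ (fun ω => F (Z ω, V ω)) (fun ω => G (Z ω, V ω)) Z
      = ∫⁻ z, mutualInfo μ (fun ω => F (z, V ω)) (fun ω => G (z, V ω)) ∂μ.map Z := by
  refine lintegral_congr_ae ?_
  filter_upwards [condDistrib_comp_of_indepFun hZ hV hind hF,
    condDistrib_comp_of_indepFun hZ hV hind hG,
    condDistrib_comp_of_indepFun hZ hV hind (hF.prodMk hG)] with z h1 h2 h3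
  rw [h1, h2, h3, mutualInfo]

lemma condMutualInfo_eq_of_forall [StandardBorelSpace A] [Nonempty A] [StandardBorelSpace B]
    [Nonempty B] {μ : Measure Ω} [IsProbabilityMeasure μ] {Z : Ω → C} {V : Ω → D}
    (hZ : Measurable Z) (hV : Measurable V) (hind : IndepFun Z V μ)
    {F : C × D → A} (hF : Measurable F) {G : C × D → B} (hG : Measurable G) {K : ℝ≥0∞}
    (h : ∀ z, mutualInfo μ (fun ω => F (z, V ω)) (fun ω => G (z, V ω)) = K) :
    condMutualInfo μ (fun ω => F (Z ω, V ω)) (fun ω => G (Z ω, V ω)) Z = K := by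
  have := Measure.isProbabilityMeasure_map (μ := μ) hZ.aemeasurable
  rw [condMutualInfo_eq_lintegral hZ hV hind hF hG]
  simp [h]

lemma le_condMutualInfo_of_forall [StandardBorelSpace A] [Nonempty A] [StandardBorelSpace B]
    [Nonempty B] {μ : Measure Ω} [IsProbabilityMeasure μ] {Z : Ω → C} {V : Ω → D}
    (hZ : Measurable Z) (hV : Measurable V) (hind : IndepFun Z V μ)
    {F : C × D → A} (hF : Measurable F) {G : C × D → B} (hG : Measurable G) {K : ℝ≥0∞}
    (h : ∀ z, K ≤ mutualInfo μ (fun ω => F (z, V ω)) (fun ω => G (z, V ω))) :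
    K ≤ condMutualInfo μ (fun ω => F (Z ω, V ω)) (fun ω => G (Z ω, V ω)) Z := by
  have := Measure.isProbabilityMeasure_map (μ := μ) hZ.aemeasurable
  rw [condMutualInfo_eq_lintegral hZ hV hind hF hG]
  calc K = ∫⁻ _, K ∂μ.map Z := by simp
    _ ≤ _ := lintegral_mono h

/-! #### Additive Gaussian noise -/

lemma lintegral_add_complexGaussian {t : ℝ≥0} (ht : 0 < t) {f : ℂ → ℝ≥0∞} (hf : Measurable f)
    (c : ℂ) :
    ∫⁻ n, f (c + n) ∂complexGaussian t
      = ∫⁻ y, ENNReal.ofReal (complexGaussianPDF t (y - c)) * f y := by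
  rw [lintegral_complexGaussian ht (by fun_prop), ← lintegral_sub_right_eq_self _ c]
  simp

lemma log_complexGaussianPDF_div {s t : ℝ≥0} (hs : 0 < s) (ht : 0 < t) (z w : ℂ) :
    Real.log (complexGaussianPDF t z / complexGaussianPDF s w)
      = Real.log (s / t) - ‖z‖ ^ 2 / t + ‖w‖ ^ 2 / s := by
  have hs' : (0 : ℝ) < s := hs
  have ht' : (0 : ℝ) < t := ht
  have h : complexGaussianPDF t z / complexGaussianPDF s w
      = (s / t) * Real.exp (-‖z‖ ^ 2 / t + ‖w‖ ^ 2 / s) := by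
    unfold complexGaussianPDF
    rw [div_eq_iff (by positivity), mul_mul_mul_comm, ← Real.exp_add]
    rw [show -‖z‖ ^ 2 / (t : ℝ) + ‖w‖ ^ 2 / s + -‖w‖ ^ 2 / s = -‖z‖ ^ 2 / (t : ℝ) by ring]
    congr 1
    field_simp
  rw [h, Real.log_mul (by positivity) (Real.exp_pos _).ne', Real.log_exp]
  ring

lemma integrable_sq_norm_of_map_eq {μ : Measure Ω} {N : Ω → ℂ} (hN : Measurable N) {t : ℝ≥0}
    (h : μ.map N = complexGaussian t) : Integrable (fun ω => ‖N ω‖ ^ 2) μ := by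
  have := integrable_sq_norm_complexGaussian t
  rw [← h] at this
  exact (integrable_map_measure (by fun_prop) hN.aemeasurable).1 this

lemma integral_sq_norm_of_map_eq {μ : Measure Ω} {N : Ω → ℂ} (hN : Measurable N) {t : ℝ≥0}
    (h : μ.map N = complexGaussian t) : ∫ ω, ‖N ω‖ ^ 2 ∂μ = t := by
  rw [← integral_sq_norm_complexGaussian t, ← h, integral_map hN.aemeasurable (by fun_prop)]

/-- The quadratic terms have means E|N|²/t = 1 and E|Y|²/s = 1 and cancel. Only the marginal laws
enter, so the dependence between N and Y is irrelevant. -/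
lemma integral_log_complexGaussianPDF_div {μ : Measure Ω} [IsProbabilityMeasure μ] {N Y : Ω → ℂ}
    (hN : Measurable N) (hY : Measurable Y) {s t : ℝ≥0} (hs : 0 < s) (ht : 0 < t)
    (hNt : μ.map N = complexGaussian t) (hYs : μ.map Y = complexGaussian s) :
    Integrable (fun ω => Real.log (complexGaussianPDF t (N ω) / complexGaussianPDF s (Y ω))) μ ∧
    ∫ ω, Real.log (complexGaussianPDF t (N ω) / complexGaussianPDF s (Y ω)) ∂μ
      = Real.log (s / t) := by
  simp_rw [log_complexGaussianPDF_div hs ht]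
  have h1 := (integrable_sq_norm_of_map_eq hN hNt).div_const t
  have h2 := (integrable_sq_norm_of_map_eq hY hYs).div_const s
  have h0 : Integrable (fun _ : Ω => Real.log (s / t)) μ := integrable_const _
  refine ⟨(h0.sub h1).add h2, ?_⟩
  have h01 : Integrable (fun ω => Real.log (s / t) - ‖N ω‖ ^ 2 / t) μ := h0.sub h1
  rw [integral_add h01 h2, integral_sub h0 h1, integral_div, integral_div,
    integral_sq_norm_of_map_eq hN hNt, integral_sq_norm_of_map_eq hY hYs, div_self, div_self]
  · simp
  · exact_mod_cast hs.ne'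
  · exact_mod_cast ht.ne'

/-- The mutual information of input and output of a channel with additive Gaussian noise of
variance `t` whose output, up to the constant `m`, is Gaussian of variance `s`. -/
lemma mutualInfo_gaussianChannel {μ : Measure Ω} [IsProbabilityMeasure μ] {X : Ω → A} {N : Ω → ℂ}
    (hX : Measurable X) (hN : Measurable N) {φ : A → ℂ} (hφ : Measurable φ)
    (hind : IndepFun X N μ) {s t : ℝ≥0} (hs : 0 < s) (ht : 0 < t)
    (hNt : μ.map N = complexGaussian t)
    (hYs : μ.map (fun ω => φ (X ω) + N ω) = complexGaussian s) (m : ℂ) :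
    mutualInfo μ X (fun ω => m + (φ (X ω) + N ω)) = ENNReal.ofReal (Real.log (s / t)) := by
  have hY : Measurable fun ω => m + (φ (X ω) + N ω) := by fun_prop
  have hpt := measurable_complexGaussianPDF t
  have hps := measurable_complexGaussianPDF s
  have := Measure.isProbabilityMeasure_map (μ := μ) hX.aemeasurable
  have := Measure.isProbabilityMeasure_map (μ := μ) hY.aemeasurable
  -- The likelihood ratio: density of the output given the input over the marginal density of the
  -- output.
  let ρ : A × ℂ → ℝ := fun p =>
    complexGaussianPDF t (p.2 - (m + φ p.1)) / complexGaussianPDF s (p.2 - m)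
  have hρ : Measurable ρ := by fun_prop
  have hρe : ∀ ω, ρ (X ω, m + (φ (X ω) + N ω))
      = complexGaussianPDF t (N ω) / complexGaussianPDF s (φ (X ω) + N ω) := by
    intro ω
    simp only [ρ]
    congr 2 <;> ring
  obtain ⟨hi, hv⟩ := integral_log_complexGaussianPDF_div hN (by fun_prop) hs ht hNt hYs
  rw [mutualInfo_eq_integral_log hX hY hρ
    (fun x => div_pos (complexGaussianPDF_pos ht _) (complexGaussianPDF_pos hs _))]
  · simp_rw [hρe, hv]
  · refine Measure.ext_of_lintegral _ fun f hf => ?_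
    rw [lintegral_withDensity_eq_lintegral_mul _ hρ.ennreal_ofReal hf,
      lintegral_prod _ (by fun_prop), lintegral_map hf (hX.prodMk hY)]
    have e1 : ∫⁻ ω, f (X ω, m + (φ (X ω) + N ω)) ∂μ
        = ∫⁻ x, ∫⁻ n, f (x, m + φ x + n) ∂complexGaussian t ∂μ.map X := by
      rw [← hNt, ← lintegral_prod (fun p : A × ℂ => f (p.1, m + φ p.1 + p.2)) (by fun_prop),
        ← (indepFun_iff_map_prod_eq_prod_map_map hX.aemeasurable hN.aemeasurable).1 hind,
        lintegral_map (by fun_prop) (hX.prodMk hN)]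
      simp_rw [add_assoc]
    rw [e1]
    refine lintegral_congr fun x => ?_
    rw [lintegral_add_complexGaussian ht (f := fun y => f (x, y)) (by fun_prop)]
    have e2 : μ.map (fun ω => m + (φ (X ω) + N ω)) = (complexGaussian s).map (fun y => m + y) := by
      rw [← hYs, Measure.map_map (by fun_prop) (by fun_prop)]; rfl
    rw [e2, lintegral_map (by fun_prop) (by fun_prop)]
    simp only [Pi.mul_apply]
    rw [lintegral_add_complexGaussian hs
      (f := fun y => ENNReal.ofReal (ρ (x, y)) * f (x, y)) (by fun_prop)]
    refine lintegral_congr fun y => ?_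
    rw [← mul_assoc, ← ENNReal.ofReal_mul (complexGaussianPDF_pos hs _).le]
    congr 2
    exact (mul_div_cancel₀ _ (complexGaussianPDF_pos hs _).ne').symm
  · simp_rw [hρe]; exact hi

lemma condMutualInfo_gaussianChannel [StandardBorelSpace A] [Nonempty A] {μ : Measure Ω}
    [IsProbabilityMeasure μ] {X : Ω → A} {Z : Ω → C} {N : Ω → ℂ}
    (hX : Measurable X) (hZ : Measurable Z) (hN : Measurable N) {φ : A → ℂ} (hφ : Measurable φ)
    {ψ : C → ℂ} (hψ : Measurable ψ) (hZi : IndepFun Z (fun ω => (X ω, N ω)) μ)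
    (hind : IndepFun X N μ) {s t : ℝ≥0} (hs : 0 < s) (ht : 0 < t)
    (hNt : μ.map N = complexGaussian t)
    (hYs : μ.map (fun ω => φ (X ω) + N ω) = complexGaussian s) :
    condMutualInfo μ X (fun ω => ψ (Z ω) + (φ (X ω) + N ω)) Z
      = ENNReal.ofReal (Real.log (s / t)) :=
  condMutualInfo_eq_of_forall hZ (hX.prodMk hN) hZi (F := fun p => p.2.1)
    (G := fun p => ψ p.1 + (φ p.2.1 + p.2.2)) (by fun_prop) (by fun_prop)
    fun z => mutualInfo_gaussianChannel hX hN hφ hind hs ht hNt hYs (ψ z)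

/-- One component of a pair of outputs gives a lower bound for the mutual information. -/
lemma le_condMutualInfo_gaussianChannel_prod [StandardBorelSpace A] [Nonempty A] {μ : Measure Ω}
    [IsProbabilityMeasure μ] {X : Ω → A} {Z : Ω → C} {N₁ N₂ : Ω → ℂ}
    (hX : Measurable X) (hZ : Measurable Z) (hN₁ : Measurable N₁) (hN₂ : Measurable N₂)
    {φ₁ φ₂ : A → ℂ} (hφ₁ : Measurable φ₁) (hφ₂ : Measurable φ₂)
    {ψ₁ ψ₂ : C → ℂ} (hψ₁ : Measurable ψ₁) (hψ₂ : Measurable ψ₂)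
    (hZi : IndepFun Z (fun ω => (X ω, N₁ ω, N₂ ω)) μ)
    (hind₁ : IndepFun X N₁ μ) (hind₂ : IndepFun X N₂ μ) {s₁ t₁ s₂ t₂ : ℝ≥0}
    (hs₁ : 0 < s₁) (ht₁ : 0 < t₁) (hs₂ : 0 < s₂) (ht₂ : 0 < t₂)
    (hNt₁ : μ.map N₁ = complexGaussian t₁) (hNt₂ : μ.map N₂ = complexGaussian t₂)
    (hYs₁ : μ.map (fun ω => φ₁ (X ω) + N₁ ω) = complexGaussian s₁)
    (hYs₂ : μ.map (fun ω => φ₂ (X ω) + N₂ ω) = complexGaussian s₂) :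
    ENNReal.ofReal (max (Real.log (s₁ / t₁)) (Real.log (s₂ / t₂))) ≤
      condMutualInfo μ X (fun ω => (ψ₁ (Z ω) + (φ₁ (X ω) + N₁ ω), ψ₂ (Z ω) + (φ₂ (X ω) + N₂ ω)))
        Z := by
  refine le_condMutualInfo_of_forall hZ (hX.prodMk (hN₁.prodMk hN₂)) hZi (F := fun p => p.2.1)
    (G := fun p => (ψ₁ p.1 + (φ₁ p.2.1 + p.2.2.1), ψ₂ p.1 + (φ₂ p.2.1 + p.2.2.2)))
    (by fun_prop) (by fun_prop) fun z => ?_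
  rw [ENNReal.ofReal_max]
  refine max_le ?_ ?_
  · rw [← mutualInfo_gaussianChannel hX hN₁ hφ₁ hind₁ hs₁ ht₁ hNt₁ hYs₁ (ψ₁ z)]
    exact mutualInfo_comp_right_le hX (by fun_prop) measurable_fst
  · rw [← mutualInfo_gaussianChannel hX hN₂ hφ₂ hind₂ hs₂ ht₂ hNt₂ hYs₂ (ψ₂ z)]
    exact mutualInfo_comp_right_le hX (by fun_prop) measurable_snd

/-- The law of `(X, c X + N)` for a Gaussian variable `N` independent of `X`. -/
lemma lintegral_map_prodMk_add {μ : Measure Ω} [IsProbabilityMeasure μ] {X N : Ω → ℂ}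
    (hX : Measurable X) (hN : Measurable N) (hind : IndepFun X N μ) {s : ℝ≥0} (hs : 0 < s)
    (hNs : μ.map N = complexGaussian s) (c : ℂ) {f : ℂ × ℂ → ℝ≥0∞} (hf : Measurable f) :
    ∫⁻ p, f p ∂μ.map (fun ω => (X ω, c * X ω + N ω))
      = ∫⁻ x, (∫⁻ y, ENNReal.ofReal (complexGaussianPDF s (y - c * x)) * f (x, y)) ∂μ.map X := by
  have := Measure.isProbabilityMeasure_map (μ := μ) hX.aemeasurable
  have := Measure.isProbabilityMeasure_map (μ := μ) hN.aemeasurable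
  rw [lintegral_map hf (by fun_prop)]
  have e : ∫⁻ ω, f (X ω, c * X ω + N ω) ∂μ
      = ∫⁻ x, ∫⁻ n, f (x, c * x + n) ∂complexGaussian s ∂μ.map X := by
    rw [← hNs, ← lintegral_prod (fun p : ℂ × ℂ => f (p.1, c * p.1 + p.2)) (by fun_prop),
      ← (indepFun_iff_map_prod_eq_prod_map_map hX.aemeasurable hN.aemeasurable).1 hind,
      lintegral_map (by fun_prop) (hX.prodMk hN)]
  rw [e]
  exact lintegral_congr fun x =>
    lintegral_add_complexGaussian hs (f := fun y => f (x, y)) (by fun_prop) _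

/-- Two observers, each of which knows one of two independent inputs and a noisy superposition
of both. -/
lemma mutualInfo_crossed {μ : Measure Ω} [IsProbabilityMeasure μ] {X₁ X₂ W Z : Ω → ℂ}
    (hX₁ : Measurable X₁) (hX₂ : Measurable X₂) (hW : Measurable W) (hZ : Measurable Z)
    (c₁ c₂ d₁ d₂ : ℂ) (h₁₂ : IndepFun X₁ X₂ μ) (hWZ : IndepFun W Z μ)
    (hXWZ : IndepFun (fun ω => (X₁ ω, X₂ ω)) (fun ω => (W ω, Z ω)) μ)
    {w z s t : ℝ≥0} (hw : 0 < w) (hz : 0 < z) (hs : 0 < s) (ht : 0 < t)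
    (hWw : μ.map W = complexGaussian w) (hZz : μ.map Z = complexGaussian z)
    (hA : μ.map (fun ω => c₂ * X₂ ω + W ω) = complexGaussian s)
    (hAi : IndepFun X₁ (fun ω => c₂ * X₂ ω + W ω) μ)
    (hB : μ.map (fun ω => d₁ * X₁ ω + Z ω) = complexGaussian t)
    (hBi : IndepFun X₂ (fun ω => d₁ * X₁ ω + Z ω) μ) :
    mutualInfo μ (fun ω => (X₁ ω, c₁ * X₁ ω + (c₂ * X₂ ω + W ω)))
        (fun ω => (X₂ ω, d₂ * X₂ ω + (d₁ * X₁ ω + Z ω)))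
      = ENNReal.ofReal (Real.log (s / w) + Real.log (t / z)) := by
  have hpw := measurable_complexGaussianPDF w
  have hpz := measurable_complexGaussianPDF z
  have hps := measurable_complexGaussianPDF s
  have hpt := measurable_complexGaussianPDF t
  have := Measure.isProbabilityMeasure_map (μ := μ) hX₁.aemeasurable
  have := Measure.isProbabilityMeasure_map (μ := μ) hX₂.aemeasurable
  have hAm : Measurable fun ω => (X₁ ω, c₁ * X₁ ω + (c₂ * X₂ ω + W ω)) := by fun_prop
  have hBm : Measurable fun ω => (X₂ ω, d₂ * X₂ ω + (d₁ * X₁ ω + Z ω)) := by fun_prop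
  have := Measure.isProbabilityMeasure_map (μ := μ) hAm.aemeasurable
  have := Measure.isProbabilityMeasure_map (μ := μ) hBm.aemeasurable
  -- Given both inputs the two noises are independent, and each marginal pair involves only its own
  -- input. So the likelihood ratio is a product of two channel ratios, and the mutual information
  -- is a sum of two logarithms.
  let ρ : (ℂ × ℂ) × (ℂ × ℂ) → ℝ := fun p =>
    complexGaussianPDF w (p.1.2 - (c₁ * p.1.1 + c₂ * p.2.1))
        / complexGaussianPDF s (p.1.2 - c₁ * p.1.1)
      * (complexGaussianPDF z (p.2.2 - (d₂ * p.2.1 + d₁ * p.1.1))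
        / complexGaussianPDF t (p.2.2 - d₂ * p.2.1))
  have hρ : Measurable ρ := by fun_prop
  have hρ0 : ∀ p, 0 < ρ p := fun p =>
    mul_pos (div_pos (complexGaussianPDF_pos hw _) (complexGaussianPDF_pos hs _))
      (div_pos (complexGaussianPDF_pos hz _) (complexGaussianPDF_pos ht _))
  have hρe : ∀ ω, Real.log (ρ ((X₁ ω, c₁ * X₁ ω + (c₂ * X₂ ω + W ω)),
        (X₂ ω, d₂ * X₂ ω + (d₁ * X₁ ω + Z ω))))
      = Real.log (complexGaussianPDF w (W ω) / complexGaussianPDF s (c₂ * X₂ ω + W ω))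
        + Real.log (complexGaussianPDF z (Z ω) / complexGaussianPDF t (d₁ * X₁ ω + Z ω)) := by
    intro ω
    rw [← Real.log_mul
      (div_pos (complexGaussianPDF_pos hw _) (complexGaussianPDF_pos hs _)).ne'
      (div_pos (complexGaussianPDF_pos hz _) (complexGaussianPDF_pos ht _)).ne']
    simp only [ρ]
    congr 4 <;> ring
  obtain ⟨hi1, hv1⟩ := integral_log_complexGaussianPDF_div hW (by fun_prop) hs hw hWw hA
  obtain ⟨hi2, hv2⟩ := integral_log_complexGaussianPDF_div hZ (by fun_prop) ht hz hZz hB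
  rw [mutualInfo_eq_integral_log hAm hBm hρ hρ0]
  · simp_rw [hρe]
    rw [integral_add hi1 hi2, hv1, hv2]
  · refine Measure.ext_of_lintegral _ fun f hf => ?_
    rw [lintegral_withDensity_eq_lintegral_mul _ hρ.ennreal_ofReal hf,
      lintegral_prod _ (by fun_prop), lintegral_map hf (hAm.prodMk hBm)]
    have e1 : ∫⁻ ω, f ((X₁ ω, c₁ * X₁ ω + (c₂ * X₂ ω + W ω)),
          (X₂ ω, d₂ * X₂ ω + (d₁ * X₁ ω + Z ω))) ∂μ
        = ∫⁻ x₁, ∫⁻ x₂, ∫⁻ a, ∫⁻ b, f ((x₁, c₁ * x₁ + c₂ * x₂ + a), (x₂, d₂ * x₂ + d₁ * x₁ + b))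
            ∂complexGaussian z ∂complexGaussian w ∂μ.map X₂ ∂μ.map X₁ := by
      let g : (ℂ × ℂ) × (ℂ × ℂ) → ℝ≥0∞ := fun p =>
        f ((p.1.1, c₁ * p.1.1 + c₂ * p.1.2 + p.2.1), (p.1.2, d₂ * p.1.2 + d₁ * p.1.1 + p.2.2))
      have hg : Measurable g := by fun_prop
      have e2 : μ.map (fun ω => ((X₁ ω, X₂ ω), (W ω, Z ω)))
          = ((μ.map X₁).prod (μ.map X₂)).prod ((complexGaussian w).prod (complexGaussian z)) := by
        rw [(indepFun_iff_map_prod_eq_prod_map_map (by fun_prop) (by fun_prop)).1 hXWZ,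
          (indepFun_iff_map_prod_eq_prod_map_map (by fun_prop) (by fun_prop)).1 h₁₂,
          (indepFun_iff_map_prod_eq_prod_map_map (by fun_prop) (by fun_prop)).1 hWZ, hWw, hZz]
      calc _ = ∫⁻ p, g p ∂μ.map (fun ω => ((X₁ ω, X₂ ω), (W ω, Z ω))) := by
            rw [lintegral_map hg (by fun_prop)]
            simp only [g, add_assoc]
        _ = _ := by
            rw [e2, lintegral_prod _ (by fun_prop), lintegral_prod _ (by fun_prop)]
            refine lintegral_congr fun x₁ => lintegral_congr fun x₂ => ?_
            rw [lintegral_prod _ (by fun_prop)]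
    rw [e1, lintegral_map_prodMk_add hX₁ (by fun_prop) hAi hs hA c₁
      (f := fun p => ∫⁻ y, ((fun x => ENNReal.ofReal (ρ x)) * f) (p, y)
        ∂μ.map (fun ω => (X₂ ω, d₂ * X₂ ω + (d₁ * X₁ ω + Z ω))))
      (Measurable.lintegral_prod_right' (f := (fun x => ENNReal.ofReal (ρ x)) * f) (by fun_prop))]
    refine lintegral_congr fun x₁ => ?_
    have e3 : ∀ y₁ : ℂ, ∫⁻ p, ((fun x => ENNReal.ofReal (ρ x)) * f) ((x₁, y₁), p)
          ∂μ.map (fun ω => (X₂ ω, d₂ * X₂ ω + (d₁ * X₁ ω + Z ω)))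
        = ∫⁻ x₂, (∫⁻ y₂, ENNReal.ofReal (complexGaussianPDF t (y₂ - d₂ * x₂))
          * (ENNReal.ofReal (ρ ((x₁, y₁), (x₂, y₂))) * f ((x₁, y₁), (x₂, y₂)))) ∂μ.map X₂ := by
      intro y₁
      exact lintegral_map_prodMk_add hX₂ (by fun_prop) hBi ht hB d₂
        (f := fun p => ((fun x => ENNReal.ofReal (ρ x)) * f) ((x₁, y₁), p)) (by fun_prop)
    simp_rw [e3]
    have e4 : ∀ y₁ : ℂ, ENNReal.ofReal (complexGaussianPDF s (y₁ - c₁ * x₁))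
          * ∫⁻ x₂, (∫⁻ y₂, ENNReal.ofReal (complexGaussianPDF t (y₂ - d₂ * x₂))
          * (ENNReal.ofReal (ρ ((x₁, y₁), (x₂, y₂))) * f ((x₁, y₁), (x₂, y₂)))) ∂μ.map X₂
        = ∫⁻ x₂, (ENNReal.ofReal (complexGaussianPDF s (y₁ - c₁ * x₁))
          * ∫⁻ y₂, ENNReal.ofReal (complexGaussianPDF t (y₂ - d₂ * x₂))
          * (ENNReal.ofReal (ρ ((x₁, y₁), (x₂, y₂))) * f ((x₁, y₁), (x₂, y₂)))) ∂μ.map X₂ := by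
      intro y₁
      rw [lintegral_const_mul]
      exact Measurable.lintegral_prod_right' (f := fun p : ℂ × ℂ =>
        ENNReal.ofReal (complexGaussianPDF t (p.2 - d₂ * p.1))
          * (ENNReal.ofReal (ρ ((x₁, y₁), (p.1, p.2))) * f ((x₁, y₁), (p.1, p.2)))) (by fun_prop)
    simp_rw [e4]
    -- The joint law is integrated in the order x₁, x₂, y₁, y₂ and the product law in the order x₁,
    -- y₁, x₂, y₂; Tonelli exchanges x₂ and y₁.
    refine Eq.trans ?_ (lintegral_lintegral_swap ?_)
    · refine lintegral_congr fun x₂ => ?_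
      rw [lintegral_add_complexGaussian hw (c := c₁ * x₁ + c₂ * x₂)
        (f := fun a => ∫⁻ b, f ((x₁, a), (x₂, d₂ * x₂ + d₁ * x₁ + b)) ∂complexGaussian z)]
      · refine lintegral_congr fun y₁ => ?_
        rw [lintegral_add_complexGaussian hz (f := fun b => f ((x₁, y₁), (x₂, b))) (by fun_prop),
          ← lintegral_const_mul _ (by fun_prop), ← lintegral_const_mul _ (by fun_prop)]
        refine lintegral_congr fun y₂ => ?_
        simp only [← mul_assoc]
        rw [← ENNReal.ofReal_mul (complexGaussianPDF_pos hw _).le,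
          ← ENNReal.ofReal_mul (complexGaussianPDF_pos hs _).le,
          ← ENNReal.ofReal_mul (mul_pos (complexGaussianPDF_pos hs _)
            (complexGaussianPDF_pos ht _)).le]
        congr 2
        simp only [ρ]
        rw [mul_mul_mul_comm, mul_div_cancel₀ _ (complexGaussianPDF_pos hs _).ne',
          mul_div_cancel₀ _ (complexGaussianPDF_pos ht _).ne']
      · exact Measurable.lintegral_prod_right' (f := fun p : ℂ × ℂ =>
          f ((x₁, p.1), (x₂, d₂ * x₂ + d₁ * x₁ + p.2))) (by fun_prop)
    · refine Measurable.aemeasurable ?_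
      refine Measurable.mul (by fun_prop) ?_
      exact Measurable.lintegral_prod_right' (f := fun p : (ℂ × ℂ) × ℂ =>
        ENNReal.ofReal (complexGaussianPDF t (p.2 - d₂ * p.1.1))
          * (ENNReal.ofReal (ρ ((x₁, p.1.2), (p.1.1, p.2)))
            * f ((x₁, p.1.2), (p.1.1, p.2)))) (by fun_prop)
  · simp_rw [hρe]; exact hi1.add hi2

end Information

/-! ### The generic signals -/

@[fun_prop] lemma measurable_X11 : Measurable X11 := measurable_pi_apply _
@[fun_prop] lemma measurable_X21 : Measurable X21 := measurable_pi_apply _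
@[fun_prop] lemma measurable_X12 : Measurable X12 := measurable_pi_apply _
@[fun_prop] lemma measurable_X22 : Measurable X22 := measurable_pi_apply _
@[fun_prop] lemma measurable_XR : Measurable XR := measurable_pi_apply _
@[fun_prop] lemma measurable_YD1 (h : Link → ℂ) : Measurable (YD1 h) := by unfold YD1; fun_prop
@[fun_prop] lemma measurable_YR (h : Link → ℂ) : Measurable (YR h) := by unfold YR; fun_prop
@[fun_prop] lemma measurable_YQ (h : Link → ℂ) : Measurable (YQ h) := by unfold YQ; fun_prop

lemma sum_sig {M : Type*} [AddCommMonoid M] (f : Sig → M) :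
    ∑ i, f i = f .x11 + f .x21 + f .x12 + f .x22 + f .xR + f .zD1 + f .zD2 + f .zR + f .zQ := by
  have : (Finset.univ : Finset Sig) = {.x11, .x21, .x12, .x22, .xR, .zD1, .zD2, .zR, .zQ} := rfl
  rw [this]
  repeat rw [Finset.sum_insert (by decide)]
  rw [Finset.sum_singleton]
  simp only [add_assoc]

lemma map_sigLaw_of_eq_linearForm {snr : ℝ} {q : ℝ≥0} {g : (Sig → ℂ) → ℂ} (c : Sig → ℂ)
    (hg : ∀ ω, g ω = ∑ i, c i * ω i) {s : ℝ≥0} (hs : s = ∑ i, ‖c i‖₊ ^ 2 * sigVar snr q i) :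
    (sigLaw snr q).map g = complexGaussian s := by
  rw [hs, ← map_linearForm_pi_complexGaussian, sigLaw, funext hg]

/-- The coordinates in S and those outside S form independent tuples. Each function is recovered
from its tuple by padding with zeros, which does not change its value. -/
lemma indepFun_sigLaw {A B : Type*} [MeasurableSpace A] [MeasurableSpace B] {snr : ℝ} {q : ℝ≥0}
    (S : Finset Sig) {F : (Sig → ℂ) → A} {G : (Sig → ℂ) → B} (hF : Measurable F)
    (hG : Measurable G) (hFS : ∀ ω ω' : Sig → ℂ, (∀ i ∈ S, ω i = ω' i) → F ω = F ω')
    (hGS : ∀ ω ω' : Sig → ℂ, (∀ i ∉ S, ω i = ω' i) → G ω = G ω') :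
    IndepFun F G (sigLaw snr q) := by
  have h0 : iIndepFun (fun (i : Sig) (ω : Sig → ℂ) => ω i) (sigLaw snr q) :=
    iIndepFun_pi (X := fun _ => id) fun _ => aemeasurable_id
  have h1 := h0.indepFun_finset S Sᶜ disjoint_compl_right fun i => measurable_pi_apply i
  have e : ∀ T : Finset Sig,
      Measurable fun (p : T → ℂ) (i : Sig) => if h : i ∈ T then p ⟨i, h⟩ else 0 := by
    intro T
    refine measurable_pi_lambda _ fun i => ?_
    by_cases h : i ∈ T
    · simpa [h] using measurable_pi_apply _
    · simp [h]
  have h2 := h1.comp (hF.comp (e S)) (hG.comp (e Sᶜ))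
  refine h2.congr (Filter.Eventually.of_forall fun ω => ?_) (Filter.Eventually.of_forall fun ω => ?_)
  · exact hFS _ _ fun i hi => by simp [hi]
  · exact hGS _ _ fun i hi => by simp [hi]

/-! ### The mutual informations of the scheme, in closed form or bounded below. -/

section Terms

attribute [local simp] X11 X21 X12 X22 XR YR YQ

variable (p q : ℝ≥0) (h : Link → ℂ)

lemma mutualInfo_YR_YQ (hq : 0 < q) :
    mutualInfo (sigLaw p q) (YR h) (YQ h)
      = ENNReal.ofReal (Real.log ((1 + ‖h .s1R‖₊ ^ 2 * p + ‖h .s2R‖₊ ^ 2 * p + q : ℝ≥0) / q)) := by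
  have := mutualInfo_gaussianChannel (μ := sigLaw p q) (X := YR h) (N := fun ω => ω .zQ)
    (φ := id) (s := 1 + ‖h .s1R‖₊ ^ 2 * p + ‖h .s2R‖₊ ^ 2 * p + q) (t := q) (by fun_prop)
    (by fun_prop) measurable_id
    (indepFun_sigLaw {.x11, .x21, .zR} (by fun_prop) (by fun_prop)
      (by intro ω ω' hω; simp at hω; simp [hω])
      (by intro ω ω' hω; simp [hω]))
    (by positivity) hq
    (map_sigLaw_of_eq_linearForm (fun | .zQ => 1 | _ => 0)
      (by intro ω; simp [sum_sig]; try ring)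
      (by simp [sum_sig, sigVar]; try ring))
    (map_sigLaw_of_eq_linearForm (fun | .x11 => h .s1R | .x21 => h .s2R | .zR => 1 | .zQ => 1 | _ => 0)
      (by intro ω; simp [sum_sig]; try ring)
      (by simp [sum_sig, sigVar]; try ring)) 0
  simpa [YQ] using! this

/-- A lower bound suffices: the conditions without the quantization rate enter only the upper bound
for the outage probability, and there one of the two outputs carries enough information. -/
lemma le_condMutualInfo_X11 :
    ENNReal.ofReal (max (Real.log ((1 + ‖h .s1D‖₊ ^ 2 * p : ℝ≥0) / (1 : ℝ≥0)))
        (Real.log ((1 + q + ‖h .s1R‖₊ ^ 2 * p : ℝ≥0) / (1 + q : ℝ≥0))))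
      ≤ condMutualInfo (sigLaw p q) X11 (fun ω => (YD1 h ω, YQ h ω)) X21 := by
  have := le_condMutualInfo_gaussianChannel_prod (μ := sigLaw p q) (X := X11) (Z := X21)
    (N₁ := fun ω => ω .zD1) (N₂ := fun ω => ω .zR + ω .zQ) (φ₁ := fun x => h .s1D * x)
    (φ₂ := fun x => h .s1R * x) (ψ₁ := fun x => h .s2D * x) (ψ₂ := fun x => h .s2R * x)
    (s₁ := 1 + ‖h .s1D‖₊ ^ 2 * p) (t₁ := 1) (s₂ := 1 + q + ‖h .s1R‖₊ ^ 2 * p) (t₂ := 1 + q)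
    (by fun_prop) (by fun_prop) (by fun_prop) (by fun_prop) (by fun_prop) (by fun_prop)
    (by fun_prop) (by fun_prop)
    (indepFun_sigLaw {.x21} (by fun_prop) (by fun_prop)
      (by intro ω ω' hω; simp at hω; simp [hω])
      (by intro ω ω' hω; simp [hω]))
    (indepFun_sigLaw {.x11} (by fun_prop) (by fun_prop)
      (by intro ω ω' hω; simp at hω; simp [hω])
      (by intro ω ω' hω; simp [hω]))
    (indepFun_sigLaw {.x11} (by fun_prop) (by fun_prop)
      (by intro ω ω' hω; simp at hω; simp [hω])
      (by intro ω ω' hω; simp [hω]))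
    (by positivity) one_pos (by positivity) (by positivity)
    (map_sigLaw_of_eq_linearForm (fun | .zD1 => 1 | _ => 0)
      (by intro ω; simp [sum_sig]; try ring)
      (by simp [sum_sig, sigVar]; try ring))
    (map_sigLaw_of_eq_linearForm (fun | .zR => 1 | .zQ => 1 | _ => 0)
      (by intro ω; simp [sum_sig]; try ring)
      (by simp [sum_sig, sigVar]; try ring))
    (map_sigLaw_of_eq_linearForm (fun | .x11 => h .s1D | .zD1 => 1 | _ => 0)
      (by intro ω; simp [sum_sig]; try ring)
      (by simp [sum_sig, sigVar]; try ring))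
    (map_sigLaw_of_eq_linearForm (fun | .x11 => h .s1R | .zR => 1 | .zQ => 1 | _ => 0)
      (by intro ω; simp [sum_sig]; try ring)
      (by simp [sum_sig, sigVar]; try ring))
  convert this using 4 with ω
  · simp only [YD1, X11, X21]; ring
  · simp only [YQ, YR, X11, X21]; ring

lemma condMutualInfo_X12 :
    condMutualInfo (sigLaw p q) X12 (YD2 h) (fun ω => (X22 ω, XR ω))
      = ENNReal.ofReal (Real.log ((1 + ‖h .s1D‖₊ ^ 2 * p : ℝ≥0) / (1 : ℝ≥0))) := by
  have := condMutualInfo_gaussianChannel (μ := sigLaw p q) (X := X12)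
    (Z := fun ω => (X22 ω, XR ω)) (N := fun ω => ω .zD2) (φ := fun x => h .s1D * x)
    (ψ := fun x => h .s2D * x.1 + h .rD * x.2) (s := 1 + ‖h .s1D‖₊ ^ 2 * p) (t := 1)
    (by fun_prop) (by fun_prop) (by fun_prop) (by fun_prop) (by fun_prop)
    (indepFun_sigLaw {.x22, .xR} (by fun_prop) (by fun_prop)
      (by intro ω ω' hω; simp at hω; simp [hω])
      (by intro ω ω' hω; simp [hω]))
    (indepFun_sigLaw {.x12} (by fun_prop) (by fun_prop)
      (by intro ω ω' hω; simp at hω; simp [hω])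
      (by intro ω ω' hω; simp [hω]))
    (by positivity) one_pos
    (map_sigLaw_of_eq_linearForm (fun | .zD2 => 1 | _ => 0)
      (by intro ω; simp [sum_sig]; try ring)
      (by simp [sum_sig, sigVar]; try ring))
    (map_sigLaw_of_eq_linearForm (fun | .x12 => h .s1D | .zD2 => 1 | _ => 0)
      (by intro ω; simp [sum_sig]; try ring)
      (by simp [sum_sig, sigVar]; try ring))
  rw [← this]
  congr 1
  funext ω
  simp only [YD2, X12, X22, XR]; ring

lemma mutualInfo_X11_YQ_X21_YD1 :
    mutualInfo (sigLaw p q) (fun ω => (X11 ω, YQ h ω)) (fun ω => (X21 ω, YD1 h ω))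
      = ENNReal.ofReal (Real.log ((1 + q + ‖h .s2R‖₊ ^ 2 * p : ℝ≥0) / (1 + q : ℝ≥0))
        + Real.log ((1 + ‖h .s1D‖₊ ^ 2 * p : ℝ≥0) / (1 : ℝ≥0))) := by
  have := mutualInfo_crossed (μ := sigLaw p q) (X₁ := X11) (X₂ := X21)
    (W := fun ω => ω .zR + ω .zQ) (Z := fun ω => ω .zD1) (by fun_prop) (by fun_prop)
    (by fun_prop) (by fun_prop) (h .s1R) (h .s2R) (h .s1D) (h .s2D)
    (w := 1 + q) (z := 1) (s := 1 + q + ‖h .s2R‖₊ ^ 2 * p) (t := 1 + ‖h .s1D‖₊ ^ 2 * p)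
    (indepFun_sigLaw {.x11} (by fun_prop) (by fun_prop)
      (by intro ω ω' hω; simp at hω; simp [hω])
      (by intro ω ω' hω; simp [hω]))
    (indepFun_sigLaw {.zR, .zQ} (by fun_prop) (by fun_prop)
      (by intro ω ω' hω; simp at hω; simp [hω])
      (by intro ω ω' hω; simp [hω]))
    (indepFun_sigLaw {.x11, .x21} (by fun_prop) (by fun_prop)
      (by intro ω ω' hω; simp at hω; simp [hω])
      (by intro ω ω' hω; simp [hω]))
    (by positivity) one_pos (by positivity) (by positivity)
    (map_sigLaw_of_eq_linearForm (fun | .zR => 1 | .zQ => 1 | _ => 0)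
      (by intro ω; simp [sum_sig]; try ring)
      (by simp [sum_sig, sigVar]; try ring))
    (map_sigLaw_of_eq_linearForm (fun | .zD1 => 1 | _ => 0)
      (by intro ω; simp [sum_sig]; try ring)
      (by simp [sum_sig, sigVar]; try ring))
    (map_sigLaw_of_eq_linearForm (fun | .x21 => h .s2R | .zR => 1 | .zQ => 1 | _ => 0)
      (by intro ω; simp [sum_sig]; try ring)
      (by simp [sum_sig, sigVar]; try ring))
    (indepFun_sigLaw {.x11} (by fun_prop) (by fun_prop)
      (by intro ω ω' hω; simp at hω; simp [hω])
      (by intro ω ω' hω; simp [hω]))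
    (map_sigLaw_of_eq_linearForm (fun | .x11 => h .s1D | .zD1 => 1 | _ => 0)
      (by intro ω; simp [sum_sig]; try ring)
      (by simp [sum_sig, sigVar]; try ring))
    (indepFun_sigLaw {.x21} (by fun_prop) (by fun_prop)
      (by intro ω ω' hω; simp at hω; simp [hω])
      (by intro ω ω' hω; simp [hω]))
  rw [← this]
  congr 1 <;> funext ω
  · simp only [YQ, YR, X11, X21, Prod.mk.injEq, true_and]; ring
  · simp only [YD1, X11, X21, Prod.mk.injEq, true_and]; ring

/-- The signal of source 2 counts as noise, so the denominator here is the numerator of the relay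
part of `mutualInfo_X11_YQ_X21_YD1`; the two cancel in `info1u_eq`. -/
lemma mutualInfo_X11_YQ :
    mutualInfo (sigLaw p q) X11 (YQ h)
      = ENNReal.ofReal (Real.log
        ((1 + q + ‖h .s1R‖₊ ^ 2 * p + ‖h .s2R‖₊ ^ 2 * p : ℝ≥0) / (1 + q + ‖h .s2R‖₊ ^ 2 * p : ℝ≥0))) := by
  have := mutualInfo_gaussianChannel (μ := sigLaw p q) (X := X11)
    (N := fun ω => h .s2R * X21 ω + (ω .zR + ω .zQ)) (φ := fun x => h .s1R * x)
    (s := 1 + q + ‖h .s1R‖₊ ^ 2 * p + ‖h .s2R‖₊ ^ 2 * p) (t := 1 + q + ‖h .s2R‖₊ ^ 2 * p)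
    (by fun_prop) (by fun_prop) (by fun_prop)
    (indepFun_sigLaw {.x11} (by fun_prop) (by fun_prop)
      (by intro ω ω' hω; simp at hω; simp [hω])
      (by intro ω ω' hω; simp [hω]))
    (by positivity) (by positivity)
    (map_sigLaw_of_eq_linearForm (fun | .x21 => h .s2R | .zR => 1 | .zQ => 1 | _ => 0)
      (by intro ω; simp [sum_sig]; try ring)
      (by simp [sum_sig, sigVar]; try ring))
    (map_sigLaw_of_eq_linearForm (fun | .x11 => h .s1R | .x21 => h .s2R | .zR => 1 | .zQ => 1 | _ => 0)
      (by intro ω; simp [sum_sig]; try ring)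
      (by simp [sum_sig, sigVar]; try ring)) 0
  rw [← this]
  congr 1
  funext ω
  simp only [YQ, YR, X11, X21]; ring

lemma condMutualInfo_X12_XR :
    condMutualInfo (sigLaw p q) (fun ω => (X12 ω, XR ω)) (YD2 h) X22
      = ENNReal.ofReal (Real.log ((1 + ‖h .s1D‖₊ ^ 2 * p + ‖h .rD‖₊ ^ 2 * p : ℝ≥0) / (1 : ℝ≥0))) := by
  have := condMutualInfo_gaussianChannel (μ := sigLaw p q) (X := fun ω => (X12 ω, XR ω))
    (Z := X22) (N := fun ω => ω .zD2) (φ := fun x => h .s1D * x.1 + h .rD * x.2)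
    (ψ := fun x => h .s2D * x) (s := 1 + ‖h .s1D‖₊ ^ 2 * p + ‖h .rD‖₊ ^ 2 * p) (t := 1)
    (by fun_prop) (by fun_prop) (by fun_prop) (by fun_prop) (by fun_prop)
    (indepFun_sigLaw {.x22} (by fun_prop) (by fun_prop)
      (by intro ω ω' hω; simp at hω; simp [hω])
      (by intro ω ω' hω; simp [hω]))
    (indepFun_sigLaw {.x12, .xR} (by fun_prop) (by fun_prop)
      (by intro ω ω' hω; simp at hω; simp [hω])
      (by intro ω ω' hω; simp [hω]))
    (by positivity) one_pos
    (map_sigLaw_of_eq_linearForm (fun | .zD2 => 1 | _ => 0)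
      (by intro ω; simp [sum_sig]; try ring)
      (by simp [sum_sig, sigVar]; try ring))
    (map_sigLaw_of_eq_linearForm (fun | .x12 => h .s1D | .xR => h .rD | .zD2 => 1 | _ => 0)
      (by intro ω; simp [sum_sig]; try ring)
      (by simp [sum_sig, sigVar]; try ring))
  rw [← this]
  congr 1
  funext ω
  simp only [YD2, X12, X22, XR]; ring

lemma le_condMutualInfo_X21 :
    ENNReal.ofReal (max (Real.log ((1 + ‖h .s2D‖₊ ^ 2 * p : ℝ≥0) / (1 : ℝ≥0)))
        (Real.log ((1 + q + ‖h .s2R‖₊ ^ 2 * p : ℝ≥0) / (1 + q : ℝ≥0))))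
      ≤ condMutualInfo (sigLaw p q) X21 (fun ω => (YD1 h ω, YQ h ω)) X11 := by
  have := le_condMutualInfo_gaussianChannel_prod (μ := sigLaw p q) (X := X21) (Z := X11)
    (N₁ := fun ω => ω .zD1) (N₂ := fun ω => ω .zR + ω .zQ) (φ₁ := fun x => h .s2D * x)
    (φ₂ := fun x => h .s2R * x) (ψ₁ := fun x => h .s1D * x) (ψ₂ := fun x => h .s1R * x)
    (s₁ := 1 + ‖h .s2D‖₊ ^ 2 * p) (t₁ := 1) (s₂ := 1 + q + ‖h .s2R‖₊ ^ 2 * p) (t₂ := 1 + q)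
    (by fun_prop) (by fun_prop) (by fun_prop) (by fun_prop) (by fun_prop) (by fun_prop)
    (by fun_prop) (by fun_prop)
    (indepFun_sigLaw {.x11} (by fun_prop) (by fun_prop)
      (by intro ω ω' hω; simp at hω; simp [hω])
      (by intro ω ω' hω; simp [hω]))
    (indepFun_sigLaw {.x21} (by fun_prop) (by fun_prop)
      (by intro ω ω' hω; simp at hω; simp [hω])
      (by intro ω ω' hω; simp [hω]))
    (indepFun_sigLaw {.x21} (by fun_prop) (by fun_prop)
      (by intro ω ω' hω; simp at hω; simp [hω])
      (by intro ω ω' hω; simp [hω]))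
    (by positivity) one_pos (by positivity) (by positivity)
    (map_sigLaw_of_eq_linearForm (fun | .zD1 => 1 | _ => 0)
      (by intro ω; simp [sum_sig]; try ring)
      (by simp [sum_sig, sigVar]; try ring))
    (map_sigLaw_of_eq_linearForm (fun | .zR => 1 | .zQ => 1 | _ => 0)
      (by intro ω; simp [sum_sig]; try ring)
      (by simp [sum_sig, sigVar]; try ring))
    (map_sigLaw_of_eq_linearForm (fun | .x21 => h .s2D | .zD1 => 1 | _ => 0)
      (by intro ω; simp [sum_sig]; try ring)
      (by simp [sum_sig, sigVar]; try ring))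
    (map_sigLaw_of_eq_linearForm (fun | .x21 => h .s2R | .zR => 1 | .zQ => 1 | _ => 0)
      (by intro ω; simp [sum_sig]; try ring)
      (by simp [sum_sig, sigVar]; try ring))
  convert this using 4 with ω
  · simp only [YD1, X11, X21]; ring
  · simp only [YQ, YR, X11, X21]; ring

lemma condMutualInfo_X22 :
    condMutualInfo (sigLaw p q) X22 (YD2 h) (fun ω => (X12 ω, XR ω))
      = ENNReal.ofReal (Real.log ((1 + ‖h .s2D‖₊ ^ 2 * p : ℝ≥0) / (1 : ℝ≥0))) := by
  have := condMutualInfo_gaussianChannel (μ := sigLaw p q) (X := X22)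
    (Z := fun ω => (X12 ω, XR ω)) (N := fun ω => ω .zD2) (φ := fun x => h .s2D * x)
    (ψ := fun x => h .s1D * x.1 + h .rD * x.2) (s := 1 + ‖h .s2D‖₊ ^ 2 * p) (t := 1)
    (by fun_prop) (by fun_prop) (by fun_prop) (by fun_prop) (by fun_prop)
    (indepFun_sigLaw {.x12, .xR} (by fun_prop) (by fun_prop)
      (by intro ω ω' hω; simp at hω; simp [hω])
      (by intro ω ω' hω; simp [hω]))
    (indepFun_sigLaw {.x22} (by fun_prop) (by fun_prop)
      (by intro ω ω' hω; simp at hω; simp [hω])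
      (by intro ω ω' hω; simp [hω]))
    (by positivity) one_pos
    (map_sigLaw_of_eq_linearForm (fun | .zD2 => 1 | _ => 0)
      (by intro ω; simp [sum_sig]; try ring)
      (by simp [sum_sig, sigVar]; try ring))
    (map_sigLaw_of_eq_linearForm (fun | .x22 => h .s2D | .zD2 => 1 | _ => 0)
      (by intro ω; simp [sum_sig]; try ring)
      (by simp [sum_sig, sigVar]; try ring))
  rw [← this]
  congr 1
  funext ω
  simp only [YD2, X12, X22, XR]; ring

lemma mutualInfo_X21_YQ_X11_YD1 :
    mutualInfo (sigLaw p q) (fun ω => (X21 ω, YQ h ω)) (fun ω => (X11 ω, YD1 h ω))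
      = ENNReal.ofReal (Real.log ((1 + q + ‖h .s1R‖₊ ^ 2 * p : ℝ≥0) / (1 + q : ℝ≥0))
        + Real.log ((1 + ‖h .s2D‖₊ ^ 2 * p : ℝ≥0) / (1 : ℝ≥0))) := by
  have := mutualInfo_crossed (μ := sigLaw p q) (X₁ := X21) (X₂ := X11)
    (W := fun ω => ω .zR + ω .zQ) (Z := fun ω => ω .zD1) (by fun_prop) (by fun_prop)
    (by fun_prop) (by fun_prop) (h .s2R) (h .s1R) (h .s2D) (h .s1D)
    (w := 1 + q) (z := 1) (s := 1 + q + ‖h .s1R‖₊ ^ 2 * p) (t := 1 + ‖h .s2D‖₊ ^ 2 * p)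
    (indepFun_sigLaw {.x21} (by fun_prop) (by fun_prop)
      (by intro ω ω' hω; simp at hω; simp [hω])
      (by intro ω ω' hω; simp [hω]))
    (indepFun_sigLaw {.zR, .zQ} (by fun_prop) (by fun_prop)
      (by intro ω ω' hω; simp at hω; simp [hω])
      (by intro ω ω' hω; simp [hω]))
    (indepFun_sigLaw {.x11, .x21} (by fun_prop) (by fun_prop)
      (by intro ω ω' hω; simp at hω; simp [hω])
      (by intro ω ω' hω; simp [hω]))
    (by positivity) one_pos (by positivity) (by positivity)
    (map_sigLaw_of_eq_linearForm (fun | .zR => 1 | .zQ => 1 | _ => 0)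
      (by intro ω; simp [sum_sig]; try ring)
      (by simp [sum_sig, sigVar]; try ring))
    (map_sigLaw_of_eq_linearForm (fun | .zD1 => 1 | _ => 0)
      (by intro ω; simp [sum_sig]; try ring)
      (by simp [sum_sig, sigVar]; try ring))
    (map_sigLaw_of_eq_linearForm (fun | .x11 => h .s1R | .zR => 1 | .zQ => 1 | _ => 0)
      (by intro ω; simp [sum_sig]; try ring)
      (by simp [sum_sig, sigVar]; try ring))
    (indepFun_sigLaw {.x21} (by fun_prop) (by fun_prop)
      (by intro ω ω' hω; simp at hω; simp [hω])
      (by intro ω ω' hω; simp [hω]))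
    (map_sigLaw_of_eq_linearForm (fun | .x21 => h .s2D | .zD1 => 1 | _ => 0)
      (by intro ω; simp [sum_sig]; try ring)
      (by simp [sum_sig, sigVar]; try ring))
    (indepFun_sigLaw {.x11} (by fun_prop) (by fun_prop)
      (by intro ω ω' hω; simp at hω; simp [hω])
      (by intro ω ω' hω; simp [hω]))
  rw [← this]
  congr 1 <;> funext ω
  · simp only [YQ, YR, X11, X21, Prod.mk.injEq, true_and]; ring
  · simp only [YD1, X11, X21, Prod.mk.injEq, true_and]; ring

lemma mutualInfo_X21_YQ :
    mutualInfo (sigLaw p q) X21 (YQ h)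
      = ENNReal.ofReal (Real.log
        ((1 + q + ‖h .s1R‖₊ ^ 2 * p + ‖h .s2R‖₊ ^ 2 * p : ℝ≥0) / (1 + q + ‖h .s1R‖₊ ^ 2 * p : ℝ≥0))) := by
  have := mutualInfo_gaussianChannel (μ := sigLaw p q) (X := X21)
    (N := fun ω => h .s1R * X11 ω + (ω .zR + ω .zQ)) (φ := fun x => h .s2R * x)
    (s := 1 + q + ‖h .s1R‖₊ ^ 2 * p + ‖h .s2R‖₊ ^ 2 * p) (t := 1 + q + ‖h .s1R‖₊ ^ 2 * p)
    (by fun_prop) (by fun_prop) (by fun_prop)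
    (indepFun_sigLaw {.x21} (by fun_prop) (by fun_prop)
      (by intro ω ω' hω; simp at hω; simp [hω])
      (by intro ω ω' hω; simp [hω]))
    (by positivity) (by positivity)
    (map_sigLaw_of_eq_linearForm (fun | .x11 => h .s1R | .zR => 1 | .zQ => 1 | _ => 0)
      (by intro ω; simp [sum_sig]; try ring)
      (by simp [sum_sig, sigVar]; try ring))
    (map_sigLaw_of_eq_linearForm (fun | .x11 => h .s1R | .x21 => h .s2R | .zR => 1 | .zQ => 1 | _ => 0)
      (by intro ω; simp [sum_sig]; try ring)
      (by simp [sum_sig, sigVar]; try ring)) 0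
  rw [← this]
  congr 1
  funext ω
  simp only [YQ, YR, X11, X21]; ring

lemma condMutualInfo_X22_XR :
    condMutualInfo (sigLaw p q) (fun ω => (X22 ω, XR ω)) (YD2 h) X12
      = ENNReal.ofReal (Real.log ((1 + ‖h .s2D‖₊ ^ 2 * p + ‖h .rD‖₊ ^ 2 * p : ℝ≥0) / (1 : ℝ≥0))) := by
  have := condMutualInfo_gaussianChannel (μ := sigLaw p q) (X := fun ω => (X22 ω, XR ω))
    (Z := X12) (N := fun ω => ω .zD2) (φ := fun x => h .s2D * x.1 + h .rD * x.2)
    (ψ := fun x => h .s1D * x) (s := 1 + ‖h .s2D‖₊ ^ 2 * p + ‖h .rD‖₊ ^ 2 * p) (t := 1)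
    (by fun_prop) (by fun_prop) (by fun_prop) (by fun_prop) (by fun_prop)
    (indepFun_sigLaw {.x12} (by fun_prop) (by fun_prop)
      (by intro ω ω' hω; simp at hω; simp [hω])
      (by intro ω ω' hω; simp [hω]))
    (indepFun_sigLaw {.x22, .xR} (by fun_prop) (by fun_prop)
      (by intro ω ω' hω; simp at hω; simp [hω])
      (by intro ω ω' hω; simp [hω]))
    (by positivity) one_pos
    (map_sigLaw_of_eq_linearForm (fun | .zD2 => 1 | _ => 0)
      (by intro ω; simp [sum_sig]; try ring)
      (by simp [sum_sig, sigVar]; try ring))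
    (map_sigLaw_of_eq_linearForm (fun | .x22 => h .s2D | .xR => h .rD | .zD2 => 1 | _ => 0)
      (by intro ω; simp [sum_sig]; try ring)
      (by simp [sum_sig, sigVar]; try ring))
  rw [← this]
  congr 1
  funext ω
  simp only [YD2, X12, X22, XR]; ring

lemma mutualInfo_X11_X21_YQ :
    mutualInfo (sigLaw p q) (fun ω => (X11 ω, X21 ω)) (YQ h)
      = ENNReal.ofReal (Real.log ((1 + q + ‖h .s1R‖₊ ^ 2 * p + ‖h .s2R‖₊ ^ 2 * p : ℝ≥0) / (1 + q : ℝ≥0))) := by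
  have := mutualInfo_gaussianChannel (μ := sigLaw p q) (X := fun ω => (X11 ω, X21 ω))
    (N := fun ω => ω .zR + ω .zQ) (φ := fun x => h .s1R * x.1 + h .s2R * x.2)
    (s := 1 + q + ‖h .s1R‖₊ ^ 2 * p + ‖h .s2R‖₊ ^ 2 * p) (t := 1 + q)
    (by fun_prop) (by fun_prop) (by fun_prop)
    (indepFun_sigLaw {.x11, .x21} (by fun_prop) (by fun_prop)
      (by intro ω ω' hω; simp at hω; simp [hω])
      (by intro ω ω' hω; simp [hω]))
    (by positivity) (by positivity)
    (map_sigLaw_of_eq_linearForm (fun | .zR => 1 | .zQ => 1 | _ => 0)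
      (by intro ω; simp [sum_sig]; try ring)
      (by simp [sum_sig, sigVar]; try ring))
    (map_sigLaw_of_eq_linearForm (fun | .x11 => h .s1R | .x21 => h .s2R | .zR => 1 | .zQ => 1 | _ => 0)
      (by intro ω; simp [sum_sig]; try ring)
      (by simp [sum_sig, sigVar]; try ring)) 0
  rw [← this]
  congr 1
  funext ω
  simp only [YQ, YR, X11, X21]; ring

lemma mutualInfo_X11_X21_YD1 :
    mutualInfo (sigLaw p q) (fun ω => (X11 ω, X21 ω)) (YD1 h)
      = ENNReal.ofReal (Real.log ((1 + ‖h .s1D‖₊ ^ 2 * p + ‖h .s2D‖₊ ^ 2 * p : ℝ≥0) / (1 : ℝ≥0))) := by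
  have := mutualInfo_gaussianChannel (μ := sigLaw p q) (X := fun ω => (X11 ω, X21 ω))
    (N := fun ω => ω .zD1) (φ := fun x => h .s1D * x.1 + h .s2D * x.2)
    (s := 1 + ‖h .s1D‖₊ ^ 2 * p + ‖h .s2D‖₊ ^ 2 * p) (t := 1)
    (by fun_prop) (by fun_prop) (by fun_prop)
    (indepFun_sigLaw {.x11, .x21} (by fun_prop) (by fun_prop)
      (by intro ω ω' hω; simp at hω; simp [hω])
      (by intro ω ω' hω; simp [hω]))
    (by positivity) one_pos
    (map_sigLaw_of_eq_linearForm (fun | .zD1 => 1 | _ => 0)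
      (by intro ω; simp [sum_sig]; try ring)
      (by simp [sum_sig, sigVar]; try ring))
    (map_sigLaw_of_eq_linearForm (fun | .x11 => h .s1D | .x21 => h .s2D | .zD1 => 1 | _ => 0)
      (by intro ω; simp [sum_sig]; try ring)
      (by simp [sum_sig, sigVar]; try ring)) 0
  rw [← this]
  congr 1
  funext ω
  simp only [YD1, X11, X21]; ring

lemma le_mutualInfo_X11_X21 :
    ENNReal.ofReal (max (Real.log ((1 + ‖h .s1D‖₊ ^ 2 * p + ‖h .s2D‖₊ ^ 2 * p : ℝ≥0) / (1 : ℝ≥0)))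
        (Real.log ((1 + q + ‖h .s1R‖₊ ^ 2 * p + ‖h .s2R‖₊ ^ 2 * p : ℝ≥0) / (1 + q : ℝ≥0))))
      ≤ mutualInfo (sigLaw p q) (fun ω => (X11 ω, X21 ω)) (fun ω => (YD1 h ω, YQ h ω)) := by
  rw [ENNReal.ofReal_max, ← mutualInfo_X11_X21_YD1 p q h, ← mutualInfo_X11_X21_YQ p q h]
  exact max_le (mutualInfo_comp_right_le (Y := fun ω => (YD1 h ω, YQ h ω)) (by fun_prop)
      (by fun_prop) measurable_fst)
    (mutualInfo_comp_right_le (Y := fun ω => (YD1 h ω, YQ h ω)) (by fun_prop)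
      (by fun_prop) measurable_snd)

lemma condMutualInfo_X12_X22 :
    condMutualInfo (sigLaw p q) (fun ω => (X12 ω, X22 ω)) (YD2 h) XR
      = ENNReal.ofReal (Real.log ((1 + ‖h .s1D‖₊ ^ 2 * p + ‖h .s2D‖₊ ^ 2 * p : ℝ≥0) / (1 : ℝ≥0))) := by
  have := condMutualInfo_gaussianChannel (μ := sigLaw p q) (X := fun ω => (X12 ω, X22 ω))
    (Z := XR) (N := fun ω => ω .zD2) (φ := fun x => h .s1D * x.1 + h .s2D * x.2)
    (ψ := fun x => h .rD * x) (s := 1 + ‖h .s1D‖₊ ^ 2 * p + ‖h .s2D‖₊ ^ 2 * p) (t := 1)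
    (by fun_prop) (by fun_prop) (by fun_prop) (by fun_prop) (by fun_prop)
    (indepFun_sigLaw {.xR} (by fun_prop) (by fun_prop)
      (by intro ω ω' hω; simp at hω; simp [hω])
      (by intro ω ω' hω; simp [hω]))
    (indepFun_sigLaw {.x12, .x22} (by fun_prop) (by fun_prop)
      (by intro ω ω' hω; simp at hω; simp [hω])
      (by intro ω ω' hω; simp [hω]))
    (by positivity) one_pos
    (map_sigLaw_of_eq_linearForm (fun | .zD2 => 1 | _ => 0)
      (by intro ω; simp [sum_sig]; try ring)
      (by simp [sum_sig, sigVar]; try ring))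
    (map_sigLaw_of_eq_linearForm (fun | .x12 => h .s1D | .x22 => h .s2D | .zD2 => 1 | _ => 0)
      (by intro ω; simp [sum_sig]; try ring)
      (by simp [sum_sig, sigVar]; try ring))
  rw [← this]
  congr 1
  funext ω
  simp only [YD2, X12, X22, XR]; ring

/-- The noise at the destination is independent of the inputs and of the quantized output together,
so the latter adds nothing to what the inputs say about `YD1`. -/
lemma mutualInfo_X11_X21_YQ_YD1 :
    mutualInfo (sigLaw p q) (fun ω => (X11 ω, X21 ω, YQ h ω)) (YD1 h)
      = ENNReal.ofReal (Real.log ((1 + ‖h .s1D‖₊ ^ 2 * p + ‖h .s2D‖₊ ^ 2 * p : ℝ≥0) / (1 : ℝ≥0))) := by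
  have := mutualInfo_gaussianChannel (μ := sigLaw p q) (X := fun ω => (X11 ω, X21 ω, YQ h ω))
    (N := fun ω => ω .zD1) (φ := fun x => h .s1D * x.1 + h .s2D * x.2.1)
    (s := 1 + ‖h .s1D‖₊ ^ 2 * p + ‖h .s2D‖₊ ^ 2 * p) (t := 1)
    (by fun_prop) (by fun_prop) (by fun_prop)
    (indepFun_sigLaw {.x11, .x21, .zR, .zQ} (by fun_prop) (by fun_prop)
      (by intro ω ω' hω; simp at hω; simp [hω])
      (by intro ω ω' hω; simp [hω]))
    (by positivity) one_pos
    (map_sigLaw_of_eq_linearForm (fun | .zD1 => 1 | _ => 0)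
      (by intro ω; simp [sum_sig]; try ring)
      (by simp [sum_sig, sigVar]; try ring))
    (map_sigLaw_of_eq_linearForm (fun | .x11 => h .s1D | .x21 => h .s2D | .zD1 => 1 | _ => 0)
      (by intro ω; simp [sum_sig]; try ring)
      (by simp [sum_sig, sigVar]; try ring)) 0
  rw [← this]
  congr 1
  funext ω
  simp only [YD1, X11, X21]; ring

lemma mutualInfo_X12_X22_XR :
    mutualInfo (sigLaw p q) (fun ω => (X12 ω, X22 ω, XR ω)) (YD2 h)
      = ENNReal.ofReal (Real.log ((1 + ‖h .s1D‖₊ ^ 2 * p + ‖h .s2D‖₊ ^ 2 * p + ‖h .rD‖₊ ^ 2 * p : ℝ≥0) / (1 : ℝ≥0))) := by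
  have := mutualInfo_gaussianChannel (μ := sigLaw p q) (X := fun ω => (X12 ω, X22 ω, XR ω))
    (N := fun ω => ω .zD2) (φ := fun x => h .s1D * x.1 + h .s2D * x.2.1 + h .rD * x.2.2)
    (s := 1 + ‖h .s1D‖₊ ^ 2 * p + ‖h .s2D‖₊ ^ 2 * p + ‖h .rD‖₊ ^ 2 * p) (t := 1)
    (by fun_prop) (by fun_prop) (by fun_prop)
    (indepFun_sigLaw {.x12, .x22, .xR} (by fun_prop) (by fun_prop)
      (by intro ω ω' hω; simp at hω; simp [hω])
      (by intro ω ω' hω; simp [hω]))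
    (by positivity) one_pos
    (map_sigLaw_of_eq_linearForm (fun | .zD2 => 1 | _ => 0)
      (by intro ω; simp [sum_sig]; try ring)
      (by simp [sum_sig, sigVar]; try ring))
    (map_sigLaw_of_eq_linearForm (fun | .x12 => h .s1D | .x22 => h .s2D | .xR => h .rD | .zD2 => 1 | _ => 0)
      (by intro ω; simp [sum_sig]; try ring)
      (by simp [sum_sig, sigVar]; try ring)) 0
  rw [← this]
  congr 1
  funext ω
  simp only [YD2, X12, X22, XR]; ring

end Terms

/-! ### The six rate bounds -/

lemma ofReal_mul_add_ofReal_mul {β x y : ℝ} (h0 : 0 ≤ β) (h1 : β ≤ 1) (hx : 0 ≤ x) (hy : 0 ≤ y) :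
    ENNReal.ofReal β * ENNReal.ofReal x + ENNReal.ofReal (1 - β) * ENNReal.ofReal y
      = ENNReal.ofReal (β * x + (1 - β) * y) := by
  have h2 : 0 ≤ 1 - β := by linarith
  rw [← ENNReal.ofReal_mul h0, ← ENNReal.ofReal_mul h2,
    ← ENNReal.ofReal_add (by positivity) (by positivity)]

lemma log_div_nonneg {x y : ℝ} (hy : 0 < y) (hxy : y ≤ x) : 0 ≤ Real.log (x / y) :=
  Real.log_nonneg ((one_le_div hy).2 hxy)

lemma log_div_add_log_div {x y z : ℝ} (hx : 0 < x) (hy : 0 < y) (hz : 0 < z) :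
    Real.log (y / z) + Real.log (x / y) = Real.log (x / z) := by
  rw [← Real.log_mul (by positivity) (by positivity)]
  congr 1; field_simp

section Formulas

variable {p : ℝ≥0} {β RU : ℝ} {h : Link → ℂ}

local notation "Q" => quantVar p β RU (h Link.s1R) (h Link.s2R)

/-- The two relay terms telescope to a ratio that is symmetric in the sources and is the same in all
three bounds involving the quantization rate. -/
lemma info1u_eq (h0 : 0 ≤ β) (h1 : β ≤ 1) :
    info1u p β RU h = ENNReal.ofReal (β * (Real.log (1 + ‖h .s1D‖ ^ 2 * p)
        + Real.log ((1 + Q + ‖h .s1R‖ ^ 2 * p + ‖h .s2R‖ ^ 2 * p) / (1 + Q)))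
      + (1 - β) * Real.log (1 + ‖h .s1D‖ ^ 2 * p + ‖h .rD‖ ^ 2 * p)) := by
  unfold info1u gqfLaw
  rw [mutualInfo_X11_YQ_X21_YD1, mutualInfo_X11_YQ, condMutualInfo_X12_XR]
  push_cast
  have e := log_div_add_log_div (x := 1 + Q + ‖h .s1R‖ ^ 2 * p + ‖h .s2R‖ ^ 2 * p)
    (y := 1 + Q + ‖h .s2R‖ ^ 2 * p) (z := 1 + Q) (by positivity) (by positivity) (by positivity)
  have p1 : 0 ≤ Real.log ((1 + Q + ‖h .s2R‖ ^ 2 * p) / (1 + Q)) :=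
    log_div_nonneg (by positivity) (le_add_of_nonneg_right (by positivity))
  have p2 : 0 ≤ Real.log (1 + ‖h .s1D‖ ^ 2 * p) :=
    Real.log_nonneg (le_add_of_nonneg_right (by positivity))
  have p3 : 0 ≤ Real.log ((1 + Q + ‖h .s1R‖ ^ 2 * p + ‖h .s2R‖ ^ 2 * p)
      / (1 + Q + ‖h .s2R‖ ^ 2 * p)) :=
    log_div_nonneg (by positivity) (by nlinarith [show 0 ≤ ‖h .s1R‖ ^ 2 * p by positivity])
  rw [div_one, div_one, ← ENNReal.ofReal_add (by positivity) p3,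
    ofReal_mul_add_ofReal_mul h0 h1 (by positivity)
      (Real.log_nonneg (by rw [add_assoc]; exact le_add_of_nonneg_right (by positivity))), ← e]
  congr 3; ring

lemma info2u_eq (h0 : 0 ≤ β) (h1 : β ≤ 1) :
    info2u p β RU h = ENNReal.ofReal (β * (Real.log (1 + ‖h .s2D‖ ^ 2 * p)
        + Real.log ((1 + Q + ‖h .s1R‖ ^ 2 * p + ‖h .s2R‖ ^ 2 * p) / (1 + Q)))
      + (1 - β) * Real.log (1 + ‖h .s2D‖ ^ 2 * p + ‖h .rD‖ ^ 2 * p)) := by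
  unfold info2u gqfLaw
  rw [mutualInfo_X21_YQ_X11_YD1, mutualInfo_X21_YQ, condMutualInfo_X22_XR]
  push_cast
  have e := log_div_add_log_div (x := 1 + Q + ‖h .s1R‖ ^ 2 * p + ‖h .s2R‖ ^ 2 * p)
    (y := 1 + Q + ‖h .s1R‖ ^ 2 * p) (z := 1 + Q) (by positivity) (by positivity) (by positivity)
  have p1 : 0 ≤ Real.log ((1 + Q + ‖h .s1R‖ ^ 2 * p) / (1 + Q)) :=
    log_div_nonneg (by positivity) (le_add_of_nonneg_right (by positivity))
  have p2 : 0 ≤ Real.log (1 + ‖h .s2D‖ ^ 2 * p) :=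
    Real.log_nonneg (le_add_of_nonneg_right (by positivity))
  have p3 : 0 ≤ Real.log ((1 + Q + ‖h .s1R‖ ^ 2 * p + ‖h .s2R‖ ^ 2 * p)
      / (1 + Q + ‖h .s1R‖ ^ 2 * p)) :=
    log_div_nonneg (by positivity) (le_add_of_nonneg_right (by positivity))
  rw [div_one, div_one, ← ENNReal.ofReal_add (by positivity) p3,
    ofReal_mul_add_ofReal_mul h0 h1 (by positivity)
      (Real.log_nonneg (by rw [add_assoc]; exact le_add_of_nonneg_right (by positivity))), ← e]
  congr 3; ring

lemma info12u_eq (h0 : 0 ≤ β) (h1 : β ≤ 1) :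
    info12u p β RU h = ENNReal.ofReal (β * (Real.log (1 + ‖h .s1D‖ ^ 2 * p + ‖h .s2D‖ ^ 2 * p)
        + Real.log ((1 + Q + ‖h .s1R‖ ^ 2 * p + ‖h .s2R‖ ^ 2 * p) / (1 + Q)))
      + (1 - β) * Real.log (1 + ‖h .s1D‖ ^ 2 * p + ‖h .s2D‖ ^ 2 * p + ‖h .rD‖ ^ 2 * p)) := by
  unfold info12u gqfLaw
  rw [mutualInfo_X11_X21_YQ_YD1, mutualInfo_X11_X21_YQ, mutualInfo_X12_X22_XR]
  push_cast
  have p1 : 0 ≤ Real.log ((1 + Q + (‖h .s1R‖ ^ 2 * p + ‖h .s2R‖ ^ 2 * p)) / (1 + Q)) :=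
    log_div_nonneg (by positivity) (le_add_of_nonneg_right (by positivity))
  have p2 : 0 ≤ Real.log (1 + (‖h .s1D‖ ^ 2 * p + ‖h .s2D‖ ^ 2 * p)) :=
    Real.log_nonneg (le_add_of_nonneg_right (by positivity))
  have p3 : 0 ≤ Real.log (1 + (‖h .s1D‖ ^ 2 * p + ‖h .s2D‖ ^ 2 * p + ‖h .rD‖ ^ 2 * p)) :=
    Real.log_nonneg (le_add_of_nonneg_right (by positivity))
  simp only [← add_assoc] at p1 p2 p3
  rw [div_one, div_one, ← ENNReal.ofReal_add p2 p1,
    ofReal_mul_add_ofReal_mul h0 h1 (by positivity) p3]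

lemma le_info1 (h0 : 0 ≤ β) (h1 : β ≤ 1) :
    ENNReal.ofReal (β * max (Real.log (1 + ‖h .s1D‖ ^ 2 * p))
        (Real.log ((1 + Q + ‖h .s1R‖ ^ 2 * p) / (1 + Q)))
      + (1 - β) * Real.log (1 + ‖h .s1D‖ ^ 2 * p)) ≤ info1 p β RU h := by
  have p2 : 0 ≤ Real.log (1 + ‖h .s1D‖ ^ 2 * p) :=
    Real.log_nonneg (le_add_of_nonneg_right (by positivity))
  unfold info1 gqfLaw
  rw [condMutualInfo_X12,
    ← ofReal_mul_add_ofReal_mul h0 h1 (p2.trans (le_max_left _ _)) p2]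
  have := le_condMutualInfo_X11 p Q h
  push_cast at this ⊢
  rw [div_one] at this ⊢
  gcongr

lemma le_info2 (h0 : 0 ≤ β) (h1 : β ≤ 1) :
    ENNReal.ofReal (β * max (Real.log (1 + ‖h .s2D‖ ^ 2 * p))
        (Real.log ((1 + Q + ‖h .s2R‖ ^ 2 * p) / (1 + Q)))
      + (1 - β) * Real.log (1 + ‖h .s2D‖ ^ 2 * p)) ≤ info2 p β RU h := by
  have p2 : 0 ≤ Real.log (1 + ‖h .s2D‖ ^ 2 * p) :=
    Real.log_nonneg (le_add_of_nonneg_right (by positivity))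
  unfold info2 gqfLaw
  rw [condMutualInfo_X22,
    ← ofReal_mul_add_ofReal_mul h0 h1 (p2.trans (le_max_left _ _)) p2]
  have := le_condMutualInfo_X21 p Q h
  push_cast at this ⊢
  rw [div_one] at this ⊢
  gcongr

lemma le_info12 (h0 : 0 ≤ β) (h1 : β ≤ 1) :
    ENNReal.ofReal (β * max (Real.log (1 + ‖h .s1D‖ ^ 2 * p + ‖h .s2D‖ ^ 2 * p))
        (Real.log ((1 + Q + ‖h .s1R‖ ^ 2 * p + ‖h .s2R‖ ^ 2 * p) / (1 + Q)))
      + (1 - β) * Real.log (1 + ‖h .s1D‖ ^ 2 * p + ‖h .s2D‖ ^ 2 * p)) ≤ info12 p β RU h := by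
  have p2 : 0 ≤ Real.log (1 + (‖h .s1D‖ ^ 2 * p + ‖h .s2D‖ ^ 2 * p)) :=
    Real.log_nonneg (le_add_of_nonneg_right (by positivity))
  rw [← add_assoc] at p2
  unfold info12 gqfLaw
  rw [condMutualInfo_X12_X22,
    ← ofReal_mul_add_ofReal_mul h0 h1 (p2.trans (le_max_left _ _)) p2]
  have := le_mutualInfo_X11_X21 p Q h
  push_cast at this ⊢
  rw [div_one] at this ⊢
  gcongr

end Formulas

/-! ### The quantizer -/

lemma coe_quantVar {snr β RU : ℝ} (hs : 0 ≤ snr) (hβ : 0 < β) (hRU : 0 < RU) (a b : ℂ) :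
    (quantVar snr β RU a b : ℝ)
      = (1 + ‖a‖ ^ 2 * snr + ‖b‖ ^ 2 * snr) / (Real.exp (RU / β) - 1) := by
  have : 1 < Real.exp (RU / β) := Real.one_lt_exp_iff.2 (by positivity)
  exact Real.coe_toNNReal _ (div_nonneg (by positivity) (by linarith))

lemma quantVar_pos {snr β RU : ℝ} (hs : 0 ≤ snr) (hβ : 0 < β) (hRU : 0 < RU) (a b : ℂ) :
    0 < quantVar snr β RU a b := by
  have : 1 < Real.exp (RU / β) := Real.one_lt_exp_iff.2 (by positivity)
  rw [← NNReal.coe_pos, coe_quantVar hs hβ hRU]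
  exact div_pos (by positivity) (by linarith)

/-- The output-to-quantization-noise ratio is fixed by the quantization rate. -/
lemma add_quantVar_div {snr β RU : ℝ} (hs : 0 ≤ snr) (hβ : 0 < β) (hRU : 0 < RU) (a b : ℂ) :
    (1 + ‖a‖ ^ 2 * snr + ‖b‖ ^ 2 * snr + quantVar snr β RU a b) / quantVar snr β RU a b
      = Real.exp (RU / β) := by
  have h1 : 1 < Real.exp (RU / β) := Real.one_lt_exp_iff.2 (by positivity)
  have h2 : 0 < Real.exp (RU / β) - 1 := by linarith
  have h3 : 0 < 1 + ‖a‖ ^ 2 * snr + ‖b‖ ^ 2 * snr := by positivity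
  rw [coe_quantVar hs hβ hRU]
  field_simp
  ring

/-- Lowering the denominator from 1 + q to q turns the ratio into the one the quantizer fixes: no
more than the quantization rate passes through the relay. It is this bound that removes r_U from the
converse. -/
lemma log_relay_ratio_le {snr β RU : ℝ} (hs : 0 ≤ snr) (hβ : 0 < β) (hRU : 0 < RU) (a b : ℂ) :
    Real.log ((1 + quantVar snr β RU a b + ‖a‖ ^ 2 * snr + ‖b‖ ^ 2 * snr)
      / (1 + quantVar snr β RU a b)) ≤ RU / β := by
  have hq : 0 < (quantVar snr β RU a b : ℝ) := quantVar_pos hs hβ hRU a b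
  rw [Real.log_le_iff_le_exp (by positivity), ← add_quantVar_div hs hβ hRU a b]
  gcongr ?_ / ?_ <;> linarith

theorem mul_mutualInfo_YR_YQ {β RU snr : ℝ} (hβ : 0 < β) (hRU : 0 < RU) (hs : 0 < snr)
    (h : Link → ℂ) :
    ENNReal.ofReal β * mutualInfo (gqfLaw snr β RU h) (YR h) (YQ h) = ENNReal.ofReal RU := by
  lift snr to ℝ≥0 using hs.le
  have hq := quantVar_pos hs.le hβ hRU (h .s1R) (h .s2R)
  rw [gqfLaw, mutualInfo_YR_YQ _ _ _ hq, ← ENNReal.ofReal_mul hβ.le]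
  push_cast
  rw [add_quantVar_div hs.le hβ hRU, Real.log_exp, mul_div_cancel₀ _ hβ.ne']

/-! ### Probabilities of fading events -/

lemma sum_link {M : Type*} [AddCommMonoid M] (f : Link → M) :
    ∑ i, f i = f .s1D + f .s2D + f .s1R + f .s2R + f .rD := by
  have : (Finset.univ : Finset Link) = {.s1D, .s2D, .s1R, .s2R, .rD} := rfl
  rw [this]
  repeat rw [Finset.sum_insert (by decide)]
  rw [Finset.sum_singleton]
  simp only [add_assoc]

lemma prod_link {M : Type*} [CommMonoid M] (f : Link → M) :
    ∏ i, f i = f .s1D * f .s2D * f .s1R * f .s2R * f .rD := by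
  have : (Finset.univ : Finset Link) = {.s1D, .s2D, .s1R, .s2R, .rD} := rfl
  rw [this]
  repeat rw [Finset.prod_insert (by decide)]
  rw [Finset.prod_singleton]
  simp only [mul_assoc]

/-- The channels whose squared gains are of the orders `snr ^ (-e i)`. -/
def gainBox (e : Link → ℝ) (snr : ℝ) : Set (Link → ℂ) :=
  {h | ∀ i, snr ^ (-e i) / 2 ≤ ‖h i‖ ^ 2 ∧ ‖h i‖ ^ 2 ≤ snr ^ (-e i)}

lemma measurableSet_gainBox (e : Link → ℝ) (snr : ℝ) : MeasurableSet (gainBox e snr) := by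
  unfold gainBox
  have hm : ∀ i, Measurable fun h : Link → ℂ => ‖h i‖ ^ 2 := fun i => by fun_prop
  simp only [Set.ofPred_forall]
  exact MeasurableSet.iInter fun i =>
    (measurableSet_le measurable_const (hm i)).inter (measurableSet_le (hm i) measurable_const)

/-- Independence multiplies the annulus bounds, and the strict gap between `d` and the sum of the
exponents absorbs the constants. The factor K is used with K = 2 to offset the conditional error
probability 1/2 in the converse for codes. -/
lemma eventually_le_gainBox {v : Link → ℝ≥0} (hv : ∀ i, 0 < v i) {e : Link → ℝ}
    (he : ∀ i, 0 ≤ e i) {d : ℝ} (hd : ∑ i, e i < d) (K : ℝ) :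
    ∀ᶠ snr : ℝ in Filter.atTop, K * snr ^ (-d) ≤ (fadingLaw v).real (gainBox e snr) := by
  choose c hc hcb using fun i => exists_le_complexGaussian_annulus (hv i)
  have hC : 0 < ∏ i, c i := Finset.prod_pos fun i _ => hc i
  have hlim : Filter.Tendsto (fun snr : ℝ => K * snr ^ (-(d - ∑ i, e i))) Filter.atTop (𝓝 (K * 0)) :=
    (tendsto_rpow_neg_atTop (by linarith)).const_mul K
  rw [mul_zero] at hlim
  filter_upwards [hlim.eventually_le_const hC, Filter.eventually_ge_atTop 1] with snr h1 h2
  have h0 : 0 < snr := by linarith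
  have hbox : gainBox e snr
      = Set.univ.pi fun i => {z : ℂ | snr ^ (-e i) / 2 ≤ ‖z‖ ^ 2 ∧ ‖z‖ ^ 2 ≤ snr ^ (-e i)} := by
    ext h; simp [gainBox]
  rw [hbox, measureReal_def, fadingLaw, Measure.pi_pi, ENNReal.toReal_prod]
  calc K * snr ^ (-d) = (K * snr ^ (-(d - ∑ i, e i))) * snr ^ (-∑ i, e i) := by
        rw [mul_assoc, ← Real.rpow_add h0]; congr 2; ring
    _ ≤ (∏ i, c i) * snr ^ (-∑ i, e i) := by gcongr
    _ = ∏ i, c i * snr ^ (-e i) := by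
        rw [Finset.prod_mul_distrib, ← Finset.sum_neg_distrib, Real.rpow_sum_of_pos h0]
    _ ≤ _ := Finset.prod_le_prod (fun i _ => by have := hc i; positivity) fun i _ =>
        hcb i _ (by positivity) (Real.rpow_le_one_of_one_le_of_nonpos h2 (by linarith [he i]))

lemma diversityAtMost_of_gainBox_subset {v : Link → ℝ≥0} (hv : ∀ i, 0 < v i) {d : ℝ}
    {E : ℝ → Set (Link → ℂ)}
    (h : ∀ ε > 0, ∃ e : Link → ℝ, (∀ i, 0 ≤ e i) ∧ ∑ i, e i < d + ε ∧
      ∀ᶠ snr : ℝ in Filter.atTop, gainBox e snr ⊆ E snr) :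
    DiversityAtMost (fun snr => (fadingLaw v).real (E snr)) d := by
  intro ε hε
  obtain ⟨e, he, hd, hE⟩ := h ε hε
  filter_upwards [eventually_le_gainBox hv he hd 1, hE] with snr h1 h2
  rw [one_mul] at h1
  exact h1.trans (measureReal_mono h2)

/-- A weight that is large when a gain is close to zero. -/
def weight (h : Link → ℂ) : ℝ := ∏ i, ((1 + ‖h i‖ ^ 2) ^ 4 / ‖h i‖ ^ 2)

lemma integrable_weight_rpow {v : Link → ℝ≥0} (hv : ∀ i, 0 < v i) {p : ℝ} (hp0 : 0 ≤ p)
    (hp : p < 1) : Integrable (fun h => weight h ^ p) (fadingLaw v) := by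
  have := Integrable.fintype_prod (μ := fun i => complexGaussian (v i))
    (f := fun _ z => ((1 + ‖z‖ ^ 2) ^ 4 / ‖z‖ ^ 2) ^ p)
    fun i => integrable_weight_complexGaussian (hv i) hp0 hp 4
  refine this.congr (Filter.Eventually.of_forall fun h => ?_)
  exact Real.finsetProd_rpow _ _ (fun i _ => by positivity) p

/-- At a vanishing gain the quotient in `weight` is 0 by convention, so the weight controls outages
only off this null set. -/
lemma ae_ne_zero_fadingLaw {v : Link → ℝ≥0} (hv : ∀ i, 0 < v i) :
    ∀ᵐ h ∂fadingLaw v, ∀ i, h i ≠ 0 := by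
  rw [ae_all_iff]
  intro i
  have h1 : ∀ᵐ z ∂complexGaussian (v i), z ≠ 0 := by
    rw [complexGaussian_eq_withDensity (hv i)]
    exact (withDensity_absolutelyContinuous _ _).ae_le (Measure.ae_ne volume 0)
  exact (Measure.quasiMeasurePreserving_eval (μ := fun i => complexGaussian (v i)) i).ae h1

/-- Markov's inequality for a power p < 1 of the weight; p = 1 is not available because the first
moment of a reciprocal squared gain diverges. -/
lemma eventually_fadingLaw_le {v : Link → ℝ≥0} (hv : ∀ i, 0 < v i) {d C : ℝ} (hC : 0 ≤ C)
    {E : ℝ → Set (Link → ℂ)}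
    (hE : ∀ᶠ snr : ℝ in Filter.atTop, ∀ h ∈ E snr, (∀ i, h i ≠ 0) → snr ^ d ≤ C * weight h)
    {ε : ℝ} (hε : 0 < ε) :
    ∀ᶠ snr : ℝ in Filter.atTop, (fadingLaw v).real (E snr) ≤ snr ^ (-(d - ε)) := by
  rcases le_or_gt d ε with hdε | hdε
  · filter_upwards [Filter.eventually_ge_atTop 1] with snr hs
    exact measureReal_le_one.trans (Real.one_le_rpow hs (by linarith))
  have hd0 : 0 < d := hε.trans hdε
  -- This order costs ε/2 in the exponent; the other ε/2 absorbs the constant C^p M.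
  set p : ℝ := 1 - ε / (2 * d) with hp
  have hp0 : 0 < p := by
    rw [hp, sub_pos, div_lt_one (by positivity)]; linarith
  have hp1 : p < 1 := by
    have : 0 < ε / (2 * d) := by positivity
    linarith
  have hdp : d * p = d - ε / 2 := by rw [hp]; field_simp
  set M : ℝ := ∫ h, weight h ^ p ∂fadingLaw v with hM
  have hlim : Filter.Tendsto (fun snr : ℝ => (C ^ p * M) * snr ^ (-(ε / 2))) Filter.atTop
      (𝓝 ((C ^ p * M) * 0)) := (tendsto_rpow_neg_atTop (by linarith)).const_mul _
  rw [mul_zero] at hlim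
  filter_upwards [hE, Filter.eventually_gt_atTop 0, hlim.eventually_le_const one_pos]
    with snr h1 h0 h2
  have hw : ∀ h, 0 ≤ weight h := fun h => Finset.prod_nonneg fun i _ => by positivity
  have hsub : (fadingLaw v).real (E snr)
      ≤ (fadingLaw v).real {h | snr ^ (d * p) ≤ C ^ p * weight h ^ p} := by
    refine ENNReal.toReal_mono (by finiteness) (measure_mono_ae ?_)
    filter_upwards [ae_ne_zero_fadingLaw hv] with h hh hhE
    have := h1 h hhE hh
    change snr ^ (d * p) ≤ C ^ p * weight h ^ p
    rw [Real.rpow_mul h0.le, ← Real.mul_rpow hC (hw h)]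
    gcongr
  have hmk := mul_meas_ge_le_integral_of_nonneg (μ := fadingLaw v)
    (f := fun h => C ^ p * weight h ^ p) (Filter.Eventually.of_forall fun h => by
      have := hw h
      simp only [Pi.zero_apply]; positivity)
    ((integrable_weight_rpow hv hp0.le hp1).const_mul _) (snr ^ (d * p))
  rw [integral_const_mul, ← hM] at hmk
  have hpos : 0 < snr ^ (d * p) := by positivity
  calc _ ≤ _ := hsub
    _ ≤ C ^ p * M / snr ^ (d * p) := by rw [le_div_iff₀ hpos, mul_comm]; exact hmk
    _ = (C ^ p * M * snr ^ (-(ε / 2))) * snr ^ (-(d - ε)) := by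
        rw [hdp, mul_assoc _ (snr ^ _), ← Real.rpow_add h0, div_eq_mul_inv, ← Real.rpow_neg h0.le]
        congr 2; ring
    _ ≤ 1 * snr ^ (-(d - ε)) := by gcongr
    _ = _ := one_mul _

lemma dotEq_of_bounds {f : ℝ → ℝ} {d : ℝ} (hl : DiversityAtMost f d)
    (hu : ∀ ε > 0, ∀ᶠ snr : ℝ in Filter.atTop, f snr ≤ snr ^ (-(d - ε))) : DotEq f (-d) := by
  refine ⟨?_, ?_⟩
  · filter_upwards [hl 1 one_pos, Filter.eventually_gt_atTop 0] with snr h1 h2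
    exact (Real.rpow_pos_of_pos h2 _).trans_le h1
  · rw [Metric.tendsto_nhds]
    intro ε hε
    filter_upwards [hl (ε / 2) (by linarith), hu (ε / 2) (by linarith),
      Filter.eventually_gt_atTop 1] with snr h1 h2 h3
    have h0 : 0 < snr := by linarith
    have hlog : 0 < Real.log snr := Real.log_pos h3
    have hf : 0 < f snr := (Real.rpow_pos_of_pos h0 _).trans_le h1
    have h1' := Real.log_le_log (Real.rpow_pos_of_pos h0 _) h1
    have h2' := Real.log_le_log hf h2
    rw [Real.log_rpow h0] at h1' h2'
    rw [Real.dist_eq, abs_lt]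
    have e1 : -(d + ε / 2) ≤ Real.log (f snr) / Real.log snr := by rwa [le_div_iff₀ hlog]
    have e2 : Real.log (f snr) / Real.log snr ≤ -(d - ε / 2) := by rwa [div_le_iff₀ hlog]
    constructor <;> linarith

lemma eventually_const_add_const_mul_rpow_lt {r δ : ℝ} (hr : 0 < r) (hδ : 0 < δ) (K : ℝ) :
    ∀ᶠ snr : ℝ in Filter.atTop, K + K * snr ^ (r - δ) < snr ^ r := by
  have h1 : Filter.Tendsto (fun snr : ℝ => K * snr ^ (-r) + K * snr ^ (-δ)) Filter.atTop
      (𝓝 (K * 0 + K * 0)) :=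
    ((tendsto_rpow_neg_atTop hr).const_mul K).add ((tendsto_rpow_neg_atTop hδ).const_mul K)
  simp only [mul_zero, add_zero] at h1
  filter_upwards [h1.eventually_lt_const one_pos, Filter.eventually_gt_atTop 0] with snr h2 h0
  have h3 : 0 < snr ^ r := by positivity
  calc K + K * snr ^ (r - δ) = (K * snr ^ (-r) + K * snr ^ (-δ)) * snr ^ r := by
        rw [add_mul, mul_assoc, mul_assoc, ← Real.rpow_add h0, ← Real.rpow_add h0]
        rw [neg_add_cancel, Real.rpow_zero, neg_add_eq_sub, mul_one]
    _ < 1 * snr ^ r := by gcongr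
    _ = _ := one_mul _

/-! ### Lower bounds for the outage probability -/

/-- The event that source 1 and the relay are received too weakly at the destination. -/
lemma diversityAtMost_gqfOutageProb_two_sub {v : Link → ℝ≥0} (hv : ∀ i, 0 < v i) {r β rU : ℝ}
    (hr : 0 < r) (hr1 : r ≤ 1) (hβ : 0 < β) (hβ1 : β < 1) (hrU : 0 < rU) :
    DiversityAtMost (gqfOutageProb v β rU r) (2 - r) := by
  refine diversityAtMost_of_gainBox_subset hv fun ε hε => ?_
  -- Both received powers are then at most S^(r/2 - ε/4), and the total cost is 2 - r + ε/2.
  refine ⟨fun | .s1D => 1 - r / 2 + ε / 4 | .rD => 1 - r / 2 + ε / 4 | _ => 0, ?_, ?_, ?_⟩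
  · rintro (_ | _ | _ | _ | _) <;> simp <;> linarith
  · simp [sum_link]; linarith
  filter_upwards [Filter.eventually_gt_atTop 1,
    eventually_const_add_const_mul_rpow_lt (r := r / 2) (δ := ε / 4) (by linarith) (by linarith) 2]
    with snr h1 h2 h hh
  have h0 : 0 < snr := by linarith
  lift snr to ℝ≥0 using h0.le
  have hlog : 0 < Real.log snr := Real.log_pos h1
  have hx : ∀ x : ℝ, x ≤ snr ^ (-(1 - r / 2 + ε / 4)) → x * snr ≤ (snr : ℝ) ^ (r / 2 - ε / 4) := by
    intro x hx
    calc x * snr ≤ (snr : ℝ) ^ (-(1 - r / 2 + ε / 4)) * (snr : ℝ) ^ (1 : ℝ) := by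
          rw [Real.rpow_one]; gcongr
      _ = _ := by rw [← Real.rpow_add h0]; congr 1; ring
  have ha := hx _ (hh .s1D).2
  have hg := hx _ (hh .rD).2
  have hp : 0 ≤ (snr : ℝ) ^ (r / 2 - ε / 4) := by positivity
  have hrl : Real.log ((snr : ℝ) ^ (r / 2)) = r / 2 * Real.log snr := Real.log_rpow h0 _
  have hna : 0 ≤ ‖h .s1D‖ ^ 2 * (snr : ℝ) := by positivity
  have hng : 0 ≤ ‖h .rD‖ ^ 2 * (snr : ℝ) := by positivity
  have l1 : Real.log (1 + ‖h .s1D‖ ^ 2 * snr) < r / 2 * Real.log snr := by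
    rw [← hrl]; exact Real.log_lt_log (by positivity) (by linarith)
  have l2 : Real.log (1 + ‖h .s1D‖ ^ 2 * snr + ‖h .rD‖ ^ 2 * snr) < r / 2 * Real.log snr := by
    rw [← hrl]; exact Real.log_lt_log (by positivity) (by linarith)
  -- Multiplied by β, the relay term is at most R_U and cancels; a convex combination of two
  -- logarithms below R₁ is left.
  have l3 := log_relay_ratio_le h0.le hβ (mul_pos hrU hlog) (h .s1R) (h .s2R)
  rw [le_div_iff₀ hβ] at l3
  refine Or.inl (Or.inl (Or.inl (Or.inl (Or.inr ?_))))
  change info1u _ _ _ _ < _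
  rw [info1u_eq hβ.le hβ1.le, ENNReal.ofReal_lt_ofReal_iff (by positivity)]
  have m1 := mul_lt_mul_of_pos_left l1 hβ
  have m2 := mul_lt_mul_of_pos_left l2 (sub_pos.2 hβ1)
  linarith

/-- The event that both sources and the relay are received too weakly at the destination. -/
lemma diversityAtMost_gqfOutageProb_three_mul {v : Link → ℝ≥0} (hv : ∀ i, 0 < v i) {r β rU : ℝ}
    (hr : 0 < r) (hr1 : r ≤ 1) (hβ : 0 < β) (hβ1 : β < 1) (hrU : 0 < rU) :
    DiversityAtMost (gqfOutageProb v β rU r) (3 * (1 - r)) := by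
  refine diversityAtMost_of_gainBox_subset hv fun ε hε => ?_
  -- All three received powers are at most S^(r - ε/4), at total cost 3(1 - r) + 3ε/4.
  refine ⟨fun | .s1D => 1 - r + ε / 4 | .s2D => 1 - r + ε / 4 | .rD => 1 - r + ε / 4 | _ => 0,
    ?_, ?_, ?_⟩
  · rintro (_ | _ | _ | _ | _) <;> simp <;> linarith
  · simp [sum_link]; linarith
  filter_upwards [Filter.eventually_gt_atTop 1,
    eventually_const_add_const_mul_rpow_lt (r := r) (δ := ε / 4) (by linarith) (by linarith) 3]
    with snr h1 h2 h hh
  have h0 : 0 < snr := by linarith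
  lift snr to ℝ≥0 using h0.le
  have hlog : 0 < Real.log snr := Real.log_pos h1
  have hx : ∀ x : ℝ, x ≤ snr ^ (-(1 - r + ε / 4)) → x * snr ≤ (snr : ℝ) ^ (r - ε / 4) := by
    intro x hx
    calc x * snr ≤ (snr : ℝ) ^ (-(1 - r + ε / 4)) * (snr : ℝ) ^ (1 : ℝ) := by
          rw [Real.rpow_one]; gcongr
      _ = _ := by rw [← Real.rpow_add h0]; congr 1; ring
  have ha := hx _ (hh .s1D).2
  have hb := hx _ (hh .s2D).2
  have hg := hx _ (hh .rD).2
  have hp : 0 ≤ (snr : ℝ) ^ (r - ε / 4) := by positivity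
  have hrl : Real.log ((snr : ℝ) ^ r) = r * Real.log snr := Real.log_rpow h0 _
  have hna : 0 ≤ ‖h .s1D‖ ^ 2 * (snr : ℝ) := by positivity
  have hnb : 0 ≤ ‖h .s2D‖ ^ 2 * (snr : ℝ) := by positivity
  have hng : 0 ≤ ‖h .rD‖ ^ 2 * (snr : ℝ) := by positivity
  have l1 : Real.log (1 + ‖h .s1D‖ ^ 2 * snr + ‖h .s2D‖ ^ 2 * snr) < r * Real.log snr := by
    rw [← hrl]; exact Real.log_lt_log (by positivity) (by linarith)
  have l2 : Real.log (1 + ‖h .s1D‖ ^ 2 * snr + ‖h .s2D‖ ^ 2 * snr + ‖h .rD‖ ^ 2 * snr)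
      < r * Real.log snr := by
    rw [← hrl]; exact Real.log_lt_log (by positivity) (by linarith)
  have l3 := log_relay_ratio_le h0.le hβ (mul_pos hrU hlog) (h .s1R) (h .s2R)
  rw [le_div_iff₀ hβ] at l3
  refine Or.inr ?_
  change info12u _ _ _ _ < _
  rw [info12u_eq hβ.le hβ1.le, ENNReal.ofReal_lt_ofReal_iff (by positivity)]
  have m1 := mul_lt_mul_of_pos_left l1 hβ
  have m2 := mul_lt_mul_of_pos_left l2 (sub_pos.2 hβ1)
  linarith

theorem diversityAtMost_gqfOutageProb {v : Link → ℝ≥0} (hv : ∀ i, 0 < v i) {r β rU : ℝ}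
    (hr : 0 < r) (hr1 : r ≤ 1) (hβ : 0 < β) (hβ1 : β < 1) (hrU : 0 < rU) :
    DiversityAtMost (gqfOutageProb v β rU r) (dmt r) := by
  unfold dmt
  split_ifs
  · exact diversityAtMost_gqfOutageProb_two_sub hv hr hr1 hβ hβ1 hrU
  · exact diversityAtMost_gqfOutageProb_three_mul hv hr hr1 hβ hβ1 hrU

/-- At vanishing rates the event that source 1 and the relay are not received is an outage. -/
lemma diversityAtMost_gqfOutageProb_zero {v : Link → ℝ≥0} (hv : ∀ i, 0 < v i) :
    DiversityAtMost (gqfOutageProb v (1 / 2) (1 / 2) 0) 2 := by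
  refine diversityAtMost_of_gainBox_subset hv fun ε hε => ?_
  -- With R₁ = 0 the destination's logarithms, being non-negative, leave no slack. The exponents ε/4
  -- at the relay lower its ratio to at most 1 + 2S^(1 - ε/4), which beats the constants 2 and 3
  -- from the destination.
  refine ⟨fun | .s1D => 1 | .rD => 1 | .s1R => ε / 4 | .s2R => ε / 4 | _ => 0, ?_, ?_, ?_⟩
  · rintro (_ | _ | _ | _ | _) <;> simp <;> linarith
  · simp [sum_link]; linarith
  filter_upwards [Filter.eventually_gt_atTop 1,
    eventually_const_add_const_mul_rpow_lt (r := 1) (δ := ε / 4) one_pos (by linarith) 12]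
    with snr h1 h2 h hh
  have h0 : 0 < snr := by linarith
  lift snr to ℝ≥0 using h0.le
  have hlog : 0 < Real.log snr := Real.log_pos h1
  have hx : ∀ x e : ℝ, x ≤ snr ^ (-e) → x * snr ≤ (snr : ℝ) ^ (1 - e) := by
    intro x e hx
    calc x * snr ≤ (snr : ℝ) ^ (-e) * (snr : ℝ) ^ (1 : ℝ) := by
          rw [Real.rpow_one]; gcongr
      _ = _ := by rw [← Real.rpow_add h0]; congr 1; ring
  have ha := hx _ _ (hh .s1D).2
  have hg := hx _ _ (hh .rD).2
  have hb := hx _ _ (hh .s1R).2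
  have hb2 := hx _ _ (hh .s2R).2
  simp only [sub_self, Real.rpow_zero] at ha hg
  have hp : 0 ≤ (snr : ℝ) ^ (1 - ε / 4) := by positivity
  rw [Real.rpow_one] at h2
  have hna : 0 ≤ ‖h .s1D‖ ^ 2 * (snr : ℝ) := by positivity
  have hng : 0 ≤ ‖h .rD‖ ^ 2 * (snr : ℝ) := by positivity
  have hn1 : 0 ≤ ‖h .s1R‖ ^ 2 * (snr : ℝ) := by positivity
  have hn2 : 0 ≤ ‖h .s2R‖ ^ 2 * (snr : ℝ) := by positivity
  refine Or.inl (Or.inl (Or.inl (Or.inl (Or.inr ?_))))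
  change info1u _ _ _ _ < _
  rw [info1u_eq (by norm_num) (by norm_num), ENNReal.ofReal_lt_ofReal_iff (by positivity)]
  set q := quantVar snr (1 / 2) (1 / 2 * Real.log snr) (h .s1R) (h .s2R)
  have hq0 : (0 : ℝ) ≤ q := NNReal.coe_nonneg _
  have l1 : Real.log (1 + ‖h .s1D‖ ^ 2 * snr) ≤ Real.log 2 :=
    Real.log_le_log (by positivity) (by linarith)
  have l2 : Real.log (1 + ‖h .s1D‖ ^ 2 * snr + ‖h .rD‖ ^ 2 * snr) ≤ Real.log 3 :=
    Real.log_le_log (by positivity) (by linarith)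
  have l3 : Real.log ((1 + q + ‖h .s1R‖ ^ 2 * snr + ‖h .s2R‖ ^ 2 * snr) / (1 + q))
      ≤ Real.log (1 + 2 * (snr : ℝ) ^ (1 - ε / 4)) := by
    refine Real.log_le_log (by positivity) ?_
    rw [div_le_iff₀ (by positivity)]
    nlinarith
  have l4 : Real.log 2 + Real.log 3 + Real.log (1 + 2 * (snr : ℝ) ^ (1 - ε / 4))
      < Real.log snr := by
    rw [← Real.log_mul (by norm_num) (by norm_num), ← Real.log_mul (by norm_num) (by positivity)]
    exact Real.log_lt_log (by positivity) (by linarith)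
  linarith

/-! ### Upper bound for the outage probability -/

/-! ### Monomials in the gains against the weight. -/

section Algebra

lemma mul_le_mul_of_five {x₁ x₂ x₃ x₄ x₅ y₁ y₂ y₃ y₄ y₅ : ℝ} (h₁ : 0 ≤ x₁) (h₂ : 0 ≤ x₂)
    (h₃ : 0 ≤ x₃) (h₄ : 0 ≤ x₄) (h₅ : 0 ≤ x₅) (l₁ : x₁ ≤ y₁) (l₂ : x₂ ≤ y₂) (l₃ : x₃ ≤ y₃)
    (l₄ : x₄ ≤ y₄) (l₅ : x₅ ≤ y₅) : x₁ * x₂ * x₃ * x₄ * x₅ ≤ y₁ * y₂ * y₃ * y₄ * y₅ := by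
  have := h₁.trans l₁
  have := h₂.trans l₂
  have := h₃.trans l₃
  have := h₄.trans l₄
  gcongr

variable {a₁ a₂ b₁ b₂ g T : ℝ}

/-- Split the product of the gains into a part m controlled by the outage condition and a rest n.
With P the product of all 1 + gain, m contributes P² and n contributes P; the fourth power leaves
room. -/
lemma mul_prod_le_of_mul_le (ha₁ : 0 < a₁) (ha₂ : 0 < a₂) (hb₁ : 0 < b₁) (hb₂ : 0 < b₂)
    (hg : 0 < g) {m n K : ℝ} (hK : 0 ≤ K) (hn : 0 ≤ n)
    (hT : T * m ≤ K * ((1 + b₁) * (1 + b₂)) ^ 2)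
    (hnP : n ≤ (1 + a₁) * (1 + a₂) * (1 + b₁) * (1 + b₂) * (1 + g)) :
    T * (m * n) ≤ K * ((1 + a₁) * (1 + a₂) * (1 + b₁) * (1 + b₂) * (1 + g)) ^ 4 := by
  have h1 : (1 + b₁) * (1 + b₂) ≤ (1 + a₁) * (1 + a₂) * (1 + b₁) * (1 + b₂) * (1 + g) := by
    have := mul_le_mul_of_five (x₁ := 1) (x₂ := 1) (x₃ := 1 + b₁) (x₄ := 1 + b₂) (x₅ := 1)
      (y₁ := 1 + a₁) (y₂ := 1 + a₂) (y₃ := 1 + b₁) (y₄ := 1 + b₂) (y₅ := 1 + g)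
      (by positivity) (by positivity) (by positivity) (by positivity) (by positivity)
      (by linarith) (by linarith) le_rfl le_rfl (by linarith)
    simpa using this
  have h2 : 1 ≤ (1 + b₁) * (1 + b₂) := by nlinarith [mul_pos hb₁ hb₂]
  have hP := h2.trans h1
  generalize (1 + a₁) * (1 + a₂) * (1 + b₁) * (1 + b₂) * (1 + g) = P at *
  calc T * (m * n) = T * m * n := by ring
    _ ≤ K * ((1 + b₁) * (1 + b₂)) ^ 2 * n := by gcongr
    _ ≤ K * P ^ 2 * P := by gcongr
    _ = K * P ^ 3 := by ring
    _ ≤ K * P ^ 4 := by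
        gcongr
        norm_num

lemma two_mul_le_four_mul_sq {N : ℝ} (hN : 1 ≤ N) : 2 * N ≤ 4 * N ^ 2 := by nlinarith

lemma mul_prod_le_of_single (ha₁ : 0 < a₁) (ha₂ : 0 < a₂) (hb₁ : 0 < b₁) (hb₂ : 0 < b₂)
    (hg : 0 < g) (hT : T * (a₁ * b₁) ≤ 2 * ((1 + b₁) * (1 + b₂))) :
    T * (a₁ * a₂ * b₁ * b₂ * g)
      ≤ 4 * ((1 + a₁) * (1 + a₂) * (1 + b₁) * (1 + b₂) * (1 + g)) ^ 4 := by
  rw [show a₁ * a₂ * b₁ * b₂ * g = (a₁ * b₁) * (1 * a₂ * 1 * b₂ * g) by ring]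
  refine mul_prod_le_of_mul_le ha₁ ha₂ hb₁ hb₂ hg (by norm_num) (by positivity) ?_
    (mul_le_mul_of_five (by positivity) (by positivity) (by positivity) (by positivity)
      (by positivity) (by linarith) (by linarith) (by linarith) (by linarith) (by linarith))
  exact hT.trans (two_mul_le_four_mul_sq (by nlinarith [mul_pos hb₁ hb₂]))

lemma mul_prod_le_of_single_relay (ha₁ : 0 < a₁) (ha₂ : 0 < a₂) (hb₁ : 0 < b₁) (hb₂ : 0 < b₂)
    (hg : 0 < g) (hT0 : 0 ≤ T) (hT : T * (a₁ * (b₁ + b₂) * g) ≤ 2 * ((1 + b₁) * (1 + b₂))) :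
    T * (a₁ * a₂ * b₁ * b₂ * g)
      ≤ 4 * ((1 + a₁) * (1 + a₂) * (1 + b₁) * (1 + b₂) * (1 + g)) ^ 4 := by
  rw [show a₁ * a₂ * b₁ * b₂ * g = (a₁ * b₁ * g) * (1 * a₂ * 1 * b₂ * 1) by ring]
  refine mul_prod_le_of_mul_le ha₁ ha₂ hb₁ hb₂ hg (by norm_num) (by positivity) ?_
    (mul_le_mul_of_five (by positivity) (by positivity) (by positivity) (by positivity)
      (by positivity) (by linarith) (by linarith) (by linarith) (by linarith) (by linarith))
  have : T * (a₁ * b₁ * g) ≤ T * (a₁ * (b₁ + b₂) * g) := by gcongr; linarith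
  exact (this.trans hT).trans (two_mul_le_four_mul_sq (by nlinarith [mul_pos hb₁ hb₂]))

/-- Since a₁a₂ ≤ (a₁ + a₂)² and b₁b₂ ≤ (b₁ + b₂)², squaring the condition doubles the exponent: both
gains in a sum must be small. -/
lemma mul_prod_le_of_sum (ha₁ : 0 < a₁) (ha₂ : 0 < a₂) (hb₁ : 0 < b₁) (hb₂ : 0 < b₂)
    (hg : 0 < g) (hT0 : 0 ≤ T)
    (hT : T * ((a₁ + a₂) * (b₁ + b₂)) ≤ 2 * ((1 + b₁) * (1 + b₂))) :
    T ^ 2 * (a₁ * a₂ * b₁ * b₂ * g)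
      ≤ 4 * ((1 + a₁) * (1 + a₂) * (1 + b₁) * (1 + b₂) * (1 + g)) ^ 4 := by
  rw [show a₁ * a₂ * b₁ * b₂ * g = ((a₁ * a₂) * (b₁ * b₂)) * (1 * 1 * 1 * 1 * g) by ring]
  refine mul_prod_le_of_mul_le ha₁ ha₂ hb₁ hb₂ hg (by norm_num) (by positivity) ?_
    (mul_le_mul_of_five (by positivity) (by positivity) (by positivity) (by positivity)
      (by positivity) (by linarith) (by linarith) (by linarith) (by linarith) (by linarith))
  have h1 : a₁ * a₂ ≤ (a₁ + a₂) ^ 2 := by nlinarith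
  have h2 : b₁ * b₂ ≤ (b₁ + b₂) ^ 2 := by nlinarith
  calc T ^ 2 * ((a₁ * a₂) * (b₁ * b₂)) ≤ T ^ 2 * ((a₁ + a₂) ^ 2 * (b₁ + b₂) ^ 2) := by gcongr
    _ = (T * ((a₁ + a₂) * (b₁ + b₂))) ^ 2 := by ring
    _ ≤ (2 * ((1 + b₁) * (1 + b₂))) ^ 2 := by gcongr
    _ = _ := by ring

/-- With A = a₁ + a₂, B = b₁ + b₂, E = A + g, the square of a₁a₂b₁b₂g is at most A³ (A g²) B³ · B ≤
(A B E)³ B, so the squared claim follows from the cube of the hypothesis. The exponent 3 matches the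
regime where a₁, a₂, g are of order 1/T and b₁, b₂ of order 1. -/
lemma mul_prod_le_of_sum_relay (ha₁ : 0 < a₁) (ha₂ : 0 < a₂) (hb₁ : 0 < b₁) (hb₂ : 0 < b₂)
    (hg : 0 < g)
    (hT : T ^ 2 * ((a₁ + a₂) * (b₁ + b₂) * (a₁ + a₂ + g)) ≤ 2 * ((1 + b₁) * (1 + b₂))) :
    T ^ 3 * (a₁ * a₂ * b₁ * b₂ * g)
      ≤ 4 * ((1 + a₁) * (1 + a₂) * (1 + b₁) * (1 + b₂) * (1 + g)) ^ 4 := by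
  rw [show a₁ * a₂ * b₁ * b₂ * g = (a₁ * a₂ * b₁ * b₂ * g) * 1 by ring]
  refine mul_prod_le_of_mul_le ha₁ ha₂ hb₁ hb₂ hg (by norm_num) (by positivity) ?_ ?_
  · have h1 : a₁ * a₂ ≤ (a₁ + a₂) ^ 2 := by nlinarith
    have h2 : b₁ * b₂ ≤ (b₁ + b₂) ^ 2 := by nlinarith
    have h3 : (a₁ + a₂) * g ^ 2 ≤ (a₁ + a₂ + g) ^ 3 := by
      calc (a₁ + a₂) * g ^ 2 ≤ (a₁ + a₂ + g) * (a₁ + a₂ + g) ^ 2 :=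
            mul_le_mul (by linarith) (pow_le_pow_left₀ hg.le (by linarith) 2) (by positivity)
              (by positivity)
        _ = _ := by ring
    have h4 : b₁ + b₂ ≤ (1 + b₁) * (1 + b₂) := by nlinarith [mul_pos hb₁ hb₂]
    have hN : 0 < (1 + b₁) * (1 + b₂) := by positivity
    have hA : 0 < a₁ + a₂ := by positivity
    have hB : 0 < b₁ + b₂ := by positivity
    have hE : 0 < a₁ + a₂ + g := by positivity
    generalize (1 + b₁) * (1 + b₂) = N at *
    generalize a₁ + a₂ + g = E at *
    generalize a₁ + a₂ = A at *
    generalize b₁ + b₂ = B at *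
    refine le_of_sq_le_sq ?_ (by positivity)
    calc (T ^ 3 * (a₁ * a₂ * b₁ * b₂ * g)) ^ 2
        = T ^ 6 * ((a₁ * a₂) ^ 2 * g ^ 2 * (b₁ * b₂) ^ 2) := by ring
      _ ≤ T ^ 6 * ((A ^ 2) ^ 2 * g ^ 2 * (B ^ 2) ^ 2) := by gcongr
      _ = T ^ 6 * (A ^ 3 * (A * g ^ 2) * B ^ 3) * B := by ring
      _ ≤ T ^ 6 * (A ^ 3 * E ^ 3 * B ^ 3) * N := by gcongr
      _ = (T ^ 2 * (A * B * E)) ^ 3 * N := by ring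
      _ ≤ (2 * N) ^ 3 * N := by gcongr
      _ ≤ (4 * N ^ 2) ^ 2 := by nlinarith [pow_pos hN 4]
  · have := mul_le_mul_of_five (x₁ := 1) (x₂ := 1) (x₃ := 1) (x₄ := 1) (x₅ := 1)
      (y₁ := 1 + a₁) (y₂ := 1 + a₂) (y₃ := 1 + b₁) (y₄ := 1 + b₂) (y₅ := 1 + g)
      (by positivity) (by positivity) (by positivity) (by positivity) (by positivity)
      (by linarith) (by linarith) (by linarith) (by linarith) (by linarith)
    simpa using this

end Algebra

/-! ### From the outage conditions to the weight. -/

lemma mul_lt_rpow_of_log_add_lt {x y S ρ : ℝ} (hx : 0 < x) (hy : 0 < y) (hS : 0 < S)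
    (h : Real.log x + Real.log y < ρ * Real.log S) : x * y < S ^ ρ := by
  rw [← Real.log_mul hx.ne' hy.ne'] at h
  exact (Real.lt_rpow_iff_log_lt (by positivity) hS).2 h

/-- The step shared by all six conditions: n counts the factors S that accompany the gains in m, ρ
is the exponent of the rates, and D is one plus the quantization noise. -/
lemma le_of_mul_log_lt {x y S n ρ κ : ℝ} {m N D : ℝ} (hx : 0 < x) (hy : 0 < y) (hS : 0 < S)
    (hD : 0 < D) (hDN : D ≤ 2 * N) (h : Real.log x + Real.log y < ρ * Real.log S)
    (hm : S ^ n * m / D ≤ x * y) (hκ : κ = n - ρ) : S ^ κ * m ≤ 2 * N := by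
  have h1 := hm.trans_lt (mul_lt_rpow_of_log_add_lt hx hy hS h)
  rw [div_lt_iff₀ hD] at h1
  have h2 : 0 < S ^ ρ := by positivity
  rw [hκ, Real.rpow_sub hS, div_mul_eq_mul_div, div_le_iff₀ h2]
  nlinarith

lemma weight_eq (h : Link → ℂ) :
    weight h = ((1 + ‖h .s1D‖ ^ 2) * (1 + ‖h .s2D‖ ^ 2) * (1 + ‖h .s1R‖ ^ 2) * (1 + ‖h .s2R‖ ^ 2)
        * (1 + ‖h .rD‖ ^ 2)) ^ 4
      / (‖h .s1D‖ ^ 2 * ‖h .s2D‖ ^ 2 * ‖h .s1R‖ ^ 2 * ‖h .s2R‖ ^ 2 * ‖h .rD‖ ^ 2) := by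
  rw [weight, Finset.prod_div_distrib, Finset.prod_pow, prod_link, prod_link]

lemma dmt_le_two_sub {r : ℝ} : dmt r ≤ 2 - r := by
  unfold dmt; split_ifs <;> linarith

lemma dmt_le_three_mul {r : ℝ} : dmt r ≤ 3 * (1 - r) := by
  unfold dmt; split_ifs <;> linarith

lemma dmt_le_four_mul {r : ℝ} (hr1 : r ≤ 1) : dmt r ≤ 4 * (1 - r) :=
  dmt_le_three_mul.trans (by linarith)

/-- For these parameters exp(R_U/β) = S, so the quantization noise is (1 + b₁S + b₂S)/(S - 1): it
does not grow with S and costs no exponent. -/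
lemma one_add_quantVar_le {S : ℝ} (hS : 2 ≤ S) (a b : ℂ) :
    1 + (quantVar S (1 / 2) (1 / 2 * Real.log S) a b : ℝ) ≤ 2 * ((1 + ‖a‖ ^ 2) * (1 + ‖b‖ ^ 2)) := by
  have hlog : 0 < Real.log S := Real.log_pos (by linarith)
  rw [coe_quantVar (by linarith) (by norm_num) (by positivity),
    mul_div_cancel_left₀ _ (by norm_num : (1 / 2 : ℝ) ≠ 0), Real.exp_log (by linarith)]
  have h1 : (1 + ‖a‖ ^ 2 * S + ‖b‖ ^ 2 * S) / (S - 1) ≤ 1 + 2 * ‖a‖ ^ 2 + 2 * ‖b‖ ^ 2 := by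
    rw [div_le_iff₀ (by linarith)]
    nlinarith [sq_nonneg ‖a‖, sq_nonneg ‖b‖]
  nlinarith [mul_nonneg (sq_nonneg ‖a‖) (sq_nonneg ‖b‖)]

/-- In an outage of the scheme with `β = rU = 1 / 2` the weight is at least of order
`snr ^ dmt r`. -/
lemma rpow_dmt_le_weight {r S : ℝ} (hr1 : r ≤ 1) (hS : 2 ≤ S) {h : Link → ℂ} (hh : ∀ i, h i ≠ 0)
    (hout : h ∈ gqfOutage S (1 / 2) (r / 2 * Real.log S) (r / 2 * Real.log S)
      (1 / 2 * Real.log S)) :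
    S ^ dmt r ≤ 4 * weight h := by
  have h0 : 0 < S := by linarith
  have h1 : 1 ≤ S := by linarith
  lift S to ℝ≥0 using h0.le
  have hpos : ∀ i, 0 < ‖h i‖ ^ 2 := fun i => by have := norm_pos_iff.2 (hh i); positivity
  have hD := one_add_quantVar_le hS (h .s1R) (h .s2R)
  suffices hT : ∃ T, (S : ℝ) ^ dmt r ≤ T ∧
      T * (‖h .s1D‖ ^ 2 * ‖h .s2D‖ ^ 2 * ‖h .s1R‖ ^ 2 * ‖h .s2R‖ ^ 2 * ‖h .rD‖ ^ 2)
      ≤ 4 * ((1 + ‖h .s1D‖ ^ 2) * (1 + ‖h .s2D‖ ^ 2) * (1 + ‖h .s1R‖ ^ 2) * (1 + ‖h .s2R‖ ^ 2)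
        * (1 + ‖h .rD‖ ^ 2)) ^ 4 by
    obtain ⟨T, hdT, hT⟩ := hT
    refine hdT.trans ?_
    have := hpos .s1D; have := hpos .s2D; have := hpos .s1R; have := hpos .s2R; have := hpos .rD
    rw [weight_eq, ← mul_div_assoc, le_div_iff₀ (by positivity)]
    exact hT
  have hβ0 : (0 : ℝ) ≤ 1 / 2 := by norm_num
  have hβ1 : (1 / 2 : ℝ) ≤ 1 := by norm_num
  have i1 := le_info1 (p := S) (RU := 1 / 2 * Real.log S) (h := h) hβ0 hβ1
  have i2 := le_info2 (p := S) (RU := 1 / 2 * Real.log S) (h := h) hβ0 hβ1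
  have i12 := le_info12 (p := S) (RU := 1 / 2 * Real.log S) (h := h) hβ0 hβ1
  have i1u := info1u_eq (p := S) (RU := 1 / 2 * Real.log S) (h := h) hβ0 hβ1
  have i2u := info2u_eq (p := S) (RU := 1 / 2 * Real.log S) (h := h) hβ0 hβ1
  have i12u := info12u_eq (p := S) (RU := 1 / 2 * Real.log S) (h := h) hβ0 hβ1
  unfold gqfOutage at hout
  simp only [Set.mem_union, Set.mem_ofPred_eq] at hout
  set D := quantVar S (1 / 2) (1 / 2 * Real.log S) (h .s1R) (h .s2R)
  have hD0 : (0 : ℝ) < 1 + D := by positivity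
  obtain ⟨a₁, ha₁⟩ : ∃ x, x = ‖h .s1D‖ ^ 2 := ⟨_, rfl⟩
  obtain ⟨a₂, ha₂⟩ : ∃ x, x = ‖h .s2D‖ ^ 2 := ⟨_, rfl⟩
  obtain ⟨b₁, hb₁⟩ : ∃ x, x = ‖h .s1R‖ ^ 2 := ⟨_, rfl⟩
  obtain ⟨b₂, hb₂⟩ : ∃ x, x = ‖h .s2R‖ ^ 2 := ⟨_, rfl⟩
  obtain ⟨g, hg⟩ : ∃ x, x = ‖h .rD‖ ^ 2 := ⟨_, rfl⟩
  have pa₁ := hpos .s1D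
  have pa₂ := hpos .s2D
  have pb₁ := hpos .s1R
  have pb₂ := hpos .s2R
  have pg := hpos .rD
  simp only [← ha₁, ← ha₂, ← hb₁, ← hb₂, ← hg] at hD i1 i2 i12 i1u i2u i12u pa₁ pa₂ pb₁ pb₂ pg ⊢
  clear hpos ha₁ ha₂ hb₁ hb₂ hg hh
  -- The conditions for source 2 are those for source 1 with the indices exchanged; these identities
  -- undo the exchange.
  have hswap : a₂ * a₁ * b₂ * b₁ * g = a₁ * a₂ * b₁ * b₂ * g := by ring
  have hswap' : (1 + a₂) * (1 + a₁) * (1 + b₂) * (1 + b₁) * (1 + g)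
      = (1 + a₁) * (1 + a₂) * (1 + b₁) * (1 + b₂) * (1 + g) := by ring
  -- Doubling removes the factors 1/2: each condition becomes log x + log y < ρ log S with y a relay
  -- ratio and ρ equal to r, r + 1, 2r or 2r + 1. Where a maximum occurs, its relay branch is used.
  rcases hout with ((((ho | ho) | ho) | ho) | ho) | ho
  · have hl := (ENNReal.ofReal_lt_ofReal_iff'.1 (i1.trans_lt ho)).1
    have hm := le_max_right (Real.log (1 + a₁ * S)) (Real.log ((1 + D + b₁ * S) / (1 + D)))
    refine ⟨S ^ (2 - r), Real.rpow_le_rpow_of_exponent_le h1 dmt_le_two_sub,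
      mul_prod_le_of_single pa₁ pa₂ pb₁ pb₂ pg ?_⟩
    refine le_of_mul_log_lt (x := 1 + a₁ * S) (y := (1 + D + b₁ * S) / (1 + D)) (n := 2) (ρ := r)
      (by positivity) (by positivity) h0 hD0 hD (by linarith) ?_ (by ring)
    calc (S : ℝ) ^ (2 : ℝ) * (a₁ * b₁) / (1 + D) = (a₁ * S) * (b₁ * S / (1 + D)) := by
          rw [Real.rpow_two]; ring
      _ ≤ _ := by gcongr <;> linarith
  · rw [i1u] at ho
    have hl := (ENNReal.ofReal_lt_ofReal_iff'.1 ho).1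
    refine ⟨S ^ (2 - r), Real.rpow_le_rpow_of_exponent_le h1 dmt_le_two_sub,
      mul_prod_le_of_single_relay pa₁ pa₂ pb₁ pb₂ pg (by positivity) ?_⟩
    refine le_of_mul_log_lt (x := (1 + a₁ * S) * (1 + a₁ * S + g * S))
      (y := (1 + D + b₁ * S + b₂ * S) / (1 + D)) (n := 3) (ρ := r + 1)
      (by positivity) (by positivity) h0 hD0 hD
      (by rw [Real.log_mul (by positivity) (by positivity)]; linarith) ?_ (by ring)
    calc (S : ℝ) ^ (3 : ℝ) * (a₁ * (b₁ + b₂) * g) / (1 + D)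
        = (a₁ * S) * (g * S) * ((b₁ * S + b₂ * S) / (1 + D)) := by
          rw [show (3 : ℝ) = (3 : ℕ) by norm_num, Real.rpow_natCast]; ring
      _ ≤ _ := by
          gcongr
          · linarith
          · exact le_add_of_nonneg_left (by positivity)
          · linarith
  · have hl := (ENNReal.ofReal_lt_ofReal_iff'.1 (i2.trans_lt ho)).1
    have hm := le_max_right (Real.log (1 + a₂ * S)) (Real.log ((1 + D + b₂ * S) / (1 + D)))
    refine ⟨S ^ (2 - r), Real.rpow_le_rpow_of_exponent_le h1 dmt_le_two_sub, ?_⟩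
    have := mul_prod_le_of_single (T := (S : ℝ) ^ (2 - r)) pa₂ pa₁ pb₂ pb₁ pg ?_
    · rwa [hswap, hswap'] at this
    rw [mul_comm (1 + b₁)] at hD
    refine le_of_mul_log_lt (x := 1 + a₂ * S) (y := (1 + D + b₂ * S) / (1 + D)) (n := 2) (ρ := r)
      (by positivity) (by positivity) h0 hD0 hD (by linarith) ?_ (by ring)
    calc (S : ℝ) ^ (2 : ℝ) * (a₂ * b₂) / (1 + D) = (a₂ * S) * (b₂ * S / (1 + D)) := by
          rw [Real.rpow_two]; ring
      _ ≤ _ := by gcongr <;> linarith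
  · rw [i2u] at ho
    have hl := (ENNReal.ofReal_lt_ofReal_iff'.1 ho).1
    refine ⟨S ^ (2 - r), Real.rpow_le_rpow_of_exponent_le h1 dmt_le_two_sub, ?_⟩
    have := mul_prod_le_of_single_relay (T := (S : ℝ) ^ (2 - r)) pa₂ pa₁ pb₂ pb₁ pg
      (by positivity) ?_
    · rwa [hswap, hswap'] at this
    rw [mul_comm (1 + b₁)] at hD
    refine le_of_mul_log_lt (x := (1 + a₂ * S) * (1 + a₂ * S + g * S))
      (y := (1 + D + b₁ * S + b₂ * S) / (1 + D)) (n := 3) (ρ := r + 1)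
      (by positivity) (by positivity) h0 hD0 hD
      (by rw [Real.log_mul (by positivity) (by positivity)]; linarith) ?_ (by ring)
    calc (S : ℝ) ^ (3 : ℝ) * (a₂ * (b₂ + b₁) * g) / (1 + D)
        = (a₂ * S) * (g * S) * ((b₁ * S + b₂ * S) / (1 + D)) := by
          rw [show (3 : ℝ) = (3 : ℕ) by norm_num, Real.rpow_natCast]; ring
      _ ≤ _ := by
          gcongr
          · linarith
          · exact le_add_of_nonneg_left (by positivity)
          · linarith
  · have hl := (ENNReal.ofReal_lt_ofReal_iff'.1 (i12.trans_lt ho)).1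
    have hm := le_max_right (Real.log (1 + a₁ * S + a₂ * S))
      (Real.log ((1 + D + b₁ * S + b₂ * S) / (1 + D)))
    -- The exponent 4(1 - r) exceeds what is needed, because r ≤ 1.
    refine ⟨(S ^ (2 - 2 * r)) ^ 2, ?_,
      mul_prod_le_of_sum pa₁ pa₂ pb₁ pb₂ pg (by positivity) ?_⟩
    · rw [← Real.rpow_natCast, ← Real.rpow_mul h0.le]
      refine Real.rpow_le_rpow_of_exponent_le h1 ((dmt_le_four_mul hr1).trans ?_)
      push_cast; linarith
    refine le_of_mul_log_lt (x := 1 + a₁ * S + a₂ * S) (y := (1 + D + b₁ * S + b₂ * S) / (1 + D))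
      (n := 2) (ρ := 2 * r) (by positivity) (by positivity) h0 hD0 hD (by linarith) ?_ (by ring)
    calc (S : ℝ) ^ (2 : ℝ) * ((a₁ + a₂) * (b₁ + b₂)) / (1 + D)
        = (a₁ * S + a₂ * S) * ((b₁ * S + b₂ * S) / (1 + D)) := by
          rw [Real.rpow_two]; ring
      _ ≤ _ := by gcongr <;> linarith
  · rw [i12u] at ho
    have hl := (ENNReal.ofReal_lt_ofReal_iff'.1 ho).1
    refine ⟨(S ^ (1 - r)) ^ 3, ?_,
      mul_prod_le_of_sum_relay pa₁ pa₂ pb₁ pb₂ pg ?_⟩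
    · rw [← Real.rpow_natCast, ← Real.rpow_mul h0.le]
      refine Real.rpow_le_rpow_of_exponent_le h1 (dmt_le_three_mul.trans ?_)
      push_cast; linarith
    rw [← Real.rpow_natCast, ← Real.rpow_mul h0.le]
    refine le_of_mul_log_lt (x := (1 + a₁ * S + a₂ * S) * (1 + a₁ * S + a₂ * S + g * S))
      (y := (1 + D + b₁ * S + b₂ * S) / (1 + D)) (n := 3) (ρ := 2 * r + 1)
      (by positivity) (by positivity) h0 hD0 hD
      (by rw [Real.log_mul (by positivity) (by positivity)]; linarith) ?_ (by push_cast; ring)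
    calc (S : ℝ) ^ (3 : ℝ) * ((a₁ + a₂) * (b₁ + b₂) * (a₁ + a₂ + g)) / (1 + D)
        = (a₁ * S + a₂ * S) * (a₁ * S + a₂ * S + g * S) * ((b₁ * S + b₂ * S) / (1 + D)) := by
          rw [show (3 : ℝ) = (3 : ℕ) by norm_num, Real.rpow_natCast]; ring
      _ ≤ _ := by gcongr <;> linarith

theorem dotEq_gqfOutageProb {v : Link → ℝ≥0} (hv : ∀ i, 0 < v i) {r : ℝ} (hr : 0 ≤ r)
    (hr1 : r ≤ 1) : DotEq (gqfOutageProb v (1 / 2) (1 / 2) r) (-dmt r) := by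
  refine dotEq_of_bounds ?_ fun ε hε => ?_
  · rcases hr.eq_or_lt with rfl | hr
    · have : dmt 0 = 2 := by norm_num [dmt]
      rw [this]
      exact diversityAtMost_gqfOutageProb_zero hv
    · exact diversityAtMost_gqfOutageProb hv hr hr1 (by norm_num) (by norm_num) (by norm_num)
  · refine eventually_fadingLaw_le hv (C := 4) (by norm_num) ?_ hε
    filter_upwards [Filter.eventually_ge_atTop 2] with S hS h hh h0
    exact rpow_dmt_le_weight hr1 hS h0 hh

/-! ### Shifted Gaussian noise is dominated by stronger Gaussian noise -/

/-- With u = y - x, the bound ‖y‖² ≤ 2‖u‖² + 2‖x‖² makes the right exponent at least -2‖u‖²/σ ≥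
-‖u‖²/4, while the left one is -3‖u‖²/4. The extra factor exp(‖u‖²/4) is kept to absorb noise
correlation in `lintegral_shear_whiteNoise_le`. -/
lemma complexGaussianPDF_one_sub_le {σ : ℝ≥0} (hσ : 8 ≤ σ) (x y : ℂ) :
    complexGaussianPDF 1 (y - x) * Real.exp (‖y - x‖ ^ 2 / 4)
      ≤ σ * Real.exp (2 * ‖x‖ ^ 2 / σ) * complexGaussianPDF σ y := by
  have hσ' : (8 : ℝ) ≤ σ := by exact_mod_cast hσ
  have h0 : (0 : ℝ) < σ := by linarith
  unfold complexGaussianPDF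
  have e1 : (Real.pi * ((1 : ℝ≥0) : ℝ))⁻¹ * Real.exp (-‖y - x‖ ^ 2 / ((1 : ℝ≥0) : ℝ))
      * Real.exp (‖y - x‖ ^ 2 / 4) = Real.pi⁻¹ * Real.exp (-(3 / 4) * ‖y - x‖ ^ 2) := by
    rw [mul_assoc, ← Real.exp_add]
    norm_num
    ring
  have e2 : σ * Real.exp (2 * ‖x‖ ^ 2 / σ) * ((Real.pi * σ)⁻¹ * Real.exp (-‖y‖ ^ 2 / σ))
      = Real.pi⁻¹ * Real.exp ((2 * ‖x‖ ^ 2 - ‖y‖ ^ 2) / σ) := by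
    rw [mul_mul_mul_comm, ← Real.exp_add]
    congr 1
    · field_simp
    · congr 1; ring
  rw [e1, e2]
  gcongr
  rw [le_div_iff₀ h0]
  have h1 : ‖y‖ ≤ ‖y - x‖ + ‖x‖ := by simpa using norm_add_le (y - x) x
  have h2 : ‖y‖ ^ 2 ≤ 2 * ‖y - x‖ ^ 2 + 2 * ‖x‖ ^ 2 := by
    calc ‖y‖ ^ 2 ≤ (‖y - x‖ + ‖x‖) ^ 2 := by gcongr
      _ ≤ _ := by nlinarith [sq_nonneg (‖y - x‖ - ‖x‖)]
  nlinarith [sq_nonneg ‖y - x‖]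

lemma lintegral_shift_complexGaussian_le {σ : ℝ≥0} (hσ : 8 ≤ σ) (x : ℂ) {f : ℂ → ℝ≥0∞}
    (hf : Measurable f) :
    ∫⁻ z, ENNReal.ofReal (Real.exp (‖z‖ ^ 2 / 4)) * f (x + z) ∂complexGaussian 1
      ≤ ENNReal.ofReal (σ * Real.exp (2 * ‖x‖ ^ 2 / σ)) * ∫⁻ y, f y ∂complexGaussian σ := by
  have h0 : 0 < σ := lt_of_lt_of_le (by norm_num) hσ
  have hp := measurable_complexGaussianPDF σ
  have e := lintegral_add_complexGaussian (t := 1) one_pos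
    (f := fun y => ENNReal.ofReal (Real.exp (‖y - x‖ ^ 2 / 4)) * f y) (by fun_prop) x
  simp only [add_sub_cancel_left] at e
  rw [e, lintegral_complexGaussian h0 hf, ← lintegral_const_mul _ (by fun_prop)]
  refine lintegral_mono fun y => ?_
  rw [← mul_assoc, ← mul_assoc, ← ENNReal.ofReal_mul (complexGaussianPDF_pos one_pos _).le,
    ← ENNReal.ofReal_mul (by positivity)]
  exact mul_le_mul' (ENNReal.ofReal_le_ofReal (complexGaussianPDF_one_sub_le hσ x y)) le_rfl

lemma piFinSuccAbove_symm_eq_cons {k : ℕ} (p : ℂ × (Fin k → ℂ)) :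
    (MeasurableEquiv.piFinSuccAbove (fun _ : Fin (k + 1) => ℂ) 0).symm p = Fin.cons p.1 p.2 := by
  funext i
  refine Fin.cases ?_ (fun j => ?_) i <;> simp [MeasurableEquiv.piFinSuccAbove]

lemma lintegral_pi_fin_succ {k : ℕ} (μ : Measure ℂ) [SigmaFinite μ] {f : (Fin (k + 1) → ℂ) → ℝ≥0∞}
    (hf : Measurable f) :
    ∫⁻ z, f z ∂Measure.pi (fun _ : Fin (k + 1) => μ)
      = ∫⁻ a, ∫⁻ z, f (Fin.cons a z) ∂Measure.pi (fun _ : Fin k => μ) ∂μ := by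
  have h := (measurePreserving_piFinSuccAbove (fun _ : Fin (k + 1) => μ) 0).symm
  rw [← h.lintegral_comp hf, lintegral_prod]
  · simp_rw [piFinSuccAbove_symm_eq_cons]
  · exact (hf.comp (MeasurableEquiv.measurable _)).aemeasurable

/-- A one-dimensional domination tensorizes: freeze the first coordinate, apply induction to the
rest, then the hypothesis to the first. -/
lemma lintegral_pi_shift_le {μ ν : Measure ℂ} [SigmaFinite μ] [SigmaFinite ν] {φ : ℂ → ℝ≥0∞}
    (hφ : Measurable φ) {C : ℂ → ℝ≥0∞}
    (H : ∀ (x : ℂ) (g : ℂ → ℝ≥0∞), Measurable g →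
      ∫⁻ z, φ z * g (x + z) ∂μ ≤ C x * ∫⁻ y, g y ∂ν) :
    ∀ (k : ℕ) (x : Fin k → ℂ) (f : (Fin k → ℂ) → ℝ≥0∞), Measurable f →
      ∫⁻ z, (∏ i, φ (z i)) * f (x + z) ∂Measure.pi (fun _ : Fin k => μ)
        ≤ (∏ i, C (x i)) * ∫⁻ y, f y ∂Measure.pi (fun _ : Fin k => ν) := by
  intro k
  induction k with
  | zero =>
    intro x f hf
    simp only [Finset.univ_eq_empty, Finset.prod_empty, one_mul, Measure.pi_of_empty _ (0 : Fin 0 → ℂ)]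
    rw [lintegral_dirac, lintegral_dirac, Subsingleton.elim (x + 0) 0]
  | succ k ih =>
    intro x f hf
    have hcons : Measurable fun p : ℂ × (Fin k → ℂ) => (Fin.cons p.1 p.2 : Fin (k + 1) → ℂ) := by
      simp_rw [← piFinSuccAbove_symm_eq_cons]
      exact MeasurableEquiv.measurable _
    have hc : ∀ a, Measurable fun z : Fin k → ℂ => (Fin.cons a z : Fin (k + 1) → ℂ) := fun a =>
      hcons.comp measurable_prodMk_left
    rw [lintegral_pi_fin_succ μ (by fun_prop), lintegral_pi_fin_succ ν hf]
    have hx : ∀ (a : ℂ) (z : Fin k → ℂ), x + (Fin.cons a z : Fin (k + 1) → ℂ)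
        = Fin.cons (x 0 + a) (Fin.tail x + z) := by
      intro a z
      funext i
      refine Fin.cases ?_ (fun j => ?_) i <;> simp [Fin.tail]
    simp_rw [hx, Fin.prod_univ_succ, Fin.cons_zero, Fin.cons_succ]
    set G : ℂ → ℝ≥0∞ := fun a => ∫⁻ y, f (Fin.cons a y) ∂Measure.pi (fun _ : Fin k => ν) with hG
    have hGm : Measurable G :=
      Measurable.lintegral_prod_right' (f := fun p : ℂ × (Fin k → ℂ) => f (Fin.cons p.1 p.2))
        (hf.comp hcons)
    calc ∫⁻ a, ∫⁻ z, φ a * (∏ i, φ (z i)) * f (Fin.cons (x 0 + a) (Fin.tail x + z))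
            ∂Measure.pi (fun _ : Fin k => μ) ∂μ
        ≤ ∫⁻ a, (∏ i, C (Fin.tail x i)) * (φ a * G (x 0 + a)) ∂μ := by
          refine lintegral_mono fun a => ?_
          have hfa : Measurable fun y : Fin k → ℂ => f (Fin.cons (x 0 + a) y) := hf.comp (hc _)
          simp_rw [mul_assoc]
          rw [lintegral_const_mul _ (by fun_prop), mul_left_comm]
          gcongr
          exact ih (Fin.tail x) (fun y => f (Fin.cons (x 0 + a) y)) hfa
      _ = (∏ i, C (Fin.tail x i)) * ∫⁻ a, φ a * G (x 0 + a) ∂μ :=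
          lintegral_const_mul _ (by fun_prop)
      _ ≤ (∏ i, C (Fin.tail x i)) * (C (x 0) * ∫⁻ a, G a ∂ν) := by
          gcongr
          exact H (x 0) G hGm
      _ = _ := by
          rw [← mul_assoc, mul_comm (∏ i, C (Fin.tail x i))]
          rfl

/-- White complex Gaussian noise of variance `σ`. -/
def whiteNoise (k : ℕ) (σ : ℝ≥0) : Measure (Fin k → ℂ) := Measure.pi fun _ => complexGaussian σ

instance (k : ℕ) (σ : ℝ≥0) : IsProbabilityMeasure (whiteNoise k σ) := by
  unfold whiteNoise; infer_instance

lemma lintegral_exp_mul_shift_whiteNoise_le {σ : ℝ≥0} (hσ : 8 ≤ σ) {k : ℕ} (x : Fin k → ℂ)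
    {f : (Fin k → ℂ) → ℝ≥0∞} (hf : Measurable f) :
    ∫⁻ z, ENNReal.ofReal (Real.exp ((∑ i, ‖z i‖ ^ 2) / 4)) * f (x + z) ∂whiteNoise k 1
      ≤ ENNReal.ofReal (σ ^ k * Real.exp (2 * (∑ i, ‖x i‖ ^ 2) / σ))
        * ∫⁻ y, f y ∂whiteNoise k σ := by
  have h := lintegral_pi_shift_le (μ := complexGaussian 1) (ν := complexGaussian σ)
    (φ := fun z => ENNReal.ofReal (Real.exp (‖z‖ ^ 2 / 4)))
    (C := fun x => ENNReal.ofReal (σ * Real.exp (2 * ‖x‖ ^ 2 / σ))) (by fun_prop)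
    (fun x g hg => lintegral_shift_complexGaussian_le hσ x hg) k x f hf
  simp_rw [← ENNReal.ofReal_prod_of_nonneg fun i (_ : i ∈ Finset.univ) =>
    (Real.exp_pos _).le, ← Real.exp_sum, ← Finset.sum_div] at h
  rw [← ENNReal.ofReal_prod_of_nonneg fun i (_ : i ∈ Finset.univ) => by positivity,
    Finset.prod_mul_distrib, ← Real.exp_sum, ← Finset.sum_div, ← Finset.mul_sum, Finset.prod_const,
    Finset.card_univ, Fintype.card_fin] at h
  exact h

lemma lintegral_shift_whiteNoise_le {σ : ℝ≥0} (hσ : 8 ≤ σ) {k : ℕ} (x : Fin k → ℂ)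
    {f : (Fin k → ℂ) → ℝ≥0∞} (hf : Measurable f) :
    ∫⁻ z, f (x + z) ∂whiteNoise k 1
      ≤ ENNReal.ofReal (σ ^ k * Real.exp (2 * (∑ i, ‖x i‖ ^ 2) / σ))
        * ∫⁻ y, f y ∂whiteNoise k σ := by
  refine (lintegral_mono fun z => ?_).trans (lintegral_exp_mul_shift_whiteNoise_le hσ x hf)
  refine le_mul_of_one_le_left zero_le ?_
  rw [ENNReal.one_le_ofReal]
  exact Real.one_le_exp (by positivity)

lemma pow_mul_exp_le {σ E A : ℝ} {k : ℕ} (hσ : 0 < σ) (hEσ : E ≤ σ) (hA : A ≤ k * E) :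
    σ ^ k * Real.exp (2 * A / σ) ≤ (Real.exp 2 * σ) ^ k := by
  rw [mul_pow, mul_comm (Real.exp 2 ^ k), ← Real.exp_nat_mul]
  gcongr
  rw [div_le_iff₀ hσ]
  have : (k : ℝ) * E ≤ k * σ := by gcongr
  nlinarith

lemma lintegral_shift_whiteNoise_le_pow {σ : ℝ≥0} (hσ : 8 ≤ σ) {k : ℕ} {x : Fin k → ℂ} {E : ℝ}
    (hE : E ≤ σ) (hx : ∑ i, ‖x i‖ ^ 2 ≤ k * E) {f : (Fin k → ℂ) → ℝ≥0∞} (hf : Measurable f) :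
    ∫⁻ z, f (x + z) ∂whiteNoise k 1
      ≤ ENNReal.ofReal ((Real.exp 2 * σ) ^ k) * ∫⁻ y, f y ∂whiteNoise k σ := by
  have h0 : (0 : ℝ) < σ := lt_of_lt_of_le (by norm_num) (NNReal.coe_le_coe.2 hσ)
  refine (lintegral_shift_whiteNoise_le hσ x hf).trans ?_
  gcongr
  exact pow_mul_exp_le h0 hE hx

/-- Two observations `x + z` and `z' - c • z`, of which only the first carries the signal `x`. -/
lemma lintegral_shear_whiteNoise_le {σ : ℝ≥0} (hσ : 8 ≤ σ) {k : ℕ} {x : Fin k → ℂ} {E : ℝ}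
    (hE : E ≤ σ) (hx : ∑ i, ‖x i‖ ^ 2 ≤ k * E) {c : ℂ} (hc : ‖c‖ ^ 2 ≤ 2)
    {f : (Fin k → ℂ) × (Fin k → ℂ) → ℝ≥0∞} (hf : Measurable f) :
    ∫⁻ z, ∫⁻ z', f (x + z, -(c • z) + z') ∂whiteNoise k 1 ∂whiteNoise k 1
      ≤ ENNReal.ofReal ((16 * (Real.exp 2 * σ)) ^ k)
        * ∫⁻ y, ∫⁻ y', f (y, y') ∂whiteNoise k 16 ∂whiteNoise k σ := by
  have h0 : (0 : ℝ) < σ := lt_of_lt_of_le (by norm_num) (NNReal.coe_le_coe.2 hσ)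
  set G : (Fin k → ℂ) → ℝ≥0∞ := fun y => ∫⁻ y', f (y, y') ∂whiteNoise k 16 with hG
  have hGm : Measurable G := hf.lintegral_prod_right'
  calc _ ≤ ∫⁻ z, ENNReal.ofReal (16 ^ k)
          * (ENNReal.ofReal (Real.exp ((∑ i, ‖z i‖ ^ 2) / 4)) * G (x + z)) ∂whiteNoise k 1 := by
        -- For fixed z the second observation is unit noise shifted by -c z. Domination by variance
        -- 16 costs 16^k exp(‖c‖²‖z‖²/8), at most 16^k exp(‖z‖²/4) as ‖c‖² ≤ 2; this is the weight
        -- allowed on the first noise.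
        refine lintegral_mono fun z => ?_
        refine (lintegral_shift_whiteNoise_le (σ := 16) (by norm_num) (-(c • z))
          (f := fun y' => f (x + z, y')) (by fun_prop)).trans ?_
        rw [← mul_assoc, ← ENNReal.ofReal_mul (by positivity)]
        simp only [Pi.neg_apply, Pi.smul_apply, norm_neg, smul_eq_mul, norm_mul, mul_pow]
        rw [← Finset.mul_sum]
        have hz : 0 ≤ ∑ i, ‖z i‖ ^ 2 := by positivity
        have h16 : 2 * (‖c‖ ^ 2 * ∑ i, ‖z i‖ ^ 2) / ((16 : ℝ≥0) : ℝ) ≤ (∑ i, ‖z i‖ ^ 2) / 4 := by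
          norm_num
          nlinarith
        refine mul_le_mul' (ENNReal.ofReal_le_ofReal ?_) le_rfl
        exact mul_le_mul_of_nonneg_left (Real.exp_le_exp.2 h16) (by positivity)
    _ = ENNReal.ofReal (16 ^ k) * ∫⁻ z, ENNReal.ofReal (Real.exp ((∑ i, ‖z i‖ ^ 2) / 4)) * G (x + z)
          ∂whiteNoise k 1 := lintegral_const_mul _ (by fun_prop)
    _ ≤ ENNReal.ofReal (16 ^ k) * (ENNReal.ofReal (σ ^ k * Real.exp (2 * (∑ i, ‖x i‖ ^ 2) / σ))
          * ∫⁻ y, G y ∂whiteNoise k σ) := by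
        gcongr
        exact lintegral_exp_mul_shift_whiteNoise_le hσ x hGm
    _ ≤ _ := by
        rw [← mul_assoc, ← ENNReal.ofReal_mul (by positivity), mul_pow]
        gcongr
        exact pow_mul_exp_le h0 hE hx

/-! ### Error probability of codes -/

namespace Code

variable (c : Code)

lemma noiseLaw_eq : c.noiseLaw
    = (whiteNoise c.n 1).prod ((whiteNoise c.n 1).prod (whiteNoise c.m 1)) := rfl

instance : IsProbabilityMeasure c.noiseLaw := by rw [noiseLaw_eq]; infer_instance

lemma measurable_yD1 (w : Fin c.M₁ × Fin c.M₂) :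
    Measurable fun p : (Link → ℂ) × c.Noise => c.yD1 w p.1 p.2 := by
  unfold yD1; fun_prop

lemma measurable_yR (w : Fin c.M₁ × Fin c.M₂) :
    Measurable fun p : (Link → ℂ) × c.Noise => c.yR w p.1 p.2 := by
  unfold yR; fun_prop

lemma measurable_yD2 (w : Fin c.M₁ × Fin c.M₂) :
    Measurable fun p : (Link → ℂ) × c.Noise => c.yD2 w p.1 p.2 := by
  have h := c.measurable_relay.comp (measurable_fst.prodMk (c.measurable_yR w))
  refine measurable_pi_lambda _ fun i => ?_
  have hi := (measurable_pi_apply i).comp h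
  simp only [Function.comp_def] at hi
  unfold yD2
  fun_prop

lemma measurable_decoded (w : Fin c.M₁ × Fin c.M₂) :
    Measurable fun p : (Link → ℂ) × c.Noise => c.dec (p.1, c.yD1 w p.1 p.2, c.yD2 w p.1 p.2) :=
  c.measurable_dec.comp (measurable_fst.prodMk ((c.measurable_yD1 w).prodMk (c.measurable_yD2 w)))

/-- The probability of correct decoding of the message pair `w` over the channel `h`. -/
def correctProb (h : Link → ℂ) (w : Fin c.M₁ × Fin c.M₂) : ℝ≥0∞ :=
  c.noiseLaw {z | c.dec (h, c.yD1 w h z, c.yD2 w h z) = w}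

lemma measurableSet_correct (w : Fin c.M₁ × Fin c.M₂) :
    MeasurableSet {p : (Link → ℂ) × c.Noise | c.dec (p.1, c.yD1 w p.1 p.2, c.yD2 w p.1 p.2) = w} :=
  c.measurable_decoded w (measurableSet_singleton w)

/-- On `E` the average probability of success is at most 1/2. For each message pair, P(E) is at most
the error probability plus the probability of success within `E`; summing over the pairs gives the
claim. -/
lemma half_measureReal_le_errorProb (v : Link → ℝ≥0) {E : Set (Link → ℂ)} (hE : MeasurableSet E)
    (h : ∀ g ∈ E, ∑ w, c.correctProb g w ≤ ENNReal.ofReal (c.M₁ * c.M₂ / 2)) :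
    (fadingLaw v).real E / 2 ≤ c.errorProb v := by
  have hM₁ : (0 : ℝ) < c.M₁ := by exact_mod_cast c.M₁_pos
  have hM₂ : (0 : ℝ) < c.M₂ := by exact_mod_cast c.M₂_pos
  set μ := (fadingLaw v).prod c.noiseLaw with hμ
  have hμf : ∀ s, μ s ≠ ∞ := fun s => measure_ne_top ((fadingLaw v).prod c.noiseLaw) s
  have hcm : ∀ w, Measurable fun g => c.correctProb g w := fun w =>
    measurable_measure_prodMk_left (c.measurableSet_correct w)
  have h1 : ∀ w, fadingLaw v E ≤ μ {p | c.dec (p.1, c.yD1 w p.1 p.2, c.yD2 w p.1 p.2) ≠ w}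
      + ∫⁻ g in E, c.correctProb g w ∂fadingLaw v := by
    intro w
    have e1 : ∫⁻ g in E, c.correctProb g w ∂fadingLaw v
        = μ ((E ×ˢ Set.univ) ∩ {p | c.dec (p.1, c.yD1 w p.1 p.2, c.yD2 w p.1 p.2) = w}) := by
      rw [hμ, Measure.prod_apply ((hE.prod .univ).inter (c.measurableSet_correct w)),
        ← lintegral_indicator hE]
      refine lintegral_congr fun g => ?_
      by_cases hg : g ∈ E
      · rw [Set.indicator_of_mem hg, correctProb]
        congr 1
        ext z
        simp [hg]
      · rw [Set.indicator_of_notMem hg]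
        symm
        convert measure_empty (μ := c.noiseLaw)
        ext z
        simp [hg]
    have e2 : fadingLaw v E = μ (E ×ˢ Set.univ) := by simp [hμ, Measure.prod_prod]
    rw [e1, e2]
    refine (measure_mono ?_).trans (measure_union_le _ _)
    intro p hp
    by_cases hc : c.dec (p.1, c.yD1 w p.1 p.2, c.yD2 w p.1 p.2) = w
    · exact Or.inr ⟨hp, hc⟩
    · exact Or.inl hc
  have h2 : (c.M₁ * c.M₂ : ℝ≥0∞) * fadingLaw v E
      ≤ ∑ w, μ {p | c.dec (p.1, c.yD1 w p.1 p.2, c.yD2 w p.1 p.2) ≠ w}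
        + ENNReal.ofReal (c.M₁ * c.M₂ / 2) * fadingLaw v E := by
    calc (c.M₁ * c.M₂ : ℝ≥0∞) * fadingLaw v E
        = ∑ _w : Fin c.M₁ × Fin c.M₂, fadingLaw v E := by simp
      _ ≤ _ := Finset.sum_le_sum fun w _ => h1 w
      _ = ∑ w, μ {p | c.dec (p.1, c.yD1 w p.1 p.2, c.yD2 w p.1 p.2) ≠ w}
          + ∫⁻ g in E, ∑ w, c.correctProb g w ∂fadingLaw v := by
        rw [Finset.sum_add_distrib, lintegral_finsetSum _ fun w _ => hcm w]
      _ ≤ _ := by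
        gcongr
        rw [← setLIntegral_const]
        exact setLIntegral_mono measurable_const h
  have hf1 := ENNReal.sum_ne_top.2 fun w (_ : w ∈ Finset.univ) =>
    hμf {p | c.dec (p.1, c.yD1 w p.1 p.2, c.yD2 w p.1 p.2) ≠ w}
  have hf2 := ENNReal.mul_ne_top (ENNReal.ofReal_ne_top (r := c.M₁ * c.M₂ / 2))
    (measure_ne_top (fadingLaw v) E)
  have h3 := ENNReal.toReal_mono (ENNReal.add_ne_top.2 ⟨hf1, hf2⟩) h2
  rw [ENNReal.toReal_add hf1 hf2, ENNReal.toReal_mul, ENNReal.toReal_mul,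
    ENNReal.toReal_mul, ENNReal.toReal_sum (fun _ _ => hμf _),
    ENNReal.toReal_ofReal (by positivity), ENNReal.toReal_natCast, ENNReal.toReal_natCast] at h3
  rw [errorProb, le_div_iff₀ (by positivity)]
  simp only [measureReal_def] at h3 ⊢
  linarith

/-! #### Bounds for the probability of correct decoding -/

lemma correctProb_eq_lintegral (h : Link → ℂ) (w : Fin c.M₁ × Fin c.M₂) :
    c.correctProb h w = ∫⁻ z₁, ∫⁻ zR, ∫⁻ z₂,
      Set.indicator {z : c.Noise | c.dec (h, c.yD1 w h z, c.yD2 w h z) = w} 1 (z₁, zR, z₂)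
      ∂whiteNoise c.m 1 ∂whiteNoise c.n 1 ∂whiteNoise c.n 1 := by
  have hs : MeasurableSet {z : c.Noise | c.dec (h, c.yD1 w h z, c.yD2 w h z) = w} :=
    (c.measurableSet_correct w).preimage measurable_prodMk_left
  have hm : Measurable (Set.indicator {z : c.Noise | c.dec (h, c.yD1 w h z, c.yD2 w h z) = w}
    (1 : c.Noise → ℝ≥0∞)) := measurable_one.indicator hs
  rw [correctProb, ← lintegral_indicator_one hs, noiseLaw_eq, lintegral_prod _ hm.aemeasurable]
  refine lintegral_congr fun z₁ => ?_
  rw [lintegral_prod _ (by fun_prop)]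

/-- The destination receives signals whose power is at most `E` per symbol. -/
lemma correctProb_le_of_received_power {σ : ℝ≥0} (hσ : 8 ≤ σ) {E : ℝ} (hE : E ≤ σ)
    (h : Link → ℂ) (w : Fin c.M₁ × Fin c.M₂)
    (h₁ : ∑ i, ‖h .s1D * c.enc₁₁ w.1 i + h .s2D * c.enc₂₁ w.2 i‖ ^ 2 ≤ c.n * E)
    (h₂ : ∀ y, ∑ i, ‖h .s1D * c.enc₁₂ w.1 i + h .s2D * c.enc₂₂ w.2 i
      + h .rD * c.relay (h, y) i‖ ^ 2 ≤ c.m * E) :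
    c.correctProb h w ≤ ENNReal.ofReal ((Real.exp 2 * σ) ^ (c.n + c.m))
      * ((whiteNoise c.n σ).prod (whiteNoise c.m σ)) ((fun p => c.dec (h, p)) ⁻¹' {w}) := by
  have hd : Measurable fun p => c.dec (h, p) := c.measurable_dec.comp measurable_prodMk_left
  have hs : MeasurableSet ((fun p => c.dec (h, p)) ⁻¹' {w}) := hd (measurableSet_singleton w)
  set F : (Fin c.n → ℂ) × (Fin c.m → ℂ) → ℝ≥0∞ := Set.indicator ((fun p => c.dec (h, p)) ⁻¹' {w}) 1
    with hF
  have hFm : Measurable F := measurable_one.indicator hs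
  rw [correctProb_eq_lintegral, ← lintegral_indicator_one hs, lintegral_prod _ hFm.aemeasurable]
  set G : (Fin c.n → ℂ) → ℝ≥0∞ := fun y => ∫⁻ y₂, F (y, y₂) ∂whiteNoise c.m σ with hG
  have hGm : Measurable G := hFm.lintegral_prod_right'
  set x₁ : Fin c.n → ℂ := fun i => h .s1D * c.enc₁₁ w.1 i + h .s2D * c.enc₂₁ w.2 i with hx₁
  -- The noise of slot 2 is integrated first, with the relay's observation frozen. The power bound
  -- is uniform in that observation, so `zR` drops out.
  have hin : ∀ z₁ zR, ∫⁻ z₂,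
      Set.indicator {z : c.Noise | c.dec (h, c.yD1 w h z, c.yD2 w h z) = w} 1 (z₁, zR, z₂)
        ∂whiteNoise c.m 1
      ≤ ENNReal.ofReal ((Real.exp 2 * σ) ^ c.m) * G (x₁ + z₁) := by
    intro z₁ zR
    -- The relay's output does not involve the slot-2 noise, so 0 may stand in its place.
    exact lintegral_shift_whiteNoise_le_pow hσ hE (h₂ (c.yR w h (z₁, zR, 0)))
      (f := fun y => F (x₁ + z₁, y)) (by fun_prop)
  calc _ ≤ ∫⁻ z₁, ∫⁻ _zR, ENNReal.ofReal ((Real.exp 2 * σ) ^ c.m) * G (x₁ + z₁)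
          ∂whiteNoise c.n 1 ∂whiteNoise c.n 1 :=
        lintegral_mono fun z₁ => lintegral_mono fun zR => hin z₁ zR
    _ = ENNReal.ofReal ((Real.exp 2 * σ) ^ c.m) * ∫⁻ z₁, G (x₁ + z₁) ∂whiteNoise c.n 1 := by
        rw [← lintegral_const_mul _ (by fun_prop)]
        simp
    _ ≤ ENNReal.ofReal ((Real.exp 2 * σ) ^ c.m) * (ENNReal.ofReal ((Real.exp 2 * σ) ^ c.n)
          * ∫⁻ y, G y ∂whiteNoise c.n σ) := by
        gcongr
        exact lintegral_shift_whiteNoise_le_pow hσ hE h₁ hGm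
    _ = _ := by
        rw [← mul_assoc, ← ENNReal.ofReal_mul (by positivity), ← pow_add, add_comm c.m]

/-- The dominating law is the same for all messages and the decoding regions are disjoint, so their
probabilities sum to at most 1. -/
lemma sum_correctProb_le_of_received_power {σ : ℝ≥0} (hσ : 8 ≤ σ) {E : ℝ} (hE : E ≤ σ)
    (h : Link → ℂ)
    (h₁ : ∀ w : Fin c.M₁ × Fin c.M₂,
      ∑ i, ‖h .s1D * c.enc₁₁ w.1 i + h .s2D * c.enc₂₁ w.2 i‖ ^ 2 ≤ c.n * E)
    (h₂ : ∀ (w : Fin c.M₁ × Fin c.M₂) y, ∑ i, ‖h .s1D * c.enc₁₂ w.1 i + h .s2D * c.enc₂₂ w.2 i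
      + h .rD * c.relay (h, y) i‖ ^ 2 ≤ c.m * E) :
    ∑ w, c.correctProb h w ≤ ENNReal.ofReal ((Real.exp 2 * σ) ^ (c.n + c.m)) := by
  have hd : Measurable fun p => c.dec (h, p) := c.measurable_dec.comp measurable_prodMk_left
  calc _ ≤ ∑ w, ENNReal.ofReal ((Real.exp 2 * σ) ^ (c.n + c.m))
        * ((whiteNoise c.n σ).prod (whiteNoise c.m σ)) ((fun p => c.dec (h, p)) ⁻¹' {w}) :=
        Finset.sum_le_sum fun w _ => c.correctProb_le_of_received_power hσ hE h w (h₁ w) (h₂ w)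
    _ ≤ ENNReal.ofReal ((Real.exp 2 * σ) ^ (c.n + c.m)) * 1 := by
        rw [← Finset.mul_sum, sum_measure_preimage_singleton _
          fun w _ => hd (measurableSet_singleton w)]
        gcongr
        exact prob_le_one
    _ = _ := mul_one _

/-- A decoder of the first message that knows the second message and sees `(y, y', y'')`, where
`y` is the destination's first output without the signal of source 2, `a • y + y'` is the relay's
output without that signal, and `y''` is the destination's second output without the signals of
source 2 and of the relay. -/
def genieDecoder (h : Link → ℂ) (a : ℂ) (w₂ : Fin c.M₂) (t : c.Noise) : Fin c.M₁ :=
  (c.dec (h, (fun i => h .s2D * c.enc₂₁ w₂ i) + t.1,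
    (fun i => h .s2D * c.enc₂₂ w₂ i
      + h .rD * c.relay (h, (fun i => h .s2R * c.enc₂₁ w₂ i) + a • t.1 + t.2.1) i) + t.2.2)).1

lemma measurable_genieDecoder (h : Link → ℂ) (a : ℂ) (w₂ : Fin c.M₂) :
    Measurable (c.genieDecoder h a w₂) := by
  have hrel : Measurable fun t : c.Noise =>
      c.relay (h, (fun i => h .s2R * c.enc₂₁ w₂ i) + a • t.1 + t.2.1) :=
    c.measurable_relay.comp (by fun_prop)
  refine measurable_fst.comp (c.measurable_dec.comp ?_)
  refine measurable_const.prodMk ((by fun_prop : Measurable _).prodMk ?_)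
  refine Measurable.add (measurable_pi_lambda _ fun i => ?_) (by fun_prop)
  have := (measurable_pi_apply i).comp hrel
  simp only [Function.comp_def] at this
  fun_prop

/-- The noise terms a z₁ cancel: adding a times the destination's output to the signal-free
difference restores the relay's output, since h₁R = a h₁D. -/
lemma genieDecoder_eq (h : Link → ℂ) {a : ℂ} (hah : h .s1R = a * h .s1D)
    (w : Fin c.M₁ × Fin c.M₂) (z : c.Noise) :
    c.genieDecoder h a w.2 ((fun i => h .s1D * c.enc₁₁ w.1 i) + z.1, -(a • z.1) + z.2.1,
      (fun i => h .s1D * c.enc₁₂ w.1 i) + z.2.2) = (c.dec (h, c.yD1 w h z, c.yD2 w h z)).1 := by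
  have e1 : (fun i => h .s2D * c.enc₂₁ w.2 i) + ((fun i => h .s1D * c.enc₁₁ w.1 i) + z.1)
      = c.yD1 w h z := by
    funext i
    simp only [yD1, Pi.add_apply]
    ring
  have e2 : (fun i => h .s2R * c.enc₂₁ w.2 i) + a • ((fun i => h .s1D * c.enc₁₁ w.1 i) + z.1)
      + (-(a • z.1) + z.2.1) = c.yR w h z := by
    funext i
    simp only [yR, Pi.add_apply, Pi.smul_apply, Pi.neg_apply, smul_eq_mul, hah]
    ring
  have e3 : (fun i => h .s2D * c.enc₂₂ w.2 i + h .rD * c.relay (h, c.yR w h z) i)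
      + ((fun i => h .s1D * c.enc₁₂ w.1 i) + z.2.2) = c.yD2 w h z := by
    funext i
    simp only [yD2, Pi.add_apply]
    ring
  simp only [genieDecoder, e1, e2, e3]

/-- The relay hears a multiple of the signal of source 1 that the destination hears. -/
lemma correctProb_le_of_source1_power {σ : ℝ≥0} (hσ : 8 ≤ σ) {E : ℝ} (hE : E ≤ σ)
    (h : Link → ℂ) {a : ℂ} (ha : ‖a‖ ^ 2 ≤ 2) (hah : h .s1R = a * h .s1D)
    (w : Fin c.M₁ × Fin c.M₂)
    (h₁ : ∑ i, ‖h .s1D * c.enc₁₁ w.1 i‖ ^ 2 ≤ c.n * E)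
    (h₂ : ∑ i, ‖h .s1D * c.enc₁₂ w.1 i‖ ^ 2 ≤ c.m * E) :
    c.correctProb h w ≤ ENNReal.ofReal ((16 * (Real.exp 2 * σ)) ^ (c.n + c.m))
      * ((whiteNoise c.n σ).prod ((whiteNoise c.n 16).prod (whiteNoise c.m σ)))
        (c.genieDecoder h a w.2 ⁻¹' {w.1}) := by
  set D := c.genieDecoder h a w.2 with hDdef
  have hD : Measurable D := c.measurable_genieDecoder h a w.2
  have hs : MeasurableSet (D ⁻¹' {w.1}) := hD (measurableSet_singleton _)
  set F : c.Noise → ℝ≥0∞ := Set.indicator (D ⁻¹' {w.1}) 1 with hF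
  have hFm : Measurable F := measurable_one.indicator hs
  set x₁ : Fin c.n → ℂ := fun i => h .s1D * c.enc₁₁ w.1 i with hx₁
  set x₂ : Fin c.m → ℂ := fun i => h .s1D * c.enc₁₂ w.1 i with hx₂
  set G : (Fin c.n → ℂ) × (Fin c.n → ℂ) → ℝ≥0∞ := fun p => ∫⁻ y, F (p.1, p.2, y) ∂whiteNoise c.m σ
    with hG
  have hGm : Measurable G := Measurable.lintegral_prod_right'
    (f := fun q : ((Fin c.n → ℂ) × (Fin c.n → ℂ)) × (Fin c.m → ℂ) => F (q.1.1, q.1.2, q.2))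
    (by fun_prop)
  -- Correct decoding of the pair is relaxed to correct decoding of the first message.
  have hle : ∀ z₁ zR z₂,
      Set.indicator {z : c.Noise | c.dec (h, c.yD1 w h z, c.yD2 w h z) = w} 1 (z₁, zR, z₂)
        ≤ F (x₁ + z₁, -(a • z₁) + zR, x₂ + z₂) := by
    intro z₁ zR z₂
    refine Set.indicator_apply_le' (fun hz => ?_) fun _ => zero_le
    have hz' : D (x₁ + z₁, -(a • z₁) + zR, x₂ + z₂) = w.1 :=
      (c.genieDecoder_eq h hah w (z₁, zR, z₂)).trans (congrArg Prod.fst hz)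
    rw [hF, Set.indicator_of_mem (by exact hz')]
    rfl
  have hin : ∀ z₁ zR, ∫⁻ z₂,
      Set.indicator {z : c.Noise | c.dec (h, c.yD1 w h z, c.yD2 w h z) = w} 1 (z₁, zR, z₂)
        ∂whiteNoise c.m 1
      ≤ ENNReal.ofReal ((Real.exp 2 * σ) ^ c.m) * G (x₁ + z₁, -(a • z₁) + zR) := by
    intro z₁ zR
    refine (lintegral_mono fun z₂ => hle z₁ zR z₂).trans ?_
    exact lintegral_shift_whiteNoise_le_pow hσ hE h₂
      (f := fun y => F (x₁ + z₁, -(a • z₁) + zR, y)) (by fun_prop)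
  rw [correctProb_eq_lintegral, ← lintegral_indicator_one hs, lintegral_prod _ hFm.aemeasurable]
  have hQ : ∀ y, ∫⁻ q, F (y, q) ∂(whiteNoise c.n 16).prod (whiteNoise c.m σ)
      = ∫⁻ y', G (y, y') ∂whiteNoise c.n 16 := fun y => by
    rw [lintegral_prod _ (by fun_prop)]
  simp_rw [hQ]
  calc _ ≤ ∫⁻ z₁, ∫⁻ zR, ENNReal.ofReal ((Real.exp 2 * σ) ^ c.m) * G (x₁ + z₁, -(a • z₁) + zR)
          ∂whiteNoise c.n 1 ∂whiteNoise c.n 1 :=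
        lintegral_mono fun z₁ => lintegral_mono fun zR => hin z₁ zR
    _ ≤ ENNReal.ofReal ((16 * (Real.exp 2 * σ)) ^ c.n)
        * ∫⁻ y, ∫⁻ y', ENNReal.ofReal ((Real.exp 2 * σ) ^ c.m) * G (y, y')
          ∂whiteNoise c.n 16 ∂whiteNoise c.n σ :=
        lintegral_shear_whiteNoise_le hσ hE h₁ ha
          (f := fun p => ENNReal.ofReal ((Real.exp 2 * σ) ^ c.m) * G p) (by fun_prop)
    _ = ENNReal.ofReal ((16 * (Real.exp 2 * σ)) ^ c.n) * (ENNReal.ofReal ((Real.exp 2 * σ) ^ c.m)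
        * ∫⁻ y, ∫⁻ y', G (y, y') ∂whiteNoise c.n 16 ∂whiteNoise c.n σ) := by
        rw [← lintegral_const_mul _ hGm.lintegral_prod_right']
        congr 2
        funext y
        rw [lintegral_const_mul _ (by fun_prop)]
    _ ≤ _ := by
        rw [← mul_assoc, ← ENNReal.ofReal_mul (by positivity), pow_add]
        refine mul_le_mul' (ENNReal.ofReal_le_ofReal (mul_le_mul_of_nonneg_left
          (pow_le_pow_left₀ (by positivity) ?_ _) (by positivity))) le_rfl
        have : 0 ≤ Real.exp 2 * σ := by positivity
        linarith

/-- The dominating law is free of the first message and the decoder depends on the second, so the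
regions are disjoint for each fixed second message only; hence the factor `M₂`. -/
lemma sum_correctProb_le_of_source1_power {σ : ℝ≥0} (hσ : 8 ≤ σ) {E : ℝ} (hE : E ≤ σ)
    (h : Link → ℂ) {a : ℂ} (ha : ‖a‖ ^ 2 ≤ 2) (hah : h .s1R = a * h .s1D)
    (h₁ : ∀ w, ∑ i, ‖h .s1D * c.enc₁₁ w i‖ ^ 2 ≤ c.n * E)
    (h₂ : ∀ w, ∑ i, ‖h .s1D * c.enc₁₂ w i‖ ^ 2 ≤ c.m * E) :
    ∑ w, c.correctProb h w
      ≤ c.M₂ * ENNReal.ofReal ((16 * (Real.exp 2 * σ)) ^ (c.n + c.m)) := by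
  rw [Fintype.sum_prod_type_right]
  calc _ ≤ ∑ _w₂ : Fin c.M₂, ENNReal.ofReal ((16 * (Real.exp 2 * σ)) ^ (c.n + c.m)) * 1 := by
        refine Finset.sum_le_sum fun w₂ _ => ?_
        refine (Finset.sum_le_sum fun w₁ _ =>
          c.correctProb_le_of_source1_power hσ hE h ha hah (w₁, w₂) (h₁ w₁) (h₂ w₁)).trans ?_
        rw [← Finset.mul_sum, sum_measure_preimage_singleton _
          fun w₁ _ => c.measurable_genieDecoder h a w₂ (measurableSet_singleton w₁)]
        gcongr
        exact prob_le_one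
    _ = _ := by simp

end Code

/-! ### The diversity gain of arbitrary codes -/

/-- The factor 2 in 2K ≤ x becomes 2^l ≥ 2 because l ≥ 1, which yields the half at every block
length. -/
lemma pow_le_half_of_log_le {K x M : ℝ} {l : ℕ} (hl : 0 < l) (hK : 0 ≤ K) (hx : 0 < x)
    (hKx : 2 * K ≤ x) (hM : 0 < M) (h : l * Real.log x ≤ Real.log M) : K ^ l ≤ M / 2 := by
  have h1 : x ^ l ≤ M := by
    rwa [← Real.log_le_log_iff (pow_pos hx l) hM, Real.log_pow]
  have h2 : 2 * K ^ l ≤ (2 * K) ^ l := by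
    rw [mul_pow]
    gcongr
    exact le_self_pow₀ one_le_two hl.ne'
  have h3 : (2 * K) ^ l ≤ x ^ l := pow_le_pow_left₀ (by positivity) hKx l
  linarith

lemma sum_norm_mul_sq_le {k : ℕ} {g : ℂ} {x : Fin k → ℂ} {snr E : ℝ}
    (hx : ∑ i, ‖x i‖ ^ 2 ≤ k * snr) (hE : ‖g‖ ^ 2 * snr ≤ E) :
    ∑ i, ‖g * x i‖ ^ 2 ≤ k * E := by
  simp_rw [norm_mul, mul_pow]
  rw [← Finset.mul_sum]
  calc ‖g‖ ^ 2 * ∑ i, ‖x i‖ ^ 2 ≤ ‖g‖ ^ 2 * (k * snr) := by gcongr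
    _ = k * (‖g‖ ^ 2 * snr) := by ring
    _ ≤ k * E := by gcongr

lemma sum_norm_add_add_sq_le {k : ℕ} {x y z : Fin k → ℂ} {E : ℝ}
    (hx : ∑ i, ‖x i‖ ^ 2 ≤ k * E) (hy : ∑ i, ‖y i‖ ^ 2 ≤ k * E) (hz : ∑ i, ‖z i‖ ^ 2 ≤ k * E) :
    ∑ i, ‖x i + y i + z i‖ ^ 2 ≤ k * (9 * E) := by
  have h : ∀ i, ‖x i + y i + z i‖ ^ 2 ≤ 3 * ‖x i‖ ^ 2 + 3 * ‖y i‖ ^ 2 + 3 * ‖z i‖ ^ 2 := by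
    intro i
    have := norm_add₃_le (a := x i) (b := y i) (c := z i)
    calc ‖x i + y i + z i‖ ^ 2 ≤ (‖x i‖ + ‖y i‖ + ‖z i‖) ^ 2 := by gcongr
      _ ≤ _ := by
        nlinarith [sq_nonneg (‖x i‖ - ‖y i‖), sq_nonneg (‖y i‖ - ‖z i‖), sq_nonneg (‖x i‖ - ‖z i‖)]
  calc _ ≤ ∑ i, (3 * ‖x i‖ ^ 2 + 3 * ‖y i‖ ^ 2 + 3 * ‖z i‖ ^ 2) := Finset.sum_le_sum fun i _ => h i
    _ = 3 * ∑ i, ‖x i‖ ^ 2 + 3 * ∑ i, ‖y i‖ ^ 2 + 3 * ∑ i, ‖z i‖ ^ 2 := by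
        simp_rw [Finset.sum_add_distrib, Finset.mul_sum]
    _ ≤ _ := by linarith

lemma mul_le_rpow_of_le_rpow {snr x s : ℝ} (h0 : 0 < snr) (hx : x ≤ snr ^ (-(1 - s))) :
    x * snr ≤ snr ^ s := by
  calc x * snr ≤ snr ^ (-(1 - s)) * snr ^ (1 : ℝ) := by rw [Real.rpow_one]; gcongr
    _ = _ := by rw [← Real.rpow_add h0]; congr 1; ring

lemma Code.log_M₁_eq (c : Code) : Real.log c.M₁ = ((c.n + c.m : ℕ) : ℝ) * c.rate₁ := by
  have : ((c.n + c.m : ℕ) : ℝ) ≠ 0 := by exact_mod_cast c.length_pos.ne'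
  rw [Code.rate₁, ← Nat.cast_add]
  field_simp

lemma Code.log_M₂_eq (c : Code) : Real.log c.M₂ = ((c.n + c.m : ℕ) : ℝ) * c.rate₂ := by
  have : ((c.n + c.m : ℕ) : ℝ) ≠ 0 := by exact_mod_cast c.length_pos.ne'
  rw [Code.rate₂, ← Nat.cast_add]
  field_simp

lemma eventually_mul_log_le {R : ℝ → ℝ} {r s : ℝ} (hsr : s < r)
    (hR : Filter.Tendsto (fun snr => R snr / Real.log snr) Filter.atTop (𝓝 r)) :
    ∀ᶠ snr in Filter.atTop, s * Real.log snr ≤ R snr := by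
  filter_upwards [hR.eventually_const_le hsr, Filter.eventually_gt_atTop 1] with snr h1 h2
  rwa [le_div_iff₀ (Real.log_pos h2)] at h1

lemma diversityAtMost_errorProb_of_gainBox {v : Link → ℝ≥0} (hv : ∀ i, 0 < v i) {d : ℝ}
    {C : ℝ → Code}
    (h : ∀ ε > 0, ∃ e : Link → ℝ, (∀ i, 0 ≤ e i) ∧ ∑ i, e i < d + ε ∧
      ∀ᶠ snr : ℝ in Filter.atTop, ∀ g ∈ gainBox e snr,
        ∑ w, (C snr).correctProb g w ≤ ENNReal.ofReal ((C snr).M₁ * (C snr).M₂ / 2)) :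
    DiversityAtMost (fun snr => (C snr).errorProb v) d := by
  intro ε hε
  obtain ⟨e, he, hd, hE⟩ := h ε hε
  filter_upwards [eventually_le_gainBox hv he hd 2, hE] with snr h1 h2
  have h3 := (C snr).half_measureReal_le_errorProb v (measurableSet_gainBox e snr) h2
  linarith

/-- The event that source 1 is received too weakly at the relay and at the destination. -/
lemma diversityAtMost_errorProb_two_sub {v : Link → ℝ≥0} (hv : ∀ i, 0 < v i) {r : ℝ} (hr : 0 < r)
    (hr1 : r ≤ 1) {C : ℝ → Code} (hP : ∀ᶠ snr in Filter.atTop, (C snr).PowerConstraint snr)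
    (h₁ : Filter.Tendsto (fun snr => (C snr).rate₁ / Real.log snr) Filter.atTop (𝓝 (r / 2))) :
    DiversityAtMost (fun snr => (C snr).errorProb v) (2 - r) := by
  refine diversityAtMost_errorProb_of_gainBox hv fun ε hε => ?_
  -- The event costs 2 - r + 2δ, which 4δ ≤ ε keeps below 2 - r + ε; 4δ ≤ r keeps the powers of S
  -- below positive. The rate is only used down to r/2 - δ/2, leaving S^(δ/2) over the received
  -- power to beat constants.
  obtain ⟨δ, hδ, hδε, hδr⟩ : ∃ δ > 0, 4 * δ ≤ ε ∧ 4 * δ ≤ r :=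
    ⟨min (ε / 4) (r / 4), by positivity, by linarith [min_le_left (ε / 4) (r / 4)],
      by linarith [min_le_right (ε / 4) (r / 4)]⟩
  refine ⟨fun | .s1D => 1 - (r / 2 - δ) | .s1R => 1 - (r / 2 - δ) | _ => 0, ?_, ?_, ?_⟩
  · rintro (_ | _ | _ | _ | _) <;> simp <;> linarith
  · simp [sum_link]; linarith
  filter_upwards [hP, Filter.eventually_gt_atTop 1,
    eventually_mul_log_le (s := r / 2 - δ / 2) (by linarith) h₁,
    eventually_const_add_const_mul_rpow_lt (r := r / 2 - δ / 2) (δ := δ / 2) (by linarith)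
      (by linarith) (2 * (16 * (Real.exp 2 * 8)))] with snr hpow hs hrate hlt g hg
  have h0 : 0 < snr := by linarith
  set c := C snr with hc
  obtain ⟨hp1, hp2, -, -, -⟩ := hpow
  rw [show r / 2 - δ / 2 - δ / 2 = r / 2 - δ by ring] at hlt
  set P := snr ^ (r / 2 - δ) with hPdef
  have hP0 : 0 < P := by positivity
  -- Large enough for both requirements: the threshold 8 and the received power P per symbol.
  set σ : ℝ≥0 := 8 + ⟨P, hP0.le⟩ with hσ
  have hσc : (σ : ℝ) = 8 + P := rfl
  have hD := mul_le_rpow_of_le_rpow h0 (hg .s1D).2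
  have hpos : 0 < ‖g .s1D‖ ^ 2 := lt_of_lt_of_le (by positivity) (hg .s1D).1
  have hne : g .s1D ≠ 0 := fun h => by simp [h] at hpos
  -- Both squared gains lie in the same interval [ρ/2, ρ]; this is where the lower bounds in
  -- `gainBox` are needed.
  have ha : ‖g .s1R / g .s1D‖ ^ 2 ≤ 2 := by
    rw [norm_div, div_pow, div_le_iff₀ hpos]
    have e1 := (hg .s1R).2
    have e2 := (hg .s1D).1
    linarith
  have hsum := c.sum_correctProb_le_of_source1_power (σ := σ) (E := P) (by rw [hσ]; exact le_self_add)
    (by rw [hσc]; linarith) g ha (div_mul_cancel₀ _ hne).symm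
    (fun w => sum_norm_mul_sq_le (hp1 w) hD) (fun w => sum_norm_mul_sq_le (hp2 w) hD)
  refine hsum.trans ?_
  have hM : (16 * (Real.exp 2 * σ)) ^ (c.n + c.m) ≤ (c.M₁ : ℝ) / 2 := by
    refine pow_le_half_of_log_le c.length_pos (by positivity)
      (Real.rpow_pos_of_pos h0 (r / 2 - δ / 2)) ?_ (by exact_mod_cast c.M₁_pos) ?_
    · have := Real.exp_pos 2
      rw [hσc]
      nlinarith [mul_pos this hP0]
    · rw [Real.log_rpow h0, c.log_M₁_eq]
      gcongr
  calc (c.M₂ : ℝ≥0∞) * ENNReal.ofReal ((16 * (Real.exp 2 * σ)) ^ (c.n + c.m))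
      ≤ c.M₂ * ENNReal.ofReal (c.M₁ / 2) := by gcongr
    _ = _ := by
      rw [← ENNReal.ofReal_natCast, ← ENNReal.ofReal_mul (by positivity)]
      congr 1
      ring

/-- The event that both sources and the relay are received too weakly at the destination. -/
lemma diversityAtMost_errorProb_three_mul {v : Link → ℝ≥0} (hv : ∀ i, 0 < v i) {r : ℝ} (hr : 0 < r)
    (hr1 : r ≤ 1) {C : ℝ → Code} (hP : ∀ᶠ snr in Filter.atTop, (C snr).PowerConstraint snr)
    (h₁ : Filter.Tendsto (fun snr => (C snr).rate₁ / Real.log snr) Filter.atTop (𝓝 (r / 2)))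
    (h₂ : Filter.Tendsto (fun snr => (C snr).rate₂ / Real.log snr) Filter.atTop (𝓝 (r / 2))) :
    DiversityAtMost (fun snr => (C snr).errorProb v) (3 * (1 - r)) := by
  refine diversityAtMost_errorProb_of_gainBox hv fun ε hε => ?_
  obtain ⟨δ, hδ, hδε, hδr⟩ : ∃ δ > 0, 4 * δ ≤ ε ∧ 4 * δ ≤ r :=
    ⟨min (ε / 4) (r / 4), by positivity, by linarith [min_le_left (ε / 4) (r / 4)],
      by linarith [min_le_right (ε / 4) (r / 4)]⟩
  refine ⟨fun | .s1D => 1 - (r - δ) | .s2D => 1 - (r - δ) | .rD => 1 - (r - δ) | _ => 0, ?_, ?_, ?_⟩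
  · rintro (_ | _ | _ | _ | _) <;> simp <;> linarith
  · simp [sum_link]; linarith
  filter_upwards [hP, Filter.eventually_gt_atTop 1,
    eventually_mul_log_le (s := r / 2 - δ / 4) (by linarith) h₁,
    eventually_mul_log_le (s := r / 2 - δ / 4) (by linarith) h₂,
    eventually_const_add_const_mul_rpow_lt (r := r - δ / 2) (δ := δ / 2) (by linarith)
      (by linarith) (2 * (Real.exp 2 * 9))] with snr hpow hs hrate₁ hrate₂ hlt g hg
  have h0 : 0 < snr := by linarith
  set c := C snr with hc
  obtain ⟨hp11, hp12, hp21, hp22, hpR⟩ := hpow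
  rw [show r - δ / 2 - δ / 2 = r - δ by ring] at hlt
  set P := snr ^ (r - δ) with hPdef
  have hP0 : 0 < P := by positivity
  -- Three signals of power P may add coherently, to power 9P.
  set σ : ℝ≥0 := 8 + ⟨9 * P, by positivity⟩ with hσ
  have hσc : (σ : ℝ) = 8 + 9 * P := rfl
  have hD1 := mul_le_rpow_of_le_rpow h0 (hg .s1D).2
  have hD2 := mul_le_rpow_of_le_rpow h0 (hg .s2D).2
  have hDR := mul_le_rpow_of_le_rpow h0 (hg .rD).2
  have hsum := c.sum_correctProb_le_of_received_power (σ := σ) (E := 9 * P)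
    (by rw [hσ]; exact le_self_add) (by rw [hσc]; linarith) g
    (fun w => by
      -- In slot 1 the relay is silent, so the third signal is 0.
      simpa using sum_norm_add_add_sq_le (sum_norm_mul_sq_le (hp11 w.1) hD1)
        (sum_norm_mul_sq_le (hp21 w.2) hD2) (z := 0) (by simp; positivity))
    (fun w y => sum_norm_add_add_sq_le (sum_norm_mul_sq_le (hp12 w.1) hD1)
        (sum_norm_mul_sq_le (hp22 w.2) hD2) (sum_norm_mul_sq_le (hpR (g, y)) hDR))
  refine hsum.trans (ENNReal.ofReal_le_ofReal ?_)
  have hM₁ : (0 : ℝ) < c.M₁ := by exact_mod_cast c.M₁_pos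
  have hM₂ : (0 : ℝ) < c.M₂ := by exact_mod_cast c.M₂_pos
  refine pow_le_half_of_log_le c.length_pos (by positivity)
    (Real.rpow_pos_of_pos h0 (r - δ / 2)) ?_ (by positivity) ?_
  · have := Real.exp_pos 2
    rw [hσc]
    nlinarith [mul_pos this hP0]
  · rw [Real.log_rpow h0, Real.log_mul hM₁.ne' hM₂.ne', c.log_M₁_eq, c.log_M₂_eq, ← mul_add]
    gcongr
    linarith

theorem diversityAtMost_errorProb {v : Link → ℝ≥0} (hv : ∀ i, 0 < v i) {r : ℝ} (hr : 0 < r)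
    (hr1 : r ≤ 1) {C : ℝ → Code} (hP : ∀ᶠ snr in Filter.atTop, (C snr).PowerConstraint snr)
    (h₁ : Filter.Tendsto (fun snr => (C snr).rate₁ / Real.log snr) Filter.atTop (𝓝 (r / 2)))
    (h₂ : Filter.Tendsto (fun snr => (C snr).rate₂ / Real.log snr) Filter.atTop (𝓝 (r / 2))) :
    DiversityAtMost (fun snr => (C snr).errorProb v) (dmt r) := by
  unfold dmt
  split_ifs
  · exact diversityAtMost_errorProb_two_sub hv hr hr1 hP h₁
  · exact diversityAtMost_errorProb_three_mul hv hr hr1 hP h₁ h₂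

end HDMARC

end

theorem proposition1 (v : HDMARC.Link → ℝ≥0) (hv : ∀ i, 0 < v i) :
    -- the quantizer, chosen without the relay-destination coefficient, has the fixed rate `RU`
    (∀ β : ℝ, 0 < β → β < 1 → ∀ RU : ℝ, 0 < RU → ∀ snr : ℝ, 0 < snr → ∀ h : HDMARC.Link → ℂ,
      ENNReal.ofReal β *
        HDMARC.mutualInfo (HDMARC.gqfLaw snr β RU h) (HDMARC.YR h) (HDMARC.YQ h)
          = ENNReal.ofReal RU) ∧
    -- the outage exponent of the scheme with `β = rU = 1 / 2`
    (∀ r : ℝ, 0 ≤ r → r ≤ 1 →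
      HDMARC.DotEq (HDMARC.gqfOutageProb v (1 / 2) (1 / 2) r) (-HDMARC.dmt r)) ∧
    -- no other choice of `β` and `rU` has a larger outage exponent
    (∀ r : ℝ, 0 < r → r ≤ 1 → ∀ β : ℝ, 0 < β → β < 1 → ∀ rU : ℝ, 0 < rU →
      HDMARC.DiversityAtMost (HDMARC.gqfOutageProb v β rU r) (HDMARC.dmt r)) ∧
    -- no family of half-duplex codes with multiplexing gains `r / 2` has a larger diversity gain
    (∀ r : ℝ, 0 < r → r ≤ 1 → ∀ C : ℝ → HDMARC.Code,
      (∀ᶠ snr in Filter.atTop, (C snr).PowerConstraint snr) →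
      Filter.Tendsto (fun snr => (C snr).rate₁ / Real.log snr) Filter.atTop (𝓝 (r / 2)) →
      Filter.Tendsto (fun snr => (C snr).rate₂ / Real.log snr) Filter.atTop (𝓝 (r / 2)) →
      HDMARC.DiversityAtMost (fun snr => (C snr).errorProb v) (HDMARC.dmt r)) := by
  exact ⟨fun β hβ _ RU hRU snr hs h => HDMARC.mul_mutualInfo_YR_YQ hβ hRU hs h,
    fun r hr hr1 => HDMARC.dotEq_gqfOutageProb hv hr hr1,
    fun r hr hr1 β hβ hβ1 rU hrU => HDMARC.diversityAtMost_gqfOutageProb hv hr hr1 hβ hβ1 hrU,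
    fun r hr hr1 C hP h₁ h₂ => HDMARC.diversityAtMost_errorProb hv hr hr1 hP h₁ h₂⟩
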